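/- Conventions. A triangulation of a compact connected surface $F^2$ (possibly with boundary) is a finite simplicial complex $G$ whose underlying space is homeomorphic to $F^2$; every edge lies in one or two triangular faces, and the link of every vertex is a path or a cycle. The edges lying in exactly one face are the boundary edges, they form the subgraph $\partial G$ triangulating $\partial F^2$, and their ends are the boundary vertices; other vertices and edges are inner. $F^2$ is punctured if it is a closed surface with the interior of one disk removed, i.e. if $\partial G$ is nonempty and connected. Degrees are degrees in the graph of $G$. Let $\mathcal F_\circ^2(4)$ be the class of triangulations of $F^2$ in which every vertex has degree $\ge 3$ and every inner vertex has degree $\ge 4$. An edge $ab$ of $G$ is contractible if identifying its ends (collapsing the faces containing $ab$, with no double edge other than those arising from these faces) yields a triangulation $G/ab$ of $F^2$; $G$ is irreducible if it has no contractible edge. Operations. (1) $G$ is obtained from $G'$ by a 3-splitting of triodes if $G'=G/ab$ for a contractible edge $ab$ of $G$ with $\deg_G a,\deg_G b\ge 3$ that is triode detecting: every vertex of degree 3 in $G'$ that is produced by the contraction (the new vertex, or the third vertex of a face containing $ab$) is a boundary vertex. (2) $G$ is obtained from $G'$ by a 4-splitting if $G'=G/ab$ for a contractible edge $ab$ of $G$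 with $\deg_G a,\deg_G b\ge 4$. (3) A flag of $G$ consists of an inner vertex $x$ of degree 4, none of whose neighbours has degree 4, with link the 4-cycle $x_1abx_2$, such that $x_1a,ab,bx_2$ are boundary edges, $x_1x_2$ is an inner edge with both ends on the boundary, and $\deg a=\deg b=3$. $G$ is obtained from $G'=G-\{a,b,x\}$ by adding a flag. (4) An octahedron component of $G$ consists of six distinct vertices $v_1,v_2,v_3,a_1,a_2,a_3$ such that $v_1v_2v_3$ and $a_1a_2a_3$ are 3-cycles of $G$, each $v_i$ has degree 4, for $\{i,j,k\}=\{1,2,3\}$ the only common neighbour of $v_j,v_k$ other than $v_i$ is $a_i$, and either no $v_i$ is a boundary vertex or the whole of $\partial G$ is one of the 3-cycles $v_ia_ja_k$, $v_iv_ja_k$, $v_1v_2v_3$ (with $i,j,k$ distinct). $G$ is obtained from $G'$ by adding an octahedron if, for such a component, either $G'=G-\{v_1,v_2,v_3\}$, where the 3-cycle $a_1a_2a_3$ bounds a face of $G'$ if no $v_i$ is a boundary vertex of $G$ and bounds the hole of $G'$ otherwise; or $a_ia_j$ and $a_ja_k$ are boundary edges of $G$ for some distinct $i,j,k$, and $G'=G-\{a_j,v_1,v_2,v_3\}$.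 Theorem. Let $F^2$ be a punctured surface other than the disk, and let $G\in\mathcal F_\circ^2(4)$ be a triangulation of $F^2$. Then there are an irreducible triangulation $G_0\in\mathcal F_\circ^2(4)$ of $F^2$ and a finite sequence $G_0,G_1,\dots,G_n=G$ of triangulations of $F^2$, all in $\mathcal F_\circ^2(4)$, such that each $G_{m+1}$ is obtained from $G_m$ by a 3-splitting of triodes, the addition of a flag, a 4-splitting, or the addition of an octahedron. -/

import Mathlib

namespace SurfaceTriangulation

universe u v

variable {V : Type u} [DecidableEq V]

/-! A finite two-dimensional simplicial complex all of whose maximal simplices are triangles is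
recorded by the finite set `T` of its faces (triangles), each face being the set of its three
vertices.  Vertices and edges are those of the faces. -/

/-- The vertices of the complex. -/
def vertices (T : Finset (Finset V)) : Finset V := T.biUnion id

/-- The edges of the complex: the two-element subsets of the faces. -/
def edges (T : Finset (Finset V)) : Finset (Finset V) := T.biUnion (Finset.powersetCard 2)

/-- The vertices adjacent to `x` in the graph of the complex. -/
def neighbors (T : Finset (Finset V)) (x : V) : Finset V :=
  ((T.filter (fun t => x ∈ t)).biUnion id).erase x

/-- The degree of a vertex in the graph of the complex. -/
def deg (T : Finset (Finset V)) (x : V) : ℕ := (neighbors T x).card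

/-- The graph (1-skeleton) of the complex. -/
def skeleton (T : Finset (Finset V)) : SimpleGraph V where
  Adj p q := p ≠ q ∧ {p, q} ∈ edges T
  symm := ⟨fun p q h => ⟨h.1.symm, by rw [Finset.pair_comm]; exact h.2⟩⟩
  loopless := ⟨fun _ h => h.1 rfl⟩

/-- The link of `x`: the edges that form a face together with `x`. -/
def linkGraph (T : Finset (Finset V)) (x : V) : SimpleGraph V where
  Adj p q := p ≠ q ∧ x ≠ p ∧ x ≠ q ∧ {x, p, q} ∈ T
  symm := ⟨fun p q h => ⟨h.1.symm, h.2.2.1, h.2.1, by rw [Finset.pair_comm]; exact h.2.2.2⟩⟩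
  loopless := ⟨fun _ h => h.1 rfl⟩

/-- The boundary edges: the edges that lie in exactly one face. -/
def boundaryEdges (T : Finset (Finset V)) : Finset (Finset V) :=
  (edges T).filter (fun e => (T.filter (fun t => e ⊆ t)).card = 1)

/-- The boundary vertices: the ends of the boundary edges.  All other vertices are inner. -/
def boundaryVertices (T : Finset (Finset V)) : Finset V := (boundaryEdges T).biUnion id

/-- The boundary subgraph `∂T`. -/
def boundaryGraph (T : Finset (Finset V)) : SimpleGraph V where
  Adj p q := p ≠ q ∧ {p, q} ∈ boundaryEdges T
  symm := ⟨fun p q h => ⟨h.1.symm, by rw [Finset.pair_comm]; exact h.2⟩⟩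
  loopless := ⟨fun _ h => h.1 rfl⟩

/-- `T` is the set of faces of a triangulated compact connected surface, possibly with boundary:
every edge lies in at most two faces, and the link of every vertex is connected (so that it is a
path or a cycle). -/
structure IsTriangulatedSurface (T : Finset (Finset V)) : Prop where
  nonempty : T.Nonempty
  card_face : ∀ t ∈ T, t.card = 3
  edge_le_two : ∀ e ∈ edges T, (T.filter (fun t => e ⊆ t)).card ≤ 2
  link_connected : ∀ x ∈ vertices T, ∀ p ∈ neighbors T x, ∀ q ∈ neighbors T x,
    (linkGraph T x).Reachable p q
  connected : ∀ p ∈ vertices T, ∀ q ∈ vertices T, (skeleton T).Reachable p q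

/-- The underlying space of the complex, in barycentric coordinates. -/
def realization (T : Finset (Finset V)) : Set (V → ℝ) :=
  {x | ∃ t ∈ T, (∀ p ∈ t, 0 ≤ x p) ∧ (∀ p, p ∉ t → x p = 0) ∧ ∑ p ∈ t, x p = 1}

/-- `T` is a triangulation of the surface `F`. -/
def Triangulates (F : Type v) [TopologicalSpace F] (T : Finset (Finset V)) : Prop :=
  IsTriangulatedSurface T ∧ Nonempty (realization T ≃ₜ F)

/-- The boundary of the triangulated surface is nonempty and connected: the surface is punctured,
that is, a closed surface with one open disk removed. -/
def HasOneHole (T : Finset (Finset V)) : Prop :=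
  (boundaryEdges T).Nonempty ∧
    ∀ p ∈ boundaryVertices T, ∀ q ∈ boundaryVertices T, (boundaryGraph T).Reachable p q

/-- The class of the triangulations of `F` with minimum degree at least three all of whose inner
vertices have degree at least four. -/
def InClass (F : Type v) [TopologicalSpace F] (T : Finset (Finset V)) : Prop :=
  Triangulates F T ∧ (∀ x ∈ vertices T, 3 ≤ deg T x) ∧
    ∀ x ∈ vertices T, x ∉ boundaryVertices T → 4 ≤ deg T x

/-- The result of contracting the edge `ab`: the vertex `b` is identified with `a`, and the faces
that contain `ab` disappear. -/
def contract (T : Finset (Finset V)) (a b : V) : Finset (Finset V) :=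
  (T.filter (fun t => ¬ (a ∈ t ∧ b ∈ t))).image
    (fun t => t.image (fun p => if p = b then a else p))

/-- The edge `ab` of the triangulation `T` of `F` is contractible: the identification of its ends
gives a triangulation of `F` again.  The only multiple edges that may be removed are those of the
collapsed faces; another common neighbor `c` of `a` and `b` (a critical 3-cycle `abc`) would leave
a double edge, so that the graph obtained would not be simple. -/
def Contractible (F : Type v) [TopologicalSpace F] (T : Finset (Finset V)) (a b : V) : Prop :=
  a ≠ b ∧ {a, b} ∈ edges T ∧
    (∀ c ∈ neighbors T a, c ∈ neighbors T b → {a, b, c} ∈ T) ∧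
    Triangulates F (contract T a b)

/-- `T` has no contractible edge. -/
def Irreducible (F : Type v) [TopologicalSpace F] (T : Finset (Finset V)) : Prop :=
  ∀ a b : V, ¬ Contractible F T a b

/-- A triode: a boundary vertex of degree three. -/
def IsTriode (T : Finset (Finset V)) (x : V) : Prop := x ∈ boundaryVertices T ∧ deg T x = 3

/-- A triode detecting edge: a contractible edge `ab` such that the vertices of degree three
produced by its contraction are triodes.  The vertices whose degree is changed by the contraction
are the new vertex (called `a`) and the third vertices of the faces that contain `ab`. -/
def TriodeDetecting (F : Type v) [TopologicalSpace F] (T : Finset (Finset V)) (a b : V) : Prop :=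
  Contractible F T a b ∧
    ∀ x, (x = a ∨ {a, b, x} ∈ T) → deg (contract T a b) x = 3 → IsTriode (contract T a b) x

/-- `T` is obtained from `T'` by a 3-splitting of triodes: the inverse of the contraction of a
triode detecting edge `ab` of `T`, where `a` and `b` have degree at least three after the
splitting. -/
def TriodeSplitting (F : Type v) [TopologicalSpace F] (T' T : Finset (Finset V)) : Prop :=
  ∃ a b : V, TriodeDetecting F T a b ∧ 3 ≤ deg T a ∧ 3 ≤ deg T b ∧ T' = contract T a b

/-- `T` is obtained from `T'` by a 4-splitting: the inverse of the contraction of a contractible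
edge `ab` of `T`, where `a` and `b` have degree at least four after the splitting. -/
def FourSplitting (F : Type v) [TopologicalSpace F] (T' T : Finset (Finset V)) : Prop :=
  ∃ a b : V, Contractible F T a b ∧ 4 ≤ deg T a ∧ 4 ≤ deg T b ∧ T' = contract T a b

/-- Deletion of the vertices of `S` together with all faces that meet `S`. -/
def deleteVertices (T : Finset (Finset V)) (S : Finset V) : Finset (Finset V) :=
  T.filter (fun t => Disjoint t S)

/-- A flag centered at `x`: `x` is an inner vertex of degree four, none of its neighbors has
degree four, its link is the cycle `x₁ a b x₂`, the edges `x₁a`, `ab`, `bx₂` are boundary edges,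
`x₁x₂` meets the boundary exactly in its ends, and `a`, `b` have degree three. -/
structure IsFlag (T : Finset (Finset V)) (x x₁ a b x₂ : V) : Prop where
  inner : x ∉ boundaryVertices T
  deg_center : deg T x = 4
  neighbors_center : neighbors T x = {x₁, a, b, x₂}
  independent : ∀ y ∈ neighbors T x, deg T y ≠ 4
  link : {x, x₁, a} ∈ T ∧ {x, a, b} ∈ T ∧ {x, b, x₂} ∈ T ∧ {x, x₂, x₁} ∈ T
  boundary : {x₁, a} ∈ boundaryEdges T ∧ {a, b} ∈ boundaryEdges T ∧ {b, x₂} ∈ boundaryEdges T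
  base : {x₁, x₂} ∉ boundaryEdges T ∧ x₁ ∈ boundaryVertices T ∧ x₂ ∈ boundaryVertices T
  deg_boundary : deg T a = 3 ∧ deg T b = 3

/-- `T` is obtained from `T'` by adding a flag along a boundary edge. -/
def FlagAddition (T' T : Finset (Finset V)) : Prop :=
  ∃ x x₁ a b x₂ : V, IsFlag T x x₁ a b x₂ ∧ T' = deleteVertices T {a, b, x}

/-- The boundary of `T` is the 3-cycle with vertices `p`, `q`, `r`. -/
def BoundaryIs (T : Finset (Finset V)) (p q r : V) : Prop :=
  boundaryEdges T = {{p, q}, {q, r}, {p, r}}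

/-- An octahedron component centered at the 3-cycle `v 0, v 1, v 2` with remaining vertices
`a 0, a 1, a 2`: the six vertices are distinct, the `v i` have degree four, `v i` and `v j` are
adjacent, `a i` is the only further common neighbor of `v j` and `v k`, the `a i` are pairwise
adjacent, and either no `v i` is a boundary vertex, or the whole boundary is a 3-cycle
`v i, a j, a k`, or `v i, v j, a k`, or `v 0, v 1, v 2` (with `i, j, k` distinct). -/
structure IsOctahedron (T : Finset (Finset V)) (v a : Fin 3 → V) : Prop where
  v_injective : Function.Injective v
  a_injective : Function.Injective a
  v_ne_a : ∀ i j, v i ≠ a j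
  deg_v : ∀ i, deg T (v i) = 4
  v_adj : ∀ i j, i ≠ j → v j ∈ neighbors T (v i)
  common : ∀ i j k, i ≠ j → i ≠ k → j ≠ k → ∀ w, w ≠ v i →
    (w ∈ neighbors T (v j) ∧ w ∈ neighbors T (v k) ↔ w = a i)
  a_adj : ∀ i j, i ≠ j → a j ∈ neighbors T (a i)
  boundary : (∀ i, v i ∉ boundaryVertices T) ∨
    (∃ i j k, i ≠ j ∧ i ≠ k ∧ j ≠ k ∧ BoundaryIs T (v i) (a j) (a k)) ∨
    (∃ i j k, i ≠ j ∧ i ≠ k ∧ j ≠ k ∧ BoundaryIs T (v i) (v j) (a k)) ∨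
    BoundaryIs T (v 0) (v 1) (v 2)

/-- `T` is obtained from `T'` by adding an octahedron whose central vertices are new.  Deleting
the central vertices of an octahedron component leaves a region bounded by the 3-cycle of the
remaining vertices; it is a face of `T'` if no central vertex lies on the boundary, and it is the
hole of the surface otherwise. -/
def InnerOctahedronAddition (T' T : Finset (Finset V)) : Prop :=
  ∃ v a : Fin 3 → V, IsOctahedron T v a ∧
    (((∀ i, v i ∉ boundaryVertices T) ∧
        T' = insert {a 0, a 1, a 2} (deleteVertices T {v 0, v 1, v 2})) ∨
      ((∃ i, v i ∈ boundaryVertices T) ∧ T' = deleteVertices T {v 0, v 1, v 2}))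

/-- `T` is obtained from `T'` by adding an octahedron along a boundary edge: `T` has an external
octahedron component, that is, `a i a j` and `a j a k` are boundary edges, and `T'` results from
the deletion of `a j` and of the central vertices. -/
def ExternalOctahedronAddition (T' T : Finset (Finset V)) : Prop :=
  ∃ v a : Fin 3 → V, IsOctahedron T v a ∧ ∃ i j k, i ≠ j ∧ i ≠ k ∧ j ≠ k ∧
    {a i, a j} ∈ boundaryEdges T ∧ {a j, a k} ∈ boundaryEdges T ∧
    T' = deleteVertices T {a j, v 0, v 1, v 2}

/-- One generating operation, carried out within the class. -/
def Step (F : Type v) [TopologicalSpace F] (T' T : Finset (Finset V)) : Prop :=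
  InClass F T' ∧ InClass F T ∧
    (TriodeSplitting F T' T ∨ FlagAddition T' T ∨ FourSplitting F T' T ∨
      InnerOctahedronAddition T' T ∨ ExternalOctahedronAddition T' T)

end SurfaceTriangulation

namespace SurfaceTriangulation

universe u v

variable {V : Type u} [DecidableEq V]

/-! ### Homeomorphisms between realizations -/

/-! By induction on the number of faces it is enough to show that a triangulation in the class that
has a boundary and a contractible edge arises by one operation from a smaller triangulation of the
same surface, again in the class and with boundary (`Reducible`, `reducible_of_contractible`).

Suppose this fails for `T`. Contracting `ab` lowers the degree of no vertex except possibly the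
merged one and the third vertices of the faces on `ab`. The merged vertex always meets the degree
conditions, so the contraction leaves the class only if some third vertex already has the smallest
permitted degree: 3 on the boundary, 4 inside (`Light`, `good_contract`). A contraction that stays
in the class is automatically triode detecting, so 4-splittings never have to be invoked. Hence
every contractible edge has a light vertex beside it (`exists_light`), and this is applied to one
edge after another.

Let `x` be light beside the given edge. If `x` is inner, its link is an induced 4-cycle, all four
edges at `x` are contractible, and so each opposite pair of link vertices contains a light one. This
gives two adjacent light vertices: if both are inner, they form with `x` the centre of an octahedron
(`Octa`); otherwise both lie on the boundary and `x` is the centre of a flag (`FlagConfig`). If `x`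
is on the boundary, two more contractible edges produce a flag around its middle neighbor. Octahedra
and flags can be removed: contractible edges near their corners show that the corners have degree to
spare, and since the surface is not a disk, the edge along which a boundary piece is cut off has a
face on its other side.

The topology rests on one explicit homeomorphism, a bistellar move in barycentric coordinates
(`Exchange.homeomorph`). A contraction is a series of flips followed by the removal of a vertex with
triangular link or of an ear (`Collapsible.contract`), and the removal of an octahedron or a flag is
a series of contractions. -/

/-- Move the mass `min x` from every vertex of `σ`, evenly, to the vertices of `τ`. -/
noncomputable def transfer (σ τ : Finset V) (hσ : σ.Nonempty) (x : V → ℝ) : V → ℝ := fun p =>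
  x p - (if p ∈ σ then σ.inf' hσ x else 0) +
    (if p ∈ τ then (σ.card : ℝ) * σ.inf' hσ x / τ.card else 0)

/-- Every face of `T` is carried by `transfer σ τ` into a face of `T'`. -/
structure Exchange (T T' : Finset (Finset V)) (σ τ : Finset V) : Prop where
  not_subset : ∀ t ∈ T, ¬ τ ⊆ t
  moved : ∀ t ∈ T, σ ⊆ t → ∀ p ∈ σ, ∃ t' ∈ T', t.erase p ∪ τ ⊆ t'
  kept : ∀ t ∈ T, ¬ σ ⊆ t → ∃ t' ∈ T', t ⊆ t'

theorem realization_nonneg {T : Finset (Finset V)} {x : V → ℝ} (hx : x ∈ realization T) (p : V) :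
    0 ≤ x p := by
  obtain ⟨t, -, h0, h1, -⟩ := hx
  by_cases hp : p ∈ t
  · exact h0 p hp
  · exact (h1 p hp).ge

/-- Once the minimum over `σ` is subtracted, the vertex `p` of `σ` where it was attained carries no
mass, so the support lies in `t.erase p ∪ τ`, which `moved` places in a face of `T'`. If `t` does
not contain `σ`, the minimum is 0 and the point stays where it is. -/
theorem transfer_mem {T T' : Finset (Finset V)} {σ τ : Finset V} (hσ : σ.Nonempty)
    (hτ : τ.Nonempty) (hd : Disjoint σ τ) (h : Exchange T T' σ τ) {x : V → ℝ}
    (hx : x ∈ realization T) : transfer σ τ hσ x ∈ realization T' := by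
  have hnn := realization_nonneg hx
  obtain ⟨t, ht, h0, h1, h2⟩ := hx
  by_cases hs : σ ⊆ t
  · obtain ⟨p, hp, hpm⟩ := Finset.exists_mem_eq_inf' hσ x
    set m := σ.inf' hσ x with hm
    have hm0 : 0 ≤ m := hpm ▸ hnn p
    obtain ⟨t', ht', hsub⟩ := h.moved t ht hs p hp
    have hτ0 : (0 : ℝ) < τ.card := by exact_mod_cast hτ.card_pos
    have key : ∀ q, q ∉ t.erase p ∪ τ → transfer σ τ hσ x q = 0 := by
      intro q hq
      simp only [Finset.mem_union, Finset.mem_erase, not_or, not_and] at hq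
      by_cases hqp : q = p
      · subst hqp
        simp [transfer, hp, hq.2, ← hm, hpm]
      · have hqt := hq.1 hqp
        simp [transfer, hq.2, h1 q hqt, show q ∉ σ from fun h' => hqt (hs h')]
    refine ⟨t', ht', ?_, ?_, ?_⟩
    · intro q _
      unfold transfer
      by_cases hq : q ∈ σ
      · have : m ≤ x q := Finset.inf'_le _ hq
        have hq' : q ∉ τ := Finset.disjoint_left.1 hd hq
        simp [hq, hq', ← hm, this]
      · rw [if_neg hq, sub_zero, ← hm]
        refine add_nonneg (hnn q) ?_
        split_ifs
        · positivity
        · exact le_rfl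
    · intro q hq
      exact key q fun h' => hq (hsub h')
    -- The sum is moved from `t'` to `t ∪ τ`, where the mass `σ.card * m` taken from `σ` cancels the
    -- mass given to `τ`.
    · have e1 : ∑ q ∈ t', transfer σ τ hσ x q = ∑ q ∈ t ∪ τ, transfer σ τ hσ x q := by
        have a1 : ∑ q ∈ t', transfer σ τ hσ x q = ∑ q ∈ t' ∪ (t ∪ τ), transfer σ τ hσ x q := by
          apply Finset.sum_subset Finset.subset_union_left
          intro q _ hq
          exact key q fun h' => hq (hsub h')
        have a2 : ∑ q ∈ t ∪ τ, transfer σ τ hσ x q = ∑ q ∈ t' ∪ (t ∪ τ), transfer σ τ hσ x q := by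
          apply Finset.sum_subset Finset.subset_union_right
          intro q _ hq
          exact key q fun h' => hq (Finset.union_subset_union_left (Finset.erase_subset _ _) h')
        rw [a1, a2]
      have e2 : ∑ q ∈ t ∪ τ, x q = 1 := by
        rw [← h2]
        exact (Finset.sum_subset Finset.subset_union_left fun q _ hq => h1 q hq).symm
      have e3 : (t ∪ τ).filter (· ∈ σ) = σ := by
        ext q
        simp only [Finset.mem_filter, Finset.mem_union]
        exact ⟨fun h => h.2, fun h => ⟨Or.inl (hs h), h⟩⟩
      have e4 : (t ∪ τ).filter (· ∈ τ) = τ := by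
        ext q
        simp only [Finset.mem_filter, Finset.mem_union]
        exact ⟨fun h => h.2, fun h => ⟨Or.inr h, h⟩⟩
      rw [e1]
      simp only [transfer, Finset.sum_add_distrib, Finset.sum_sub_distrib, ← Finset.sum_filter,
        e2, e3, e4, Finset.sum_const, nsmul_eq_mul, ← hm]
      field_simp
      ring
  · obtain ⟨p, hp, hpt⟩ := Finset.not_subset.1 hs
    have hm : σ.inf' hσ x = 0 := by
      apply le_antisymm
      · exact (Finset.inf'_le _ hp).trans (h1 p hpt).le
      · exact Finset.le_inf' _ _ fun q _ => hnn q
    have hx' : transfer σ τ hσ x = x := by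
      funext q
      simp [transfer, hm]
    rw [hx']
    obtain ⟨t', ht', hsub⟩ := h.kept t ht hs
    refine ⟨t', ht', fun q _ => hnn q, fun q hq => h1 q fun h' => hq (hsub h'), ?_⟩
    rw [← h2]
    exact (Finset.sum_subset hsub fun q _ hq => h1 q hq).symm

/-- A face of `T` misses some vertex of `τ`, and there `x` vanishes. So after the transfer the
minimum over `τ` is exactly the amount deposited on each of its vertices, and transferring back
takes away precisely that. -/
theorem transfer_transfer {T T' : Finset (Finset V)} {σ τ : Finset V} (hσ : σ.Nonempty)
    (hτ : τ.Nonempty) (hd : Disjoint σ τ) (h : Exchange T T' σ τ) {x : V → ℝ}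
    (hx : x ∈ realization T) : transfer τ σ hτ (transfer σ τ hσ x) = x := by
  have hnn := realization_nonneg hx
  obtain ⟨t, ht, h0, h1, h2⟩ := hx
  obtain ⟨p, hp, hpt⟩ := Finset.not_subset.1 (h.not_subset t ht)
  set m := σ.inf' hσ x with hm
  have hτ0 : (0 : ℝ) < τ.card := by exact_mod_cast hτ.card_pos
  have hσ0 : (0 : ℝ) < σ.card := by exact_mod_cast hσ.card_pos
  have hon : ∀ q ∈ τ, transfer σ τ hσ x q = x q + (σ.card : ℝ) * m / τ.card := by
    intro q hq
    have : q ∉ σ := Finset.disjoint_right.1 hd hq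
    simp [transfer, hq, this, ← hm]
  have hinf : τ.inf' hτ (transfer σ τ hσ x) = (σ.card : ℝ) * m / τ.card := by
    apply le_antisymm
    · refine (Finset.inf'_le _ hp).trans ?_
      rw [hon p hp, h1 p hpt, zero_add]
    · refine Finset.le_inf' _ _ fun q hq => ?_
      rw [hon q hq]
      linarith [hnn q]
  have hval : (τ.card : ℝ) * ((σ.card : ℝ) * m / τ.card) / σ.card = m := by field_simp
  funext q
  change transfer σ τ hσ x q - (if q ∈ τ then τ.inf' hτ (transfer σ τ hσ x) else 0) +
    (if q ∈ σ then (τ.card : ℝ) * τ.inf' hτ (transfer σ τ hσ x) / σ.card else 0) = x q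
  rw [hinf, hval]
  by_cases hq : q ∈ τ
  · have : q ∉ σ := Finset.disjoint_right.1 hd hq
    rw [hon q hq]
    simp [hq, this]
  · by_cases hq' : q ∈ σ <;> simp [transfer, hq, hq', ← hm]

theorem continuous_transfer (σ τ : Finset V) (hσ : σ.Nonempty) :
    Continuous (transfer σ τ hσ) := by
  have hm : Continuous fun x : V → ℝ => σ.inf' hσ x := by
    have : Continuous (σ.inf' hσ fun p => fun x : V → ℝ => x p) :=
      Continuous.finset_inf' hσ fun i _ => continuous_apply i
    convert this using 1
    funext x
    simp [Finset.inf'_apply]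
  refine continuous_pi fun p => ?_
  unfold transfer
  refine ((continuous_apply p).sub ?_).add ?_
  · split_ifs
    · exact hm
    · exact continuous_const
  · split_ifs
    · exact (continuous_const.mul hm).div_const _
    · exact continuous_const

/-- Invariance under a bistellar move. It is used for two crossing diagonals, for a vertex and the
triangle around it, and for a vertex and the boundary edge that it subdivides. -/
theorem Exchange.homeomorph {T T' : Finset (Finset V)} {σ τ : Finset V} (hσ : σ.Nonempty)
    (hτ : τ.Nonempty) (hd : Disjoint σ τ) (h : Exchange T T' σ τ) (h' : Exchange T' T τ σ) :
    Nonempty (realization T ≃ₜ realization T') :=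
  ⟨{  toFun := fun x => ⟨transfer σ τ hσ x.1, transfer_mem hσ hτ hd h x.2⟩
      invFun := fun x => ⟨transfer τ σ hτ x.1, transfer_mem hτ hσ hd.symm h' x.2⟩
      left_inv := fun x => Subtype.ext (transfer_transfer hσ hτ hd h x.2)
      right_inv := fun x => Subtype.ext (transfer_transfer hτ hσ hd.symm h' x.2)
      continuous_toFun :=
        ((continuous_transfer σ τ hσ).comp continuous_subtype_val).subtype_mk _
      continuous_invFun :=
        ((continuous_transfer τ σ hτ).comp continuous_subtype_val).subtype_mk _ }⟩

/-! ### The realization of a single face is a disk -/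

/-- The standard closed triangle in the plane. -/
def planeTriangle : Set (EuclideanSpace ℝ (Fin 2)) := {x | 0 ≤ x 0 ∧ 0 ≤ x 1 ∧ x 0 + x 1 ≤ 1}

theorem planeTriangle_homeomorph_ball :
    Nonempty (planeTriangle ≃ₜ Metric.closedBall (0 : EuclideanSpace ℝ (Fin 2)) 1) := by
  have c0 : Continuous fun x : EuclideanSpace ℝ (Fin 2) => x 0 := by fun_prop
  have c1 : Continuous fun x : EuclideanSpace ℝ (Fin 2) => x 1 := by fun_prop
  have hconv : Convex ℝ planeTriangle := by
    rintro x ⟨hx0, hx1, hx2⟩ y ⟨hy0, hy1, hy2⟩ s t hs ht hst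
    refine ⟨?_, ?_, ?_⟩ <;> simp only [PiLp.add_apply, PiLp.smul_apply, smul_eq_mul]
    · positivity
    · positivity
    · nlinarith
  have hclosed : IsClosed planeTriangle :=
    (isClosed_le continuous_const c0).inter
      ((isClosed_le continuous_const c1).inter (isClosed_le (c0.add c1) continuous_const))
  have hopen : IsOpen {x : EuclideanSpace ℝ (Fin 2) | 0 < x 0 ∧ 0 < x 1 ∧ x 0 + x 1 < 1} :=
    (isOpen_lt continuous_const c0).inter
      ((isOpen_lt continuous_const c1).inter (isOpen_lt (c0.add c1) continuous_const))
  have hne : (interior planeTriangle).Nonempty := by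
    refine ⟨!₂[1 / 4, 1 / 4], ?_⟩
    refine interior_maximal (t := {x : EuclideanSpace ℝ (Fin 2) | 0 < x 0 ∧ 0 < x 1 ∧
      x 0 + x 1 < 1}) ?_ hopen ?_
    · rintro x ⟨h0, h1, h2⟩
      exact ⟨h0.le, h1.le, h2.le⟩
    · simp
      norm_num
  have hb : Bornology.IsBounded planeTriangle := by
    refine (Metric.isBounded_closedBall (x := (0 : EuclideanSpace ℝ (Fin 2))) (r := 2)).subset ?_
    rintro x ⟨hx0, hx1, hx2⟩
    rw [mem_closedBall_zero_iff, EuclideanSpace.norm_eq, Fin.sum_univ_two, Real.norm_eq_abs,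
      Real.norm_eq_abs, sq_abs, sq_abs]
    apply Real.sqrt_le_iff.2
    constructor
    · norm_num
    · nlinarith
  -- A homeomorphism of the plane takes the closure of a bounded convex set with nonempty interior
  -- to the closed unit ball.
  obtain ⟨e, -, he, -⟩ :=
    exists_homeomorph_image_interior_closure_frontier_eq_unitBall hconv hne hb
  rw [hclosed.closure_eq] at he
  exact ⟨(e.image planeTriangle).trans (Homeomorph.setCongr he)⟩

theorem realization_face_homeomorph {a b c : V} (hab : a ≠ b) (hac : a ≠ c) (hbc : b ≠ c) :
    Nonempty (realization {{a, b, c}} ≃ₜ planeTriangle) := by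
  have hsum : ∀ f : V → ℝ, ∑ p ∈ ({a, b, c} : Finset V), f p = f a + f b + f c := by
    intro f
    rw [Finset.sum_insert (by simp [hab, hac]), Finset.sum_insert (by simp [hbc]),
      Finset.sum_singleton, add_assoc]
  refine ⟨{
    toFun := fun x => ⟨!₂[x.1 a, x.1 b], ?_⟩
    invFun := fun y => ⟨fun p => if p = a then y.1 0 else if p = b then y.1 1 else
      if p = c then 1 - y.1 0 - y.1 1 else 0, ?_⟩
    left_inv := ?_
    right_inv := ?_
    continuous_toFun := ?_
    continuous_invFun := ?_ }⟩
  · obtain ⟨x, t, ht, h0, h1, h2⟩ := x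
    rw [Finset.mem_singleton] at ht
    subst ht
    rw [hsum] at h2
    have := h0 a (by simp)
    have := h0 b (by simp)
    have := h0 c (by simp)
    refine ⟨?_, ?_, ?_⟩ <;> simp <;> linarith
  · obtain ⟨y, h0, h1, h2⟩ := y
    refine ⟨{a, b, c}, by simp, ?_, ?_, ?_⟩
    · intro p _
      dsimp only
      split_ifs
      · exact h0
      · exact h1
      · linarith
      · exact le_rfl
    · intro p hp
      simp only [Finset.mem_insert, Finset.mem_singleton, not_or] at hp
      simp [hp]
    · rw [hsum]
      simp [hab.symm, hac.symm, hbc.symm]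
  · rintro ⟨x, t, ht, h0, h1, h2⟩
    rw [Finset.mem_singleton] at ht
    subst ht
    rw [hsum] at h2
    apply Subtype.ext
    funext p
    by_cases ha : p = a
    · simp [ha]
    by_cases hb : p = b
    · simp [hb, hab.symm]
    by_cases hc : p = c
    · subst hc
      simp [ha, hb]
      linarith
    · simp [ha, hb, hc, h1 p (by simp [ha, hb, hc])]
  · rintro ⟨y, hy⟩
    apply Subtype.ext
    ext i
    fin_cases i <;> simp [hab.symm]
  · refine Continuous.subtype_mk ?_ _
    refine (PiLp.continuous_toLp 2 _).comp (continuous_pi fun i => ?_)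
    fin_cases i
    · exact (continuous_apply a).comp continuous_subtype_val
    · exact (continuous_apply b).comp continuous_subtype_val
  · refine Continuous.subtype_mk (continuous_pi fun p => ?_) _
    split_ifs <;> fun_prop

/-! ### Surfaces in terms of the ternary face relation -/

/-- The vertices `x`, `y`, `z` span a face. -/
def Tri (T : Finset (Finset V)) (x y z : V) : Prop := {x, y, z} ∈ T

/-- The vertices `x` and `y` are adjacent. -/
def Nb (T : Finset (Finset V)) (x y : V) : Prop := ∃ z, Tri T x y z

/-- The pair `x y` is a boundary edge. -/
def Bd (T : Finset (Finset V)) (x y : V) : Prop := ∃ z, Tri T x y z ∧ ∀ w, Tri T x y w → w = z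

theorem Tri.swap {T : Finset (Finset V)} {x y z : V} (h : Tri T x y z) : Tri T y x z := by
  unfold Tri at *
  rwa [Finset.insert_comm]

theorem Tri.rot {T : Finset (Finset V)} {x y z : V} (h : Tri T x y z) : Tri T y z x := by
  have h' := h.swap
  unfold Tri at *
  rwa [Finset.pair_comm z x]

theorem Tri.swapRight {T : Finset (Finset V)} {x y z : V} (h : Tri T x y z) : Tri T x z y :=
  h.swap.rot

theorem Tri.nb {T : Finset (Finset V)} {x y z : V} (h : Tri T x y z) : Nb T x y := ⟨z, h⟩

theorem Nb.symm {T : Finset (Finset V)} {x y : V} (h : Nb T x y) : Nb T y x :=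
  h.imp fun _ h => h.swap

theorem Bd.symm {T : Finset (Finset V)} {x y : V} (h : Bd T x y) : Bd T y x :=
  h.imp fun _ h => ⟨h.1.swap, fun w hw => h.2 w hw.swap⟩

theorem Bd.nb {T : Finset (Finset V)} {x y : V} (h : Bd T x y) : Nb T x y :=
  h.imp fun _ h => h.1

/-- The defining properties of a triangulated surface, in terms of the face relation. -/
structure Surf (T : Finset (Finset V)) : Prop where
  nonempty : ∃ x y z, Tri T x y z
  card_face : ∀ t ∈ T, t.card = 3
  le_two : ∀ {x y p q r}, Tri T x y p → Tri T x y q → Tri T x y r → p = q ∨ p = r ∨ q = r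
  link : ∀ (x : V) (S : V → Prop), (∃ p, S p ∧ Nb T x p) → (∀ p q, S p → Tri T x p q → S q) →
    ∀ q, Nb T x q → S q
  conn : ∀ (S : V → Prop), (∃ p q, S p ∧ Nb T p q) → (∀ p q, S p → Nb T p q → S q) →
    ∀ p q, Nb T p q → S p

theorem tri_distinct {T : Finset (Finset V)} (hc : ∀ t ∈ T, t.card = 3) {x y z : V}
    (h : Tri T x y z) : x ≠ y ∧ x ≠ z ∧ y ≠ z := by
  have := hc _ h
  grind

theorem Surf.distinct {T : Finset (Finset V)} (hT : Surf T) {x y z : V}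
    (h : Tri T x y z) : x ≠ y ∧ x ≠ z ∧ y ≠ z := tri_distinct hT.card_face h

theorem eq_triple_of_mem {t : Finset V} (ht : t.card = 3) {x y : V} (hx : x ∈ t) (hy : y ∈ t)
    (hxy : x ≠ y) : ∃ z, t = {x, y, z} := by
  obtain ⟨a, b, c, -, -, -, rfl⟩ := Finset.card_eq_three.1 ht
  simp only [Finset.mem_insert, Finset.mem_singleton] at hx hy
  have : ∀ z, (z = a ∨ z = b ∨ z = c) → z ≠ x → z ≠ y → ({a, b, c} : Finset V) = {x, y, z} := by
    grind
  by_cases h1 : a ≠ x ∧ a ≠ y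
  · exact ⟨a, this a (by simp) h1.1 h1.2⟩
  by_cases h2 : b ≠ x ∧ b ≠ y
  · exact ⟨b, this b (by simp) h2.1 h2.2⟩
  by_cases h3 : c ≠ x ∧ c ≠ y
  · exact ⟨c, this c (by simp) h3.1 h3.2⟩
  grind

theorem mem_neighbors {T : Finset (Finset V)} (hc : ∀ t ∈ T, t.card = 3) {x y : V} :
    y ∈ neighbors T x ↔ Nb T x y := by
  simp only [neighbors, Finset.mem_erase, Finset.mem_biUnion, Finset.mem_filter, id]
  constructor
  · rintro ⟨hne, t, ⟨ht, hx⟩, hy⟩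
    obtain ⟨z, rfl⟩ := eq_triple_of_mem (hc t ht) hx hy hne.symm
    exact ⟨z, ht⟩
  · rintro ⟨z, h⟩
    exact ⟨(tri_distinct hc h).1.symm, _, ⟨h, by simp⟩, by simp⟩

theorem mem_vertices {T : Finset (Finset V)} (hc : ∀ t ∈ T, t.card = 3) {x : V} :
    x ∈ vertices T ↔ ∃ y, Nb T x y := by
  simp only [vertices, Finset.mem_biUnion, id]
  constructor
  · rintro ⟨t, ht, hx⟩
    obtain ⟨y, hy, hne⟩ := Finset.exists_mem_ne (by rw [hc t ht]; norm_num) x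
    obtain ⟨z, rfl⟩ := eq_triple_of_mem (hc t ht) hx hy hne.symm
    exact ⟨y, z, ht⟩
  · rintro ⟨y, z, h⟩
    exact ⟨_, h, by simp⟩

theorem mem_edges {T : Finset (Finset V)} (hc : ∀ t ∈ T, t.card = 3) {x y : V} (hne : x ≠ y) :
    {x, y} ∈ edges T ↔ Nb T x y := by
  simp only [edges, Finset.mem_biUnion, Finset.mem_powersetCard]
  constructor
  · rintro ⟨t, ht, hs, -⟩
    obtain ⟨z, rfl⟩ := eq_triple_of_mem (hc t ht) (hs (by simp) : x ∈ t) (hs (by simp) : y ∈ t) hne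
    exact ⟨z, ht⟩
  · rintro ⟨z, h⟩
    exact ⟨_, h, by grind, Finset.card_pair hne⟩

theorem exists_of_mem_edges {T : Finset (Finset V)} {e : Finset V} (he : e ∈ edges T) :
    ∃ x y, x ≠ y ∧ e = {x, y} := by
  simp only [edges, Finset.mem_biUnion, Finset.mem_powersetCard] at he
  obtain ⟨t, ht, hs, h2⟩ := he
  exact Finset.card_eq_two.1 h2

theorem mem_thirds {T : Finset (Finset V)} (hc : ∀ t ∈ T, t.card = 3) {x y : V} (hne : x ≠ y)
    {t : Finset V} : t ∈ T.filter (fun t => {x, y} ⊆ t) ↔ ∃ z, Tri T x y z ∧ t = {x, y, z} := by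
  rw [Finset.mem_filter]
  constructor
  · rintro ⟨ht, hs⟩
    obtain ⟨z, rfl⟩ := eq_triple_of_mem (hc t ht) (hs (by simp) : x ∈ t) (hs (by simp) : y ∈ t) hne
    exact ⟨z, ht, rfl⟩
  · rintro ⟨z, h, rfl⟩
    exact ⟨h, by grind⟩

theorem triple_inj {x y z w : V} (hz : z ≠ x) (hz' : z ≠ y)
    (h : ({x, y, z} : Finset V) = {x, y, w}) : z = w := by
  have : z ∈ ({x, y, w} : Finset V) := by rw [← h]; simp
  grind

theorem mem_boundaryEdges {T : Finset (Finset V)} (hc : ∀ t ∈ T, t.card = 3) {x y : V} :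
    {x, y} ∈ boundaryEdges T ↔ Bd T x y := by
  have hne_of : x = y ∨ x ≠ y := eq_or_ne x y
  rcases hne_of with rfl | hne
  · constructor
    · intro h
      obtain ⟨p, q, hpq, h'⟩ := exists_of_mem_edges (Finset.mem_filter.1 h).1
      have := congrArg Finset.card h'
      simp [Finset.card_pair hpq] at this
    · rintro ⟨z, h, -⟩
      exact absurd rfl (tri_distinct hc h).1
  rw [boundaryEdges, Finset.mem_filter, mem_edges hc hne, Finset.card_eq_one]
  constructor
  · rintro ⟨⟨z, hz⟩, t, ht⟩
    refine ⟨z, hz, fun w hw => ?_⟩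
    have h1 := (mem_thirds hc hne).2 ⟨z, hz, rfl⟩
    have h2 := (mem_thirds hc hne).2 ⟨w, hw, rfl⟩
    rw [ht, Finset.mem_singleton] at h1 h2
    have := tri_distinct hc hw
    exact triple_inj this.2.1.symm this.2.2.symm (h2.trans h1.symm)
  · rintro ⟨z, hz, h⟩
    refine ⟨⟨z, hz⟩, {x, y, z}, ?_⟩
    ext t
    rw [mem_thirds hc hne, Finset.mem_singleton]
    constructor
    · rintro ⟨w, hw, rfl⟩
      rw [h w hw]
    · rintro rfl
      exact ⟨z, hz, rfl⟩

theorem mem_boundaryVertices {T : Finset (Finset V)} (hc : ∀ t ∈ T, t.card = 3) {x : V} :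
    x ∈ boundaryVertices T ↔ ∃ y, Bd T x y := by
  simp only [boundaryVertices, Finset.mem_biUnion, id]
  constructor
  · rintro ⟨e, he, hx⟩
    obtain ⟨p, q, hpq, rfl⟩ := exists_of_mem_edges (Finset.mem_filter.1 he).1
    rw [mem_boundaryEdges hc] at he
    simp only [Finset.mem_insert, Finset.mem_singleton] at hx
    rcases hx with rfl | rfl
    · exact ⟨q, he⟩
    · exact ⟨p, he.symm⟩
  · rintro ⟨y, h⟩
    exact ⟨{x, y}, (mem_boundaryEdges hc).2 h, by simp⟩

theorem boundaryEdges_nonempty {T : Finset (Finset V)} (hc : ∀ t ∈ T, t.card = 3) :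
    (boundaryEdges T).Nonempty ↔ ∃ x y, Bd T x y := by
  constructor
  · rintro ⟨e, he⟩
    obtain ⟨p, q, hpq, rfl⟩ := exists_of_mem_edges (Finset.mem_filter.1 he).1
    exact ⟨p, q, (mem_boundaryEdges hc).1 he⟩
  · rintro ⟨x, y, h⟩
    exact ⟨_, (mem_boundaryEdges hc).2 h⟩

/-- Turns reachability into the invariance form of `Surf.link` and `Surf.conn`, in which a link is
determined by exhibiting a set of vertices that is closed under adjacency. -/
theorem reachable_of_closed {α : Type*} (G : SimpleGraph α) {S : α → Prop} {p q : α}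
    (hS : ∀ p q, S p → G.Adj p q → S q) (hp : S p) (h : G.Reachable p q) : S q := by
  obtain ⟨w⟩ := h
  induction w with
  | nil => exact hp
  | cons hadj _ ih => exact ih (hS _ _ hp hadj)

theorem IsTriangulatedSurface.surf {T : Finset (Finset V)} (h : IsTriangulatedSurface T) :
    Surf T := by
  have hc := h.card_face
  refine ⟨?_, hc, ?_, ?_, ?_⟩
  · obtain ⟨t, ht⟩ := h.nonempty
    obtain ⟨a, b, c, -, -, -, rfl⟩ := Finset.card_eq_three.1 (hc t ht)
    exact ⟨a, b, c, ht⟩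
  · intro x y p q r hp hq hr
    by_contra! hne
    have hxy := (tri_distinct hc hp).1
    have := h.edge_le_two {x, y} ((mem_edges hc hxy).2 ⟨p, hp⟩)
    refine absurd this (not_le.2 (Finset.two_lt_card.2 ⟨{x, y, p}, ?_, {x, y, q}, ?_,
      {x, y, r}, ?_, ?_, ?_, ?_⟩))
    · exact (mem_thirds hc hxy).2 ⟨_, hp, rfl⟩
    · exact (mem_thirds hc hxy).2 ⟨_, hq, rfl⟩
    · exact (mem_thirds hc hxy).2 ⟨_, hr, rfl⟩
    · have := tri_distinct hc hp
      exact fun h => hne.1 (triple_inj this.2.1.symm this.2.2.symm h)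
    · have := tri_distinct hc hp
      exact fun h => hne.2.1 (triple_inj this.2.1.symm this.2.2.symm h)
    · have := tri_distinct hc hq
      exact fun h => hne.2.2 (triple_inj this.2.1.symm this.2.2.symm h)
  · rintro x S ⟨p, hSp, hp⟩ hS q hq
    refine reachable_of_closed (linkGraph T x) (fun p q hp hpq => hS p q hp hpq.2.2.2) hSp
      (h.link_connected x ?_ p ?_ q ?_)
    · exact (mem_vertices hc).2 ⟨p, hp⟩
    · exact (mem_neighbors hc).2 hp
    · exact (mem_neighbors hc).2 hq
  · rintro S ⟨p, q, hSp, hpq⟩ hS p' q' hpq'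
    refine reachable_of_closed (skeleton T) (fun p q hp hpq => hS p q hp ?_) hSp
      (h.connected p ?_ p' ?_)
    · exact (mem_edges hc hpq.1).1 hpq.2
    · exact (mem_vertices hc).2 ⟨q, hpq⟩
    · exact (mem_vertices hc).2 ⟨q', hpq'⟩

theorem Surf.isTriangulatedSurface {T : Finset (Finset V)} (h : Surf T) :
    IsTriangulatedSurface T := by
  have hc := h.card_face
  refine ⟨?_, hc, ?_, ?_, ?_⟩
  · obtain ⟨x, y, z, h⟩ := h.nonempty
    exact ⟨_, h⟩
  · intro e he
    obtain ⟨x, y, hxy, rfl⟩ := exists_of_mem_edges he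
    by_contra! hlt
    obtain ⟨s, hs, t, ht, u, hu, h1, h2, h3⟩ := Finset.two_lt_card.1 hlt
    obtain ⟨p, hp, rfl⟩ := (mem_thirds hc hxy).1 hs
    obtain ⟨q, hq, rfl⟩ := (mem_thirds hc hxy).1 ht
    obtain ⟨r, hr, rfl⟩ := (mem_thirds hc hxy).1 hu
    rcases h.le_two hp hq hr with rfl | rfl | rfl <;> contradiction
  · intro x _ p hp q hq
    rw [mem_neighbors hc] at hp hq
    refine h.link x (fun r => (linkGraph T x).Reachable p r) ⟨p, SimpleGraph.Reachable.refl _, hp⟩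
      (fun r s hr hrs => hr.trans (SimpleGraph.Adj.reachable ?_)) q hq
    have := tri_distinct hc hrs
    exact ⟨this.2.2, this.1, this.2.1, hrs⟩
  · intro p hp q hq
    rw [mem_vertices hc] at hp hq
    obtain ⟨p', hp⟩ := hp
    obtain ⟨q', hq⟩ := hq
    refine h.conn (fun r => (skeleton T).Reachable p r) ⟨p, p', SimpleGraph.Reachable.refl _, hp⟩
      (fun r s hr hrs => hr.trans (SimpleGraph.Adj.reachable ?_)) q q' hq
    have hne : r ≠ s := by
      obtain ⟨z, hz⟩ := hrs
      exact (tri_distinct hc hz).1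
    exact ⟨hne, (mem_edges hc hne).2 hrs⟩

theorem faces_ext {T T' : Finset (Finset V)} (hc : ∀ t ∈ T, t.card = 3)
    (hc' : ∀ t ∈ T', t.card = 3) (h : ∀ x y z, Tri T x y z ↔ Tri T' x y z) : T = T' := by
  ext t
  constructor <;> intro ht
  · obtain ⟨a, b, c, -, -, -, rfl⟩ := Finset.card_eq_three.1 (hc t ht)
    exact (h a b c).1 ht
  · obtain ⟨a, b, c, -, -, -, rfl⟩ := Finset.card_eq_three.1 (hc' t ht)
    exact (h a b c).2 ht

/-! ### Faces of a contraction -/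

theorem card_of_mem_contract {T : Finset (Finset V)} (hc : ∀ t ∈ T, t.card = 3) {a b : V}
    (t : Finset V) (ht : t ∈ contract T a b) : t.card = 3 := by
  simp only [contract, Finset.mem_image, Finset.mem_filter] at ht
  obtain ⟨s, ⟨hs, hab⟩, rfl⟩ := ht
  rw [Finset.card_image_of_injOn, hc s hs]
  intro p hp q hq hpq
  simp only [Finset.mem_coe] at hp hq hpq
  grind

/-- Faces without `b` are kept and in the others `b` is renamed `a`; requiring three distinct
vertices, none of them `b`, discards the collapsed faces. -/
theorem tri_contract {T : Finset (Finset V)} (hc : ∀ t ∈ T, t.card = 3) {a b : V} (hab : a ≠ b)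
    (x y z : V) : Tri (contract T a b) x y z ↔ (x ≠ y ∧ x ≠ z ∧ y ≠ z) ∧
      (x ≠ b ∧ y ≠ b ∧ z ≠ b) ∧ (Tri T x y z ∨ (x = a ∧ Tri T b y z) ∨ (y = a ∧ Tri T x b z) ∨
        (z = a ∧ Tri T x y b)) := by
  constructor
  · intro h
    have hd := tri_distinct (card_of_mem_contract hc) h
    refine ⟨hd, ?_⟩
    have him : ∀ s : Finset V, b ∉ s → s.image (fun p => if p = b then a else p) = s := by
      intro s hs
      ext q
      grind
    simp only [Tri, contract, Finset.mem_image, Finset.mem_filter] at h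
    obtain ⟨s, ⟨hs, hn⟩, he⟩ := h
    have hb : b ∉ ({x, y, z} : Finset V) := by
      rw [← he]
      grind
    refine ⟨by grind, ?_⟩
    by_cases hbs : b ∈ s
    · have has : a ∉ s := fun h => hn ⟨h, hbs⟩
      have key : s = insert b (({x, y, z} : Finset V).erase a) ∧ a ∈ ({x, y, z} : Finset V) := by
        rw [← he]
        constructor
        · ext q
          grind
        · grind
      obtain ⟨hs', ha⟩ := key
      simp only [Finset.mem_insert, Finset.mem_singleton] at ha
      unfold Tri
      rcases ha with rfl | rfl | rfl
      · have : s = {b, y, z} := by rw [hs']; grind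
        exact Or.inr (Or.inl ⟨rfl, this ▸ hs⟩)
      · have : s = {x, b, z} := by rw [hs']; grind
        exact Or.inr (Or.inr (Or.inl ⟨rfl, this ▸ hs⟩))
      · have : s = {x, y, b} := by rw [hs']; grind
        exact Or.inr (Or.inr (Or.inr ⟨rfl, this ▸ hs⟩))
    · rw [him s hbs] at he
      subst he
      exact Or.inl hs
  · rintro ⟨hd, hb, h⟩
    simp only [Tri, contract, Finset.mem_image, Finset.mem_filter]
    rcases h with h | ⟨rfl, h⟩ | ⟨rfl, h⟩ | ⟨rfl, h⟩
    · exact ⟨_, ⟨h, by grind⟩, by grind⟩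
    · exact ⟨_, ⟨h, by grind⟩, by simp [Finset.image_insert, hb]⟩
    · exact ⟨_, ⟨h, by grind⟩, by simp [Finset.image_insert, hb]⟩
    · exact ⟨_, ⟨h, by grind⟩, by simp [Finset.image_insert, hb]⟩

set_option linter.unusedSimpArgs false

/-! ### Flips -/

/-- The triples `x y z` and `a b c` are equal up to order. -/
def SameTriple (x y z a b c : V) : Prop :=
  (x = a ∧ y = b ∧ z = c) ∨ (x = a ∧ y = c ∧ z = b) ∨ (x = b ∧ y = a ∧ z = c) ∨
    (x = b ∧ y = c ∧ z = a) ∨ (x = c ∧ y = a ∧ z = b) ∨ (x = c ∧ y = b ∧ z = a)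

theorem triple_eq_iff {x y z a b c : V} (hab : a ≠ b) (hac : a ≠ c) (hbc : b ≠ c) :
    ({x, y, z} : Finset V) = {a, b, c} ↔ SameTriple x y z a b c := by
  constructor
  · intro h
    have h1 : a ∈ ({x, y, z} : Finset V) := by rw [h]; simp
    have h2 : b ∈ ({x, y, z} : Finset V) := by rw [h]; simp
    have h3 : c ∈ ({x, y, z} : Finset V) := by rw [h]; simp
    simp only [Finset.mem_insert, Finset.mem_singleton] at h1 h2 h3
    unfold SameTriple
    grind
  · rintro (⟨rfl, rfl, rfl⟩ | ⟨rfl, rfl, rfl⟩ | ⟨rfl, rfl, rfl⟩ | ⟨rfl, rfl, rfl⟩ |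
      ⟨rfl, rfl, rfl⟩ | ⟨rfl, rfl, rfl⟩) <;> grind

/-- Replace the diagonal `b p` of the quadrilateral `a b q p` by the diagonal `a q`. -/
def flip (T : Finset (Finset V)) (a b p q : V) : Finset (Finset V) :=
  (T.filter fun t => t ≠ {a, b, p} ∧ t ≠ {b, p, q}) ∪ {{a, b, q}, {a, p, q}}

/-- The diagonal `b p` of the quadrilateral `a b q p` of `T` may be flipped. -/
structure Flippable (T : Finset (Finset V)) (a b p q : V) : Prop where
  left : Tri T a b p
  right : Tri T b p q
  ne : a ≠ q
  not_nb : ¬ Nb T a q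

theorem Flippable.distinct {T : Finset (Finset V)} (hT : Surf T) {a b p q : V}
    (h : Flippable T a b p q) : a ≠ b ∧ a ≠ p ∧ a ≠ q ∧ b ≠ p ∧ b ≠ q ∧ p ≠ q := by
  have := hT.distinct h.left
  have := hT.distinct h.right
  have := h.ne
  grind

theorem tri_flip {T : Finset (Finset V)} (hT : Surf T) {a b p q : V}
    (h : Flippable T a b p q) (x y z : V) : Tri (flip T a b p q) x y z ↔
      (Tri T x y z ∧ ¬ SameTriple x y z a b p ∧ ¬ SameTriple x y z b p q) ∨
        SameTriple x y z a b q ∨ SameTriple x y z a p q := by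
  have := h.distinct hT
  rw [← triple_eq_iff, ← triple_eq_iff, ← triple_eq_iff, ← triple_eq_iff]
  · simp only [Tri, flip, Finset.mem_union, Finset.mem_filter, Finset.mem_insert,
      Finset.mem_singleton, ne_eq]
  all_goals grind

theorem card_of_mem_flip {T : Finset (Finset V)} (hT : Surf T) {a b p q : V}
    (h : Flippable T a b p q) (t : Finset V) (ht : t ∈ flip T a b p q) : t.card = 3 := by
  have := h.distinct hT
  simp only [flip, Finset.mem_union, Finset.mem_filter, Finset.mem_insert,
    Finset.mem_singleton] at ht
  rcases ht with ht | rfl | rfl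
  · exact hT.card_face t ht.1
  · exact Finset.card_eq_three.2 ⟨a, b, q, by grind, by grind, by grind, rfl⟩
  · exact Finset.card_eq_three.2 ⟨a, p, q, by grind, by grind, by grind, rfl⟩

theorem Surf.third {T : Finset (Finset V)} (hT : Surf T) {x y p q r : V} (hp : Tri T x y p)
    (hq : Tri T x y q) (hpq : p ≠ q) (hr : Tri T x y r) : r = p ∨ r = q := by
  rcases hT.le_two hp hq hr with h | h | h
  · exact absurd h hpq
  · exact Or.inl h.symm
  · exact Or.inr h.symm

theorem SameTriple.tri {T : Finset (Finset V)} {x y z a b c : V} (h : SameTriple x y z a b c)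
    (ht : Tri T a b c) : Tri T x y z := by
  rcases h with ⟨rfl, rfl, rfl⟩ | ⟨rfl, rfl, rfl⟩ | ⟨rfl, rfl, rfl⟩ | ⟨rfl, rfl, rfl⟩ |
      ⟨rfl, rfl, rfl⟩ | ⟨rfl, rfl, rfl⟩
  · exact ht
  · exact ht.rot.swap.rot.rot
  · exact ht.swap
  · exact ht.rot
  · exact ht.rot.rot
  · exact ht.swap.rot.rot

/-- An edge of a new face is either the diagonal `a q`, which lies in no old face, or a side of the
quadrilateral, where the new face takes the place of exactly one removed face. -/
theorem flip_le_two_of_new {T : Finset (Finset V)} (hT : Surf T) {a b p q : V}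
    (h : Flippable T a b p q) {x y c d e : V}
    (hc : SameTriple x y c a b q ∨ SameTriple x y c a p q)
    (hd : Tri (flip T a b p q) x y d) (he : Tri (flip T a b p q) x y e) :
    c = d ∨ c = e ∨ d = e := by
  obtain ⟨h1, h2, h3, h4, h5, h6⟩ := h.distinct hT
  have hl := h.left
  have hr := h.right
  have hn : ∀ r, ¬ Tri T a q r := fun r hr => h.not_nb ⟨r, hr⟩
  have hn' : ∀ r, ¬ Tri T q a r := fun r hr => h.not_nb ⟨r, hr.swap⟩
  have k1 := fun r s => hT.le_two (p := p) (q := r) (r := s) hl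
  have k2 := fun r s => hT.le_two (p := p) (q := r) (r := s) hl.swap
  have k3 := fun r s => hT.le_two (p := a) (q := r) (r := s) hl.rot.swap.swap
  have k4 := fun r s => hT.le_two (p := b) (q := r) (r := s) hl.rot.rot
  have k5 := fun r s => hT.le_two (p := b) (q := r) (r := s) hl.rot.rot.swap
  have k6 := fun r s => hT.le_two (p := b) (q := r) (r := s) hr.rot
  have k7 := fun r s => hT.le_two (p := b) (q := r) (r := s) hr.rot.swap
  have k8 := fun r s => hT.le_two (p := p) (q := r) (r := s) hr.rot.rot
  have k9 := fun r s => hT.le_two (p := p) (q := r) (r := s) hr.rot.rot.swap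
  rw [tri_flip hT h] at hd he
  rcases hc with (⟨rfl, rfl, rfl⟩ | ⟨rfl, rfl, rfl⟩ | ⟨rfl, rfl, rfl⟩ | ⟨rfl, rfl, rfl⟩ |
      ⟨rfl, rfl, rfl⟩ | ⟨rfl, rfl, rfl⟩) | (⟨rfl, rfl, rfl⟩ | ⟨rfl, rfl, rfl⟩ | ⟨rfl, rfl, rfl⟩ |
      ⟨rfl, rfl, rfl⟩ | ⟨rfl, rfl, rfl⟩ | ⟨rfl, rfl, rfl⟩) <;>
  simp only [SameTriple, h1, h2, h3, h4, h5, h6, h1.symm, h2.symm, h3.symm, h4.symm, h5.symm,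
    h6.symm, hn, hn', true_and, false_and, or_false, false_or, and_false, not_false_eq_true,
    and_true] at hd he <;> grind

theorem flip_le_two {T : Finset (Finset V)} (hT : Surf T) {a b p q : V}
    (h : Flippable T a b p q) {x y c d e : V} (hc : Tri (flip T a b p q) x y c)
    (hd : Tri (flip T a b p q) x y d) (he : Tri (flip T a b p q) x y e) :
    c = d ∨ c = e ∨ d = e := by
  have hc' := hc
  have hd' := hd
  have he' := he
  rw [tri_flip hT h] at hc hd he
  rcases hc with hc | hc
  · rcases hd with hd | hd
    · rcases he with he | he
      · exact hT.le_two hc.1 hd.1 he.1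
      · have := flip_le_two_of_new hT h he hc' hd'
        grind
    · have := flip_le_two_of_new hT h hd hc' he'
      grind
  · exact flip_le_two_of_new hT h hc hd' he'

theorem flip_swap (T : Finset (Finset V)) (a b p q : V) : flip T a b p q = flip T a p b q := by
  unfold flip
  rw [show ({a, b, p} : Finset V) = {a, p, b} by grind,
    show ({b, p, q} : Finset V) = {p, b, q} by grind, Finset.pair_comm ({a, b, q} : Finset V)]

theorem flip_rotate (T : Finset (Finset V)) (a b p q : V) : flip T a b p q = flip T q b p a := by
  unfold flip
  rw [show ({a, b, p} : Finset V) = {b, p, a} by grind,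
    show ({b, p, q} : Finset V) = {q, b, p} by grind,
    show ({a, b, q} : Finset V) = {q, b, a} by grind,
    show ({a, p, q} : Finset V) = {q, p, a} by grind]
  simp only [and_comm]

theorem Flippable.swap {T : Finset (Finset V)} {a b p q : V} (h : Flippable T a b p q) :
    Flippable T a p b q :=
  ⟨h.left.rot.swap.rot.rot, h.right.swap, h.ne, h.not_nb⟩

theorem Flippable.rotate {T : Finset (Finset V)} {a b p q : V} (h : Flippable T a b p q) :
    Flippable T q b p a :=
  ⟨h.right.rot.rot, h.left.rot, h.ne.symm, fun h' => h.not_nb h'.symm⟩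

theorem tri_flip_removed {T : Finset (Finset V)} (hT : Surf T) {a b p q : V}
    (h : Flippable T a b p q) (c d : V) : Tri (flip T a b p q) b c d ↔
      (Tri T b c d ∧ c ≠ p ∧ d ≠ p) ∨ (c = a ∧ d = q) ∨ (c = q ∧ d = a) := by
  obtain ⟨h1, h2, h3, h4, h5, h6⟩ := h.distinct hT
  rw [tri_flip hT h]
  have e : ∀ s, Tri T b p s → s = a ∨ s = q := fun s hs => hT.third h.left.rot h.right h3 hs
  have e' : ∀ s, Tri T b s p → s = a ∨ s = q := fun s hs => e s hs.swapRight
  simp only [SameTriple, h1, h2, h3, h4, h5, h6, h1.symm, h2.symm, h3.symm, h4.symm, h5.symm,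
    h6.symm, true_and, false_and, or_false, false_or]
  grind

theorem tri_flip_added {T : Finset (Finset V)} (hT : Surf T) {a b p q : V}
    (h : Flippable T a b p q) (c d : V) : Tri (flip T a b p q) a c d ↔
      (Tri T a c d ∧ ¬ (c = b ∧ d = p) ∧ ¬ (c = p ∧ d = b)) ∨ (c = b ∧ d = q) ∨ (c = q ∧ d = b) ∨
        (c = p ∧ d = q) ∨ (c = q ∧ d = p) := by
  obtain ⟨h1, h2, h3, h4, h5, h6⟩ := h.distinct hT
  rw [tri_flip hT h]
  simp only [SameTriple, h1, h2, h3, h4, h5, h6, h1.symm, h2.symm, h3.symm, h4.symm, h5.symm,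
    h6.symm, true_and, false_and, or_false]
  grind

/-- In the link of `b` the flip shortens the path `a p q` to the edge `a q`. A closed set of the new
link extends to the old one by letting `p` follow `q`. -/
theorem flip_link_removed {T : Finset (Finset V)} (hT : Surf T) {a b p q : V}
    (h : Flippable T a b p q) (S : V → Prop) (hp : ∃ c, S c ∧ Nb (flip T a b p q) b c)
    (hS : ∀ c d, S c → Tri (flip T a b p q) b c d → S d) (d : V)
    (hd : Nb (flip T a b p q) b d) : S d := by
  obtain ⟨h1, h2, h3, h4, h5, h6⟩ := h.distinct hT
  have hl := h.left
  have hr := h.right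
  simp only [Nb, tri_flip_removed hT h] at hS hp hd
  have := hT.link b (fun c => (c = p ∧ S q) ∨ (c ≠ p ∧ S c)) ?_ ?_ d ?_
  · obtain ⟨d', hd⟩ := hd
    have : d ≠ p := by grind
    grind
  · obtain ⟨c, hc, c', hc'⟩ := hp
    refine ⟨c, ?_, ?_⟩
    · grind
    · rcases hc' with h | ⟨rfl, rfl⟩ | ⟨rfl, rfl⟩
      · exact ⟨c', h.1⟩
      · exact ⟨p, hl.swap⟩
      · exact ⟨p, hr.swapRight⟩
  · intro c d hc hcd
    have e : ∀ s, Tri T b p s → s = a ∨ s = q := fun s hs => hT.third hl.rot hr h3 hs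
    have e' : ∀ s, Tri T b s p → s = a ∨ s = q := fun s hs => e s hs.swapRight
    have := hT.distinct hcd
    have q1 := hS a q
    have q2 := hS q a
    by_cases hcp : c = p
    · subst hcp
      have := e d hcd
      grind
    · by_cases hdp : d = p
      · subst hdp
        have := e' c hcd
        grind
      · have := hS c d
        grind
  · obtain ⟨d', hd⟩ := hd
    rcases hd with h | ⟨rfl, rfl⟩ | ⟨rfl, rfl⟩
    · exact ⟨d', h.1⟩
    · exact ⟨p, hl.swap⟩
    · exact ⟨p, hr.swapRight⟩

/-- In the link of `a` the flip subdivides the edge `b p` by `q`, so a set closed in the new link is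
closed in the old one, and only `q` has to be added. -/
theorem flip_link_added {T : Finset (Finset V)} (hT : Surf T) {a b p q : V}
    (h : Flippable T a b p q) (S : V → Prop) (hp : ∃ c, S c ∧ Nb (flip T a b p q) a c)
    (hS : ∀ c d, S c → Tri (flip T a b p q) a c d → S d) (d : V)
    (hd : Nb (flip T a b p q) a d) : S d := by
  obtain ⟨h1, h2, h3, h4, h5, h6⟩ := h.distinct hT
  have hl := h.left
  simp only [Nb, tri_flip_added hT h] at hS hp hd
  have q1 := hS b q
  have q2 := hS q b
  have q3 := hS p q
  have q4 := hS q p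
  have key : ∀ d, Nb T a d → S d := by
    intro d hd
    refine hT.link a S ?_ ?_ d hd
    · obtain ⟨c, hc, c', hc'⟩ := hp
      have hb : Nb T a b := ⟨p, hl⟩
      have hp' : Nb T a p := ⟨b, hl.swapRight⟩
      rcases hc' with h | h | h | h | h
      · exact ⟨c, hc, c', h.1⟩
      · exact ⟨b, by grind, hb⟩
      · exact ⟨b, by grind, hb⟩
      · exact ⟨p, by grind, hp'⟩
      · exact ⟨b, by grind, hb⟩
    · intro c d hc hcd
      have := hS c d
      grind
  obtain ⟨d', hd⟩ := hd
  have kb := key b ⟨p, hl⟩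
  rcases hd with h | h | h | h | h
  · exact key d ⟨d', h.1⟩
  all_goals grind

theorem flip_link {T : Finset (Finset V)} (hT : Surf T) {a b p q : V}
    (h : Flippable T a b p q) (x : V) (S : V → Prop) (hp : ∃ c, S c ∧ Nb (flip T a b p q) x c)
    (hS : ∀ c d, S c → Tri (flip T a b p q) x c d → S d) (d : V)
    (hd : Nb (flip T a b p q) x d) : S d := by
  by_cases ha : x = a
  · subst ha
    exact flip_link_added hT h S hp hS d hd
  by_cases hq : x = q
  · subst hq
    rw [flip_rotate] at hp hS hd
    exact flip_link_added hT h.rotate S hp hS d hd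
  by_cases hb : x = b
  · subst hb
    exact flip_link_removed hT h S hp hS d hd
  by_cases hp' : x = p
  · subst hp'
    rw [flip_swap] at hp hS hd
    exact flip_link_removed hT h.swap S hp hS d hd
  · have e : ∀ c d, Tri (flip T a b p q) x c d ↔ Tri T x c d := by
      intro c d
      simp only [tri_flip hT h, SameTriple, ha, hb, hp', hq, false_and, or_false, not_false_eq_true,
        and_true]
    simp only [Nb, e] at hS hp hd
    exact hT.link x S hp hS d hd

/-- The four sides of the quadrilateral survive and bypass the removed diagonal. -/
theorem flip_conn {T : Finset (Finset V)} (hT : Surf T) {a b p q : V}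
    (h : Flippable T a b p q) (S : V → Prop) (hp : ∃ c d, S c ∧ Nb (flip T a b p q) c d)
    (hS : ∀ c d, S c → Nb (flip T a b p q) c d → S d) (c d : V)
    (hd : Nb (flip T a b p q) c d) : S c := by
  obtain ⟨h1, h2, h3, h4, h5, h6⟩ := h.distinct hT
  have hl := h.left
  have hr := h.right
  have hab : Nb (flip T a b p q) a b := ⟨q, (tri_flip hT h _ _ _).2 (by simp [SameTriple])⟩
  have hbq : Nb (flip T a b p q) b q := ⟨a, (tri_flip hT h _ _ _).2 (by simp [SameTriple])⟩
  have hap : Nb (flip T a b p q) a p := ⟨q, (tri_flip hT h _ _ _).2 (by simp [SameTriple])⟩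
  have hpq : Nb (flip T a b p q) p q := ⟨a, (tri_flip hT h _ _ _).2 (by simp [SameTriple])⟩
  have hold : ∀ x y, Nb (flip T a b p q) x y → ∃ z, Nb T x z := by
    rintro x y ⟨z, hz⟩
    rcases (tri_flip hT h _ _ _).1 hz with hz | hz | hz
    · exact ⟨y, z, hz.1⟩
    all_goals
      have : x = a ∨ x = b ∨ x = p ∨ x = q := by
        simp only [SameTriple] at hz
        grind
      rcases this with rfl | rfl | rfl | rfl
      · exact ⟨_, _, hl⟩
      · exact ⟨_, _, hr⟩
      · exact ⟨_, _, hr.rot⟩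
      · exact ⟨_, _, hr.rot.rot⟩
  obtain ⟨c₀, d₀, hc₀, hcd₀⟩ := hp
  obtain ⟨e₀, he₀⟩ := hold _ _ hcd₀
  obtain ⟨e, he⟩ := hold _ _ hd
  refine hT.conn S ⟨c₀, e₀, hc₀, he₀⟩ ?_ c e he
  intro x y hx hxy
  obtain ⟨z, hz⟩ := hxy
  by_cases h1 : SameTriple x y z a b p
  · have s1 := hS a b
    have s2 := hS b a
    have s3 := hS a p
    have s4 := hS p a
    have := hab.symm
    have := hap.symm
    simp only [SameTriple] at h1
    grind
  by_cases h2 : SameTriple x y z b p q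
  · have s1 := hS b q
    have s2 := hS q b
    have s3 := hS q p
    have s4 := hS p q
    have := hbq.symm
    have := hpq.symm
    simp only [SameTriple] at h2
    grind
  · exact hS x y hx ⟨z, (tri_flip hT h _ _ _).2 (Or.inl ⟨hz, h1, h2⟩)⟩

theorem Flippable.surf {T : Finset (Finset V)} (hT : Surf T) {a b p q : V}
    (h : Flippable T a b p q) : Surf (flip T a b p q) where
  nonempty := ⟨a, b, q, (tri_flip hT h _ _ _).2 (Or.inr (Or.inl (Or.inl ⟨rfl, rfl, rfl⟩)))⟩
  card_face := card_of_mem_flip hT h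
  le_two := flip_le_two hT h
  link := flip_link hT h
  conn := flip_conn hT h

/-- The exchange of `{b, p}` with `{a, q}`: before the flip only the two faces of the quadrilateral
contain the first diagonal and none contains the second; afterwards it is the reverse. -/
theorem Flippable.homeomorph {T : Finset (Finset V)} (hT : Surf T) {a b p q : V}
    (h : Flippable T a b p q) : Nonempty (realization T ≃ₜ realization (flip T a b p q)) := by
  obtain ⟨h1, h2, h3, h4, h5, h6⟩ := h.distinct hT
  have hl := h.left
  have hr := h.right
  have hmem : ∀ t, t ∈ flip T a b p q ↔ (t ∈ T ∧ t ≠ {a, b, p} ∧ t ≠ {b, p, q}) ∨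
      t = {a, b, q} ∨ t = {a, p, q} := by
    intro t
    simp only [flip, Finset.mem_union, Finset.mem_filter, Finset.mem_insert, Finset.mem_singleton]
  have haq : ∀ t ∈ T, a ∈ t → q ∈ t → False := by
    intro t ht ha hq
    obtain ⟨z, rfl⟩ := eq_triple_of_mem (hT.card_face t ht) ha hq h3
    exact h.not_nb ⟨z, ht⟩
  have hbp : ∀ t ∈ T, b ∈ t → p ∈ t → t = {a, b, p} ∨ t = {b, p, q} := by
    intro t ht hb hp
    obtain ⟨z, rfl⟩ := eq_triple_of_mem (hT.card_face t ht) hb hp h4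
    rcases hT.third hl.rot hr h3 ht with rfl | rfl
    · left; grind
    · right; rfl
  have hs : ∀ (x y : V) (t : Finset V), ({x, y} : Finset V) ⊆ t ↔ x ∈ t ∧ y ∈ t := by
    intro x y t
    grind
  refine Exchange.homeomorph (σ := {b, p}) (τ := {a, q}) (by simp) (by simp) (by simp; grind)
    ⟨?_, ?_, ?_⟩ ⟨?_, ?_, ?_⟩
  · intro t ht hsub
    rw [hs] at hsub
    exact haq t ht hsub.1 hsub.2
  · intro t ht hsub c hc
    rw [hs] at hsub
    simp only [Finset.mem_insert, Finset.mem_singleton] at hc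
    rcases hc with rfl | rfl
    · refine ⟨{a, p, q}, (hmem _).2 (by simp), ?_⟩
      rcases hbp t ht hsub.1 hsub.2 with rfl | rfl <;> grind
    · refine ⟨{a, b, q}, (hmem _).2 (by simp), ?_⟩
      rcases hbp t ht hsub.1 hsub.2 with rfl | rfl <;> grind
  · intro t ht hsub
    rw [hs] at hsub
    exact ⟨t, (hmem _).2 (Or.inl ⟨ht, by grind⟩), le_rfl⟩
  · intro t ht hsub
    rw [hs] at hsub
    rcases (hmem t).1 ht with ht | rfl | rfl
    · rcases hbp t ht.1 hsub.1 hsub.2 with h | h <;> grind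
    · grind
    · grind
  · intro t ht hsub c hc
    rw [hs] at hsub
    simp only [Finset.mem_insert, Finset.mem_singleton] at hc
    have : t = {a, b, q} ∨ t = {a, p, q} := by
      rcases (hmem t).1 ht with ht | h
      · exact (haq t ht.1 hsub.1 hsub.2).elim
      · exact h
    rcases hc with rfl | rfl
    · exact ⟨{b, p, q}, hr, by rcases this with rfl | rfl <;> grind⟩
    · exact ⟨{a, b, p}, hl, by rcases this with rfl | rfl <;> grind⟩
  · intro t ht hsub
    rw [hs] at hsub
    rcases (hmem t).1 ht with ht | rfl | rfl
    · exact ⟨t, ht.1, le_rfl⟩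
    · grind
    · grind

/-! ### Edge contractions -/

/-- The combinatorial conditions under which the contraction of `a b` keeps the surface. -/
structure Collapsible (T : Finset (Finset V)) (a b : V) : Prop where
  nb : Nb T a b
  common : ∀ c, Nb T a c → Nb T b c → Tri T a b c
  no_double : ∀ c d, Tri T a c d → ¬ Tri T b c d
  kind : (∀ c, ¬ Bd T b c) ∨ Bd T a b
  other : ∃ x y z, Tri T x y z ∧ ((x ≠ a ∧ y ≠ a ∧ z ≠ a) ∨ (x ≠ b ∧ y ≠ b ∧ z ≠ b))

/-- An edge `a y` of the contraction gathers the faces on `a y` and on `b y`. If both edges exist,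
`a b y` is a face by `hcom`; it is lost on both sides, and at most one face remains on each. -/
theorem contract_le_two {T : Finset (Finset V)} (hT : Surf T) {a b : V} (hab : a ≠ b)
    (hcom : ∀ c, Nb T a c → Nb T b c → Tri T a b c) {x y c d e : V}
    (hc : Tri (contract T a b) x y c) (hd : Tri (contract T a b) x y d)
    (he : Tri (contract T a b) x y e) : c = d ∨ c = e ∨ d = e := by
  have main : ∀ y c d e, Tri (contract T a b) a y c → Tri (contract T a b) a y d →
      Tri (contract T a b) a y e → c = d ∨ c = e ∨ d = e := by
    intro y c d e hc hd he
    simp only [tri_contract hT.card_face hab] at hc hd he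
    have hy : ∀ c d, Tri T a y c → Tri T b y d → Tri T a y b ∧ Tri T b y a := by
      intro c d h1 h2
      have := hcom y ⟨c, h1⟩ ⟨d, h2⟩
      exact ⟨this.swapRight, this.rot⟩
    have l1 := @Surf.le_two _ _ _ hT a y
    have l2 := @Surf.le_two _ _ _ hT b y
    grind
  by_cases hxa : x = a
  · subst hxa
    exact main _ _ _ _ hc hd he
  by_cases hya : y = a
  · subst hya
    exact main _ _ _ _ hc.swap hd.swap he.swap
  simp only [tri_contract hT.card_face hab] at hc hd he
  have l1 := @Surf.le_two _ _ _ hT x y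
  grind

/-- Links are followed directly only when `b` has no neighbors besides `a`, `p`, `q`; flips reduce
every other case to this one. In the link of `a` the vertex `b` then plays the role of `p`, and in
all other links `b` is merely renamed `a`. -/
theorem contract_link {T : Finset (Finset V)} (hT : Surf T) {a b p q : V}
    (hp : Tri T a b p) (hN : ∀ c, Nb T b c → c = a ∨ c = p ∨ c = q)
    (hpq : q = p ∨ (Tri T b p q ∧ q ≠ a)) (x : V) (S : V → Prop)
    (hne : ∃ c, S c ∧ Nb (contract T a b) x c)
    (hS : ∀ c d, S c → Tri (contract T a b) x c d → S d) (d : V)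
    (hd : Nb (contract T a b) x d) : S d := by
  have hab := (hT.distinct hp).1
  have hdist := hT.distinct hp
  have hbp := tri_contract hT.card_face hab
  have hxb : x ≠ b := by
    obtain ⟨z, hz⟩ := hd
    exact ((hbp _ _ _).1 hz).2.1.1
  obtain ⟨c, hc, c', hcc⟩ := hne
  obtain ⟨d', hdd⟩ := hd
  by_cases hxa : x = a
  · subst hxa
    have hqp : S p ↔ S q := by
      rcases hpq with rfl | ⟨hpq, hq⟩
      · rfl
      · have hd := hT.distinct hpq
        have : Tri (contract T x b) x p q := (hbp _ _ _).2 (by grind)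
        exact ⟨fun h => hS _ _ h this, fun h => hS _ _ h this.swapRight⟩
    have main : ∀ d, Nb T x d → (d ≠ b ∧ S d) ∨ (d = b ∧ S p) := by
      intro d hd
      refine hT.link x (fun c => (c ≠ b ∧ S c) ∨ (c = b ∧ S p)) ?_ ?_ d hd
      · rcases ((hbp _ _ _).1 hcc).2.2 with h | h | h | h
        · exact ⟨c, by grind, c', h⟩
        · have := hN c ⟨c', h.2⟩
          exact ⟨b, by grind, p, hp⟩
        · grind
        · grind
      · intro c d hc hcd
        have hcd' := hT.distinct hcd
        by_cases hcb : c = b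
        · subst hcb
          have := hN d ⟨x, hcd.rot⟩
          grind
        · by_cases hdb : d = b
          · subst hdb
            have := hN c ⟨x, hcd.rot.swap⟩
            grind
          · have := hS c d
            grind
    have hb := main b ⟨p, hp⟩
    rcases ((hbp _ _ _).1 hdd).2.2 with h | h | h | h
    · have := main d ⟨_, h⟩
      grind
    · have := hN d ⟨d', h.2⟩
      grind
    · grind
    · grind
  · have key : ∀ d, Nb T x d → S (if d = b then a else d) := by
      intro d hd
      refine hT.link x (fun d => S (if d = b then a else d)) ?_ ?_ d hd
      · rcases ((hbp _ _ _).1 hcc).2.2 with h | h | h | h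
        · exact ⟨c, by grind, c', h⟩
        · grind
        · exact ⟨b, by grind, c', h.2⟩
        · exact ⟨c, by grind, b, h.2⟩
      · intro c d hc hcd
        have hcd' := hT.distinct hcd
        have h1 := hS c d
        have h2 := hS a d
        have h3 := hS c a
        grind
    have := ((hbp _ _ _).1 hdd).2
    rcases this.2 with h | h | h | h
    · have := key d ⟨d', h⟩
      grind
    · grind
    · have := key b ⟨d', h.2⟩
      grind
    · have := key d ⟨b, h.2⟩
      grind

theorem contract_conn {T : Finset (Finset V)} (hT : Surf T) {a b p q : V}
    (hp : Tri T a b p) (hN : ∀ c, Nb T b c → c = a ∨ c = p ∨ c = q)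
    (hpq : q = p ∨ (Tri T b p q ∧ q ≠ a)) (hap : Nb (contract T a b) a p) (S : V → Prop)
    (hne : ∃ c d, S c ∧ Nb (contract T a b) c d)
    (hS : ∀ c d, S c → Nb (contract T a b) c d → S d) (c d : V)
    (hd : Nb (contract T a b) c d) : S c := by
  have hab := (hT.distinct hp).1
  have hdist := hT.distinct hp
  have hbp := tri_contract hT.card_face hab
  have haq : Nb (contract T a b) a q := by
    rcases hpq with rfl | ⟨hpq, hq⟩
    · exact hap
    · have hd := hT.distinct hpq
      exact ⟨p, (hbp _ _ _).2 (by have := hpq.swapRight; grind)⟩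
  have hold : ∀ c d, Nb (contract T a b) c d →
      c ≠ b ∧ ((∃ e, Nb T c e) ∨ (c = a ∧ ∃ e, Nb T b e)) := by
    rintro c d ⟨e, he⟩
    have := ((hbp _ _ _).1 he).2
    refine ⟨this.1.1, ?_⟩
    rcases this.2 with h | h | h | h
    · exact Or.inl ⟨_, _, h⟩
    · exact Or.inr ⟨h.1, _, _, h.2⟩
    · exact Or.inl ⟨_, _, h.2⟩
    · exact Or.inl ⟨_, _, h.2⟩
  have key : ∀ x y, Nb T x y → S (if x = b then a else x) := by
    intro x y hxy
    refine hT.conn (fun x => S (if x = b then a else x)) ?_ ?_ x y hxy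
    · obtain ⟨c₀, d₀, h1, h2⟩ := hne
      obtain ⟨h3, ⟨e, h4⟩ | ⟨h4, e, h5⟩⟩ := hold _ _ h2
      · exact ⟨c₀, e, by grind, h4⟩
      · exact ⟨b, e, by grind, h5⟩
    · rintro c d hc ⟨e, he⟩
      have hcd' := hT.distinct he
      have hd : Nb T d e := ⟨c, he.rot⟩
      have step : ∀ c d, S c → d ≠ b → c ≠ b → Tri T c d b → c = a → S d := by
        rintro c d hsc hdb hcb h rfl
        have hcd := hT.distinct h
        have := hN d ⟨c, h.rot.swap⟩
        rcases this with h' | rfl | rfl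
        · exact absurd h'.symm hcd.1
        · exact hS _ _ hsc hap
        · exact hS _ _ hsc haq
      have step' : ∀ c d, S c → d ≠ b → c ≠ b → Tri T c d b → d = a → S d := by
        rintro c d hsc hdb hcb h rfl
        have hcd := hT.distinct h
        have := hN c ⟨d, h.rot.rot.swapRight.swapRight⟩
        rcases this with h' | rfl | rfl
        · exact absurd h' hcd.1
        · exact hS _ _ hsc hap.symm
        · exact hS _ _ hsc haq.symm
      by_cases hcb : c = b
      · subst hcb
        by_cases hda : d = a
        · grind
        · have hdc : d ≠ c := by grind
          by_cases hea : e = a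
          · subst hea
            have := hN d ⟨_, he⟩
            grind
          · have h1 := hS a d
            have : Nb (contract T a c) a d := ⟨e, (hbp _ _ _).2 (by grind)⟩
            grind
      · by_cases hdb : d = b
        · subst hdb
          by_cases hca : c = a
          · grind
          · by_cases hea : e = a
            · subst hea
              have := hN c ⟨_, he.swap⟩
              have := hap.symm
              have := haq.symm
              grind
            · have h1 := hS c a
              have : Nb (contract T a d) c a := ⟨e, (hbp _ _ _).2 (by grind)⟩
              grind
        · by_cases heb : e = b
          · subst heb
            by_cases hca : c = a
            · have := step c d (by grind) hdb hcb he hca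
              grind
            · by_cases hda : d = a
              · have := step' c d (by grind) hdb hcb he hda
                grind
              · have h1 := hS c d
                have : Nb (contract T a e) c d := ⟨a, (hbp _ _ _).2 (by grind)⟩
                grind
          · have h1 := hS c d
            have : Nb (contract T a b) c d := ⟨e, (hbp _ _ _).2 (by grind)⟩
            grind
  obtain ⟨h3, ⟨e, h4⟩ | ⟨h4, e, h5⟩⟩ := hold _ _ hd
  · have := key _ _ h4
    grind
  · have := key _ _ h5
    grind

theorem contract_surf_of_small {T : Finset (Finset V)} (hT : Surf T) {a b p q : V}
    (h : Collapsible T a b) (hp : Tri T a b p) (hN : ∀ c, Nb T b c → c = a ∨ c = p ∨ c = q)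
    (hpq : q = p ∨ (Tri T b p q ∧ q ≠ a)) (hap : Nb (contract T a b) a p) :
    Surf (contract T a b) where
  nonempty := ⟨a, p, hap⟩
  card_face := card_of_mem_contract hT.card_face
  le_two := contract_le_two hT (hT.distinct hp).1 h.common
  link := contract_link hT hp hN hpq
  conn := contract_conn hT hp hN hpq hap

/-- A 3-cycle is closed in the link, and the link is connected. -/
theorem nb_of_triangle_link {T : Finset (Finset V)} (hT : Surf T) {a b p q : V}
    (hp : Tri T a b p) (hq : Tri T a b q) (hpq : Tri T b p q) (c : V) (hc : Nb T b c) :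
    c = a ∨ c = p ∨ c = q := by
  obtain ⟨h1, h2, h3⟩ := hT.distinct hp
  obtain ⟨-, h4, h5⟩ := hT.distinct hq
  obtain ⟨-, -, h6⟩ := hT.distinct hpq
  refine hT.link b (fun c => c = a ∨ c = p ∨ c = q) ⟨a, by simp, p, hp.swap⟩ ?_ c hc
  rintro c d (rfl | rfl | rfl) hcd
  · exact Or.inr (hT.third hp.swap hq.swap h6 hcd)
  · rcases hT.third hp.rot hpq h4 hcd with h | h
    · exact Or.inl h
    · exact Or.inr (Or.inr h)
  · rcases hT.third hq.rot hpq.swapRight h2 hcd with h | h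
    · exact Or.inl h
    · exact Or.inr (Or.inl h)

theorem contract_eq_of_interior {T : Finset (Finset V)} (hT : Surf T) {a b p q : V}
    (hp : Tri T a b p) (hq : Tri T a b q) (hpq : Tri T b p q) :
    contract T a b = (T.filter fun t => b ∉ t) ∪ {{a, p, q}} := by
  obtain ⟨h1, h2, h3⟩ := hT.distinct hp
  obtain ⟨-, h4, h5⟩ := hT.distinct hq
  obtain ⟨-, -, h6⟩ := hT.distinct hpq
  refine faces_ext (card_of_mem_contract hT.card_face) ?_ ?_
  · intro t ht
    simp only [Finset.mem_union, Finset.mem_filter, Finset.mem_singleton] at ht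
    rcases ht with ht | rfl
    · exact hT.card_face t ht.1
    · exact Finset.card_eq_three.2 ⟨a, p, q, h2, h4, h6, rfl⟩
  · intro x y z
    have e : Tri ((T.filter fun t => b ∉ t) ∪ {{a, p, q}}) x y z ↔
        (Tri T x y z ∧ x ≠ b ∧ y ≠ b ∧ z ≠ b) ∨ SameTriple x y z a p q := by
      rw [← triple_eq_iff h2 h4 h6]
      simp only [Tri, Finset.mem_union, Finset.mem_filter, Finset.mem_insert,
        Finset.mem_singleton]
      grind
    rw [tri_contract hT.card_face h1, e]
    have hb : ∀ c d, Tri T b c d → c ≠ a → d ≠ a → (c = p ∧ d = q) ∨ (c = q ∧ d = p) := by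
      intro c d hcd hca hda
      have hS := nb_of_triangle_link hT hp hq hpq
      have := hS c ⟨d, hcd⟩
      have := hS d ⟨c, hcd.swapRight⟩
      have := hT.distinct hcd
      grind
    have hd := @Surf.distinct _ _ _ hT x y z
    have k1 := hb y z
    have k2 := hb x z
    have k3 := hb x y
    have r1 : Tri T x b z → Tri T b x z := Tri.swap
    have r2 : Tri T x y b → Tri T b x y := fun h => h.rot.rot
    have r3 : Tri T b x z → Tri T x b z := Tri.swap
    have r4 : Tri T b x y → Tri T x y b := fun h => h.rot
    clear e
    constructor
    · simp only [SameTriple]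
      grind
    · rintro (h | h)
      · exact ⟨hd h.1, h.2, Or.inl h.1⟩
      · have := hpq.swapRight
        rcases h with ⟨rfl, rfl, rfl⟩ | ⟨rfl, rfl, rfl⟩ | ⟨rfl, rfl, rfl⟩ | ⟨rfl, rfl, rfl⟩ |
          ⟨rfl, rfl, rfl⟩ | ⟨rfl, rfl, rfl⟩ <;> grind

theorem contract_eq_of_ear {T : Finset (Finset V)} (hT : Surf T) {a b p : V}
    (hp : Tri T a b p) (hN : ∀ c, Nb T b c → c = a ∨ c = p) :
    contract T a b = T.filter fun t => b ∉ t := by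
  obtain ⟨h1, h2, h3⟩ := hT.distinct hp
  refine faces_ext (card_of_mem_contract hT.card_face) ?_ ?_
  · intro t ht
    exact hT.card_face t (Finset.mem_filter.1 ht).1
  · intro x y z
    have e : Tri (T.filter fun t => b ∉ t) x y z ↔
        (Tri T x y z ∧ x ≠ b ∧ y ≠ b ∧ z ≠ b) := by
      simp only [Tri, Finset.mem_filter]
      grind
    rw [tri_contract hT.card_face h1, e]
    have hb : ∀ c d, Tri T b c d → c ≠ a → d ≠ a → False := by
      intro c d hcd hca hda
      have := hN c ⟨d, hcd⟩
      have := hN d ⟨c, hcd.swapRight⟩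
      have := hT.distinct hcd
      grind
    have hd := @Surf.distinct _ _ _ hT x y z
    have k1 := hb y z
    have k2 := hb x z
    have k3 := hb x y
    have r1 : Tri T x b z → Tri T b x z := Tri.swap
    have r2 : Tri T x y b → Tri T b x y := fun h => h.rot.rot
    grind

/-- With a triangular link the contraction erases `b` from the triangle `a p q`: the exchange of
`{b}` with `{a, p, q}`. By `no_double`, `a p q` was not a face before. -/
theorem contract_homeomorph_of_interior {T : Finset (Finset V)} (hT : Surf T) {a b p q : V}
    (h : Collapsible T a b) (hp : Tri T a b p) (hq : Tri T a b q) (hpq : Tri T b p q) :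
    Nonempty (realization T ≃ₜ realization (contract T a b)) := by
  obtain ⟨h1, h2, h3⟩ := hT.distinct hp
  obtain ⟨-, h4, h5⟩ := hT.distinct hq
  obtain ⟨-, -, h6⟩ := hT.distinct hpq
  have hN := nb_of_triangle_link hT hp hq hpq
  rw [contract_eq_of_interior hT hp hq hpq]
  have hmem : ∀ t, t ∈ (T.filter fun t => b ∉ t) ∪ {{a, p, q}} ↔
      (t ∈ T ∧ b ∉ t) ∨ t = {a, p, q} := by
    intro t
    simp only [Finset.mem_union, Finset.mem_filter, Finset.mem_singleton]
  have hs : ∀ (x y z : V) (t : Finset V), ({x, y, z} : Finset V) ⊆ t ↔ x ∈ t ∧ y ∈ t ∧ z ∈ t := by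
    intro x y z t
    grind
  have hno : ∀ t ∈ T, a ∈ t → p ∈ t → q ∈ t → False := by
    intro t ht ha hp hq
    obtain ⟨z, rfl⟩ := eq_triple_of_mem (hT.card_face t ht) ha hp h2
    have : z = q := by grind
    subst this
    exact h.no_double p z ht hpq
  refine Exchange.homeomorph (σ := {b}) (τ := {a, p, q}) (by simp) (by simp) (by simp; grind)
    ⟨?_, ?_, ?_⟩ ⟨?_, ?_, ?_⟩
  · intro t ht hsub
    rw [hs] at hsub
    exact hno t ht hsub.1 hsub.2.1 hsub.2.2
  · intro t ht hsub c hc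
    rw [Finset.mem_singleton] at hc
    subst hc
    refine ⟨{a, p, q}, (hmem _).2 (by simp), ?_⟩
    rw [Finset.singleton_subset_iff] at hsub
    intro x hx
    rw [Finset.mem_union, Finset.mem_erase] at hx
    rcases hx with ⟨hxc, hx⟩ | hx
    · obtain ⟨z, rfl⟩ := eq_triple_of_mem (hT.card_face t ht) hsub hx hxc.symm
      have := hN x ⟨z, ht⟩
      simpa using this
    · exact hx
  · intro t ht hsub
    rw [Finset.singleton_subset_iff] at hsub
    exact ⟨t, (hmem t).2 (Or.inl ⟨ht, hsub⟩), le_rfl⟩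
  · intro t ht hsub
    rw [Finset.singleton_subset_iff] at hsub
    rcases (hmem t).1 ht with h | rfl
    · exact h.2 hsub
    · grind
  · intro t ht hsub c hc
    rw [hs] at hsub
    have : t = {a, p, q} := by
      rcases (hmem t).1 ht with h | h
      · exact (hno t h.1 hsub.1 hsub.2.1 hsub.2.2).elim
      · exact h
    subst this
    simp only [Finset.mem_insert, Finset.mem_singleton] at hc
    rcases hc with rfl | rfl | rfl
    · exact ⟨_, hpq, by grind⟩
    · exact ⟨_, hq, by grind⟩
    · exact ⟨_, hp, by grind⟩
  · intro t ht hsub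
    rw [hs] at hsub
    rcases (hmem t).1 ht with h | rfl
    · exact ⟨t, h.1, le_rfl⟩
    · grind

/-- Flipping `a p` to `b r` turns the ear into a subdivision of the triangle `a p r` by a point `b`
of its side `a p`. Erasing that point is the exchange of `{b}` with `{a, p}`. -/
theorem contract_homeomorph_of_ear {T : Finset (Finset V)} (hT : Surf T) {a b p r : V}
    (hp : Tri T a b p) (hN : ∀ c, Nb T b c → c = a ∨ c = p) (hr : Tri T a p r) (hrb : r ≠ b) :
    Nonempty (realization T ≃ₜ realization (contract T a b)) := by
  obtain ⟨h1, h2, h3⟩ := hT.distinct hp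
  obtain ⟨-, h4, h5⟩ := hT.distinct hr
  have hf : Flippable T b a p r := by
    refine ⟨hp.swap, hr, hrb.symm, fun hbr => ?_⟩
    rcases hN r hbr with h | h
    · exact h4 h.symm
    · exact h5 h.symm
  obtain ⟨e₁⟩ := hf.homeomorph hT
  suffices Nonempty (realization (flip T b a p r) ≃ₜ realization (contract T a b)) from
    this.map fun e₂ => e₁.trans e₂
  rw [contract_eq_of_ear hT hp hN]
  have hmem : ∀ t, t ∈ flip T b a p r ↔ (t ∈ T ∧ t ≠ {b, a, p} ∧ t ≠ {a, p, r}) ∨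
      t = {b, a, r} ∨ t = {b, p, r} := by
    intro t
    simp only [flip, Finset.mem_union, Finset.mem_filter, Finset.mem_insert, Finset.mem_singleton]
  have hmem' : ∀ t, t ∈ (T.filter fun t => b ∉ t) ↔ t ∈ T ∧ b ∉ t := by
    intro t
    rw [Finset.mem_filter]
  have hs : ∀ (x y : V) (t : Finset V), ({x, y} : Finset V) ⊆ t ↔ x ∈ t ∧ y ∈ t := by
    intro x y t
    grind
  have hap : ∀ t ∈ T, a ∈ t → p ∈ t → t = {b, a, p} ∨ t = {a, p, r} := by
    intro t ht ha hp'
    obtain ⟨z, rfl⟩ := eq_triple_of_mem (hT.card_face t ht) ha hp' h2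
    rcases hT.third hp.swapRight hr hrb.symm ht with rfl | rfl
    · left; grind
    · right; rfl
  have hb : ∀ t ∈ T, b ∈ t → t = {b, a, p} := by
    intro t ht hbt
    obtain ⟨x, y, z, -, -, -, rfl⟩ := Finset.card_eq_three.1 (hT.card_face t ht)
    have key : ∀ x y, Tri T b x y → ({b, x, y} : Finset V) = {b, a, p} := by
      intro x y hxy
      have := hN x ⟨y, hxy⟩
      have := hN y ⟨x, hxy.swapRight⟩
      have := hT.distinct hxy
      grind
    simp only [Finset.mem_insert, Finset.mem_singleton] at hbt
    rcases hbt with rfl | rfl | rfl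
    · exact key _ _ ht
    · rw [← key _ _ (Tri.swap ht)]
      grind
    · rw [← key _ _ (Tri.rot (Tri.rot ht))]
      grind
  refine Exchange.homeomorph (σ := {b}) (τ := {a, p}) (by simp) (by simp) (by simp; grind)
    ⟨?_, ?_, ?_⟩ ⟨?_, ?_, ?_⟩
  · intro t ht hsub
    rw [hs] at hsub
    rcases (hmem t).1 ht with h | rfl | rfl
    · have := hap t h.1 hsub.1 hsub.2
      grind
    · grind
    · grind
  · intro t ht hsub c hc
    rw [Finset.mem_singleton] at hc
    subst hc
    rw [Finset.singleton_subset_iff] at hsub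
    refine ⟨{a, p, r}, (hmem' _).2 ⟨hr, by grind⟩, ?_⟩
    rcases (hmem t).1 ht with h | rfl | rfl
    · have := hb t h.1 hsub
      grind
    · grind
    · grind
  · intro t ht hsub
    rw [Finset.singleton_subset_iff] at hsub
    exact ⟨t, (hmem' t).2 (by grind), le_rfl⟩
  · intro t ht hsub
    rw [Finset.singleton_subset_iff] at hsub
    exact ((hmem' t).1 ht).2 hsub
  · intro t ht hsub c hc
    rw [hs] at hsub
    have ht' := (hmem' t).1 ht
    have : t = {a, p, r} := by
      have := hap t ht'.1 hsub.1 hsub.2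
      grind
    subst this
    simp only [Finset.mem_insert, Finset.mem_singleton] at hc
    rcases hc with rfl | rfl
    · exact ⟨{b, p, r}, (hmem _).2 (by simp), by grind⟩
    · exact ⟨{b, a, r}, (hmem _).2 (by simp), by grind⟩
  · intro t ht hsub
    rw [hs] at hsub
    have ht' := (hmem' t).1 ht
    exact ⟨t, (hmem _).2 (Or.inl (by grind)), le_rfl⟩

/-- Away from `a` and `b`, the flip only moves the edge `p q` from the link of `b` to the link of
`a`, and the contraction merges these two links. -/
theorem contract_flip {T : Finset (Finset V)} (hT : Surf T) {a b p q : V}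
    (h : Flippable T a b p q) : contract (flip T a b p q) a b = contract T a b := by
  obtain ⟨h1, h2, h3, h4, h5, h6⟩ := h.distinct hT
  have hT' := h.surf hT
  refine faces_ext (card_of_mem_contract hT'.card_face) (card_of_mem_contract hT.card_face) ?_
  have hlink : ∀ y z, y ≠ a → z ≠ a → y ≠ b → z ≠ b →
      ((Tri (flip T a b p q) a y z ∨ Tri (flip T a b p q) b y z) ↔ (Tri T a y z ∨ Tri T b y z)) := by
    intro y z hya hza hyb hzb
    rw [tri_flip_added hT h, tri_flip_removed hT h]
    have e : ∀ s, Tri T b p s → s = a ∨ s = q := fun s hs => hT.third h.left.rot h.right h3 hs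
    have e' : ∀ s, Tri T b s p → s = a ∨ s = q := fun s hs => e s hs.swapRight
    have := h.right
    have := h.right.swapRight
    grind
  have hout : ∀ x y z, x ≠ a → y ≠ a → z ≠ a → x ≠ b → y ≠ b → z ≠ b →
      (Tri (flip T a b p q) x y z ↔ Tri T x y z) := by
    intro x y z _ _ _ _ _ _
    rw [tri_flip hT h]
    simp only [SameTriple]
    grind
  have main : ∀ T : Finset (Finset V), Surf T → ∀ x y z, Tri (contract T a b) x y z ↔
      (x ≠ y ∧ x ≠ z ∧ y ≠ z) ∧ (x ≠ b ∧ y ≠ b ∧ z ≠ b) ∧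
      ((x ≠ a ∧ y ≠ a ∧ z ≠ a ∧ Tri T x y z) ∨ (x = a ∧ (Tri T a y z ∨ Tri T b y z)) ∨
        (y = a ∧ (Tri T a x z ∨ Tri T b x z)) ∨ (z = a ∧ (Tri T a x y ∨ Tri T b x y))) := by
    intro T hT x y z
    rw [tri_contract hT.card_face h1]
    have r1 : ∀ c, Tri T x c z ↔ Tri T c x z := fun c => ⟨Tri.swap, Tri.swap⟩
    have r2 : ∀ c, Tri T x y c ↔ Tri T c x y := fun c => ⟨fun h => h.rot.rot, Tri.rot⟩
    grind
  intro x y z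
  rw [main _ hT', main _ hT]
  have := hlink y z
  have := hlink x z
  have := hlink x y
  have := hout x y z
  clear hlink hout main
  by_cases hx : x = a <;> by_cases hy : y = a <;> by_cases hz : z = a <;> grind

/-- Keeps the induction in `Collapsible.contract` going after a flip; `q` replaces `p` as a third
vertex on `a b`. -/
theorem Collapsible.flip {T : Finset (Finset V)} (hT : Surf T) {a b p q : V}
    (h : Collapsible T a b) (hf : Flippable T a b p q) :
    Collapsible (flip T a b p q) a b := by
  obtain ⟨h1, h2, h3, h4, h5, h6⟩ := hf.distinct hT
  have hl := hf.left
  have hr := hf.right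
  have ha := tri_flip_added hT hf
  have hb := tri_flip_removed hT hf
  have hnab : ¬ Tri T a b q := fun h => hf.not_nb ⟨b, h.swapRight⟩
  have e : ∀ s, Tri T b p s → s = a ∨ s = q := fun s hs => hT.third hl.rot hr h3 hs
  have e' : ∀ s, Tri T b s p → s = a ∨ s = q := fun s hs => e s hs.swapRight
  refine ⟨⟨q, (ha _ _).2 (by simp)⟩, ?_, ?_, ?_, ?_⟩
  · rintro c ⟨d, hd⟩ ⟨e, he⟩
    rw [ha] at hd ⊢
    rw [hb] at he
    have hbc : c ≠ b := by
      have := @Surf.distinct _ _ _ hT b c e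
      grind
    have hca : c ≠ a := by
      have := @Surf.distinct _ _ _ hT a c d
      grind
    by_cases hcq : c = q
    · simp [hcq]
    by_cases hcp : c = p
    · grind
    · have h1 : Nb T a c := ⟨d, by grind⟩
      have h2 : Nb T b c := ⟨e, by grind⟩
      have := h.common c h1 h2
      grind
  · intro c d hac hbc
    rw [ha] at hac
    rw [hb] at hbc
    have := h.no_double c d
    have := @Surf.distinct _ _ _ hT a c d
    have := @Surf.distinct _ _ _ hT b c d
    grind
  · rcases h.kind with h | h
    · left
      rintro c ⟨d, hd, hu⟩
      simp only [hb] at hd hu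
      have two : ∀ c, Nb T b c → ∃ d e, d ≠ e ∧ Tri T b c d ∧ Tri T b c e := by
        rintro c ⟨d, hd⟩
        by_contra! hne
        exact h c ⟨d, hd, fun w hw => by_contra fun h' => hne w d h' hw hd⟩
      by_cases hcp : c = p
      · grind
      have hNc : Nb T b c := by
        rcases hd with h | h | h
        · exact ⟨d, h.1⟩
        · rw [h.1]; exact ⟨p, hl.swap⟩
        · rw [h.1]; exact ⟨p, hr.swapRight⟩
      obtain ⟨x, y, hxy, hx, hy⟩ := two c hNc
      have u1 := hu x
      have u2 := hu y
      have u3 := hu a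
      have u4 := hu q
      have dx := hT.distinct hx
      have dy := hT.distinct hy
      have ex := e' c
      have n1 : ¬ Tri T b a q := fun h => hnab h.swap
      have n2 : ¬ Tri T b q a := fun h => hnab h.rot.rot
      clear two ha hb hu
      by_cases hca : c = a
      · subst hca
        have := u4 (by simp)
        by_cases hxp : x = p
        · have := u2 (Or.inl ⟨hy, hcp, by grind⟩)
          grind
        · have := u1 (Or.inl ⟨hx, hcp, hxp⟩)
          grind
      by_cases hcq : c = q
      · subst hcq
        have := u3 (by simp)
        by_cases hxp : x = p
        · have := u2 (Or.inl ⟨hy, hcp, by grind⟩)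
          grind
        · have := u1 (Or.inl ⟨hx, hcp, hxp⟩)
          grind
      have := u1 (Or.inl ⟨hx, hcp, by grind⟩)
      have := u2 (Or.inl ⟨hy, hcp, by grind⟩)
      grind
    · right
      obtain ⟨d, hd, hu⟩ := h
      have hdp := hu p hl
      refine ⟨q, (ha _ _).2 (by simp), ?_⟩
      intro w hw
      rw [ha] at hw
      have := hu w
      grind
  · refine ⟨a, p, q, (ha _ _).2 (by simp), Or.inr ⟨h1, h4.symm, h5.symm⟩⟩

theorem neighbors_flip_card_lt {T : Finset (Finset V)} (hT : Surf T) {a b p q : V}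
    (hf : Flippable T a b p q) :
    (neighbors (flip T a b p q) b).card < (neighbors T b).card := by
  obtain ⟨h1, h2, h3, h4, h5, h6⟩ := hf.distinct hT
  have hT' := hf.surf hT
  apply Finset.card_lt_card
  rw [Finset.ssubset_iff_of_subset]
  · refine ⟨p, (mem_neighbors hT.card_face).2 ⟨a, hf.left.rot⟩, ?_⟩
    rw [mem_neighbors hT'.card_face]
    rintro ⟨d, hd⟩
    rw [tri_flip_removed hT hf] at hd
    grind
  · intro c hc
    rw [mem_neighbors hT'.card_face] at hc
    rw [mem_neighbors hT.card_face]
    obtain ⟨d, hd⟩ := hc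
    rw [tri_flip_removed hT hf] at hd
    rcases hd with h | h | h
    · exact ⟨d, h.1⟩
    · rw [h.1]; exact ⟨p, hf.left.swap⟩
    · rw [h.1]; exact ⟨p, hf.right.swapRight⟩

/-- If no side has a second face, the three vertices are closed under adjacency, and connectedness
leaves no others. -/
theorem eq_of_boundary_face {T : Finset (Finset V)} (hT : Surf T) {a b c : V} (h : Tri T a b c)
    (hab : ∀ w, Tri T a b w → w = c) (hac : ∀ w, Tri T a c w → w = b)
    (hbc : ∀ w, Tri T b c w → w = a) {x y z : V} (hxyz : Tri T x y z) :
    SameTriple x y z a b c := by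
  have link : ∀ a b c, Tri T a b c → (∀ w, Tri T a b w → w = c) → (∀ w, Tri T a c w → w = b) →
      ∀ d, Nb T a d → d = b ∨ d = c := by
    intro a b c h hab hac d hd
    refine hT.link a (fun d => d = b ∨ d = c) ⟨b, by simp, c, h⟩ ?_ d hd
    rintro p q (rfl | rfl) hpq
    · exact Or.inr (hab _ hpq)
    · exact Or.inl (hac _ hpq)
  have la := link a b c h hab hac
  have lb := link b a c h.swap (fun w hw => hab w hw.swap) hbc
  have lc := link c a b h.rot.rot (fun w hw => hac w hw.swap) (fun w hw => hbc w hw.swap)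
  have conn : ∀ p q, Nb T p q → p = a ∨ p = b ∨ p = c := by
    refine hT.conn (fun p => p = a ∨ p = b ∨ p = c) ⟨a, b, by simp, c, h⟩ ?_
    rintro p q (rfl | rfl | rfl) hpq
    · have := la q hpq
      grind
    · have := lb q hpq
      grind
    · have := lc q hpq
      grind
  have h1 := conn x y ⟨z, hxyz⟩
  have h2 := conn y z ⟨x, hxyz.rot⟩
  have h3 := conn z x ⟨y, hxyz.rot.rot⟩
  have := hT.distinct hxyz
  unfold SameTriple
  grind

/-- The contraction of a collapsible edge yields a triangulation of the same surface. -/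
theorem Collapsible.contract {T : Finset (Finset V)} (hT : Surf T) {a b : V}
    (h : Collapsible T a b) :
    Surf (contract T a b) ∧ Nonempty (realization T ≃ₜ realization (contract T a b)) := by
  -- Induction on the degree of `b`: flips of edges at `b` lower it without changing the
  -- contraction, until the link of `b` is a triangle or `b` lies in a single face.
  induction hn : (neighbors T b).card using Nat.strong_induction_on generalizing T with
  | _ n ih =>
  subst hn
  by_cases hflip : ∃ p q, Tri T a b p ∧ Tri T b p q ∧ q ≠ a ∧ ¬ Tri T a b q
  · obtain ⟨p, q, hp, hpq, hqa, hq⟩ := hflip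
    have hf : Flippable T a b p q :=
      ⟨hp, hpq, hqa.symm, fun haq => hq (h.common q haq ⟨p, hpq.swapRight⟩)⟩
    obtain ⟨hs, ⟨e⟩⟩ := ih _ (neighbors_flip_card_lt hT hf) (hf.surf hT) (h.flip hT hf) rfl
    obtain ⟨e'⟩ := hf.homeomorph hT
    rw [contract_flip hT hf] at hs e
    exact ⟨hs, ⟨e'.trans e⟩⟩
  · push Not at hflip
    obtain ⟨p, hp⟩ := h.nb
    obtain ⟨h1, h2, h3⟩ := hT.distinct hp
    by_cases hq : ∃ q, Tri T b p q ∧ q ≠ a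
    · obtain ⟨q, hpq, hqa⟩ := hq
      have hq := hflip p q hp hpq hqa
      refine ⟨contract_surf_of_small hT h hp (nb_of_triangle_link hT hp hq hpq)
        (Or.inr ⟨hpq, hqa⟩) ⟨q, ?_⟩, contract_homeomorph_of_interior hT h hp hq hpq⟩
      rw [tri_contract hT.card_face h1]
      have := hT.distinct hpq
      grind
    -- Now `b p` is a boundary edge, so by `kind` the edge `a b` is one as well, and `b` is a vertex
    -- of the face `a b p` only.
    · push Not at hq
      have hbd : ∀ w, Tri T a b w → w = p := by
        have : Bd T a b := by
          rcases h.kind with h | h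
          · exact absurd ⟨a, hp.rot, hq⟩ (h p)
          · exact h
        obtain ⟨c, -, hc⟩ := this
        intro w hw
        rw [hc w hw, hc p hp]
      have hN : ∀ c, Nb T b c → c = a ∨ c = p := by
        refine hT.link b (fun c => c = a ∨ c = p) ⟨a, by simp, p, hp.swap⟩ ?_
        rintro c d (rfl | rfl) hcd
        · exact Or.inr (hbd d hcd.swap)
        · exact Or.inl (hq d hcd)
      -- Without a second face on `a p`, the whole complex would be `a b p`, against `other`.
      have hr : ∃ r, Tri T a p r ∧ r ≠ b := by
        by_contra! hr
        obtain ⟨x, y, z, hxyz, hne⟩ := h.other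
        have := eq_of_boundary_face hT hp hbd hr hq hxyz
        simp only [SameTriple] at this
        grind
      obtain ⟨r, hr, hrb⟩ := hr
      refine ⟨contract_surf_of_small hT h hp (fun c hc => ?_) (Or.inl rfl) ⟨r, ?_⟩,
        contract_homeomorph_of_ear hT hp hN hr hrb⟩
      · have := hN c hc
        grind
      · rw [tri_contract hT.card_face h1]
        have := hT.distinct hr
        grind

theorem single_face_homeomorph_ball {T : Finset (Finset V)} (hT : Surf T) {a b c : V}
    (h : Tri T a b c) (hab : ∀ w, Tri T a b w → w = c) (hac : ∀ w, Tri T a c w → w = b)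
    (hbc : ∀ w, Tri T b c w → w = a) :
    Nonempty (realization T ≃ₜ Metric.closedBall (0 : EuclideanSpace ℝ (Fin 2)) 1) := by
  obtain ⟨h1, h2, h3⟩ := hT.distinct h
  have hT' : T = {{a, b, c}} := by
    refine faces_ext hT.card_face ?_ ?_
    · intro t ht
      rw [Finset.mem_singleton] at ht
      rw [ht]
      exact hT.card_face _ h
    · intro x y z
      rw [show Tri {{a, b, c}} x y z ↔ SameTriple x y z a b c by
        rw [← triple_eq_iff h1 h2 h3]; simp [Tri]]
      exact ⟨eq_of_boundary_face hT h hab hac hbc, fun hs => hs.tri h⟩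
  rw [hT']
  obtain ⟨e₁⟩ := realization_face_homeomorph h1 h2 h3
  obtain ⟨e₂⟩ := planeTriangle_homeomorph_ball
  exact ⟨e₁.trans e₂⟩

/-! ### Degrees and the class of triangulations -/

/-- The combinatorial part of the definition of the class. -/
structure Good (T : Finset (Finset V)) : Prop where
  surf : Surf T
  three_le : ∀ x y, Nb T x y → 3 ≤ deg T x
  four_le : ∀ x y, Nb T x y → (∀ z, ¬ Bd T x z) → 4 ≤ deg T x

/-- A vertex of the smallest degree permitted in the class. -/
def Light (T : Finset (Finset V)) (x : V) : Prop :=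
  ((∃ y, Bd T x y) ∧ deg T x = 3) ∨ ((∀ y, ¬ Bd T x y) ∧ deg T x = 4)

theorem inClass_iff {F : Type v} [TopologicalSpace F] {T : Finset (Finset V)} :
    InClass F T ↔ Good T ∧ Nonempty (realization T ≃ₜ F) := by
  constructor
  · rintro ⟨⟨h1, h2⟩, h3, h4⟩
    refine ⟨⟨h1.surf, fun x y hxy => h3 x ((mem_vertices h1.card_face).2 ⟨y, hxy⟩),
      fun x y hxy hx => h4 x ((mem_vertices h1.card_face).2 ⟨y, hxy⟩) ?_⟩, h2⟩
    rw [mem_boundaryVertices h1.card_face]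
    rintro ⟨z, hz⟩
    exact hx z hz
  · rintro ⟨h, h2⟩
    have hc := h.surf.card_face
    refine ⟨⟨h.surf.isTriangulatedSurface, h2⟩, ?_, ?_⟩
    · intro x hx
      obtain ⟨y, hy⟩ := (mem_vertices hc).1 hx
      exact h.three_le x y hy
    · intro x hx hxb
      obtain ⟨y, hy⟩ := (mem_vertices hc).1 hx
      rw [mem_boundaryVertices hc] at hxb
      exact h.four_le x y hy fun z hz => hxb ⟨z, hz⟩

theorem deg_le {T : Finset (Finset V)} (hT : Surf T) {x : V} (s : Finset V)
    (h : ∀ c, Nb T x c → c ∈ s) : deg T x ≤ s.card :=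
  Finset.card_le_card fun c hc => h c ((mem_neighbors hT.card_face).1 hc)

theorem le_deg {T : Finset (Finset V)} (hT : Surf T) {x : V} (s : Finset V)
    (h : ∀ c ∈ s, Nb T x c) : s.card ≤ deg T x :=
  Finset.card_le_card fun c hc => (mem_neighbors hT.card_face).2 (h c hc)

theorem nb_iff_of_deg_le {T : Finset (Finset V)} (hT : Surf T) {x : V} (s : Finset V)
    (h : ∀ c ∈ s, Nb T x c) (hd : deg T x ≤ s.card) (c : V) : Nb T x c ↔ c ∈ s := by
  rw [Finset.eq_of_subset_of_card_le (fun c hc => (mem_neighbors hT.card_face).2 (h c hc)) hd,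
    mem_neighbors hT.card_face]

theorem exists_nb_of_lt_deg {T : Finset (Finset V)} (hT : Surf T) {x : V} (s : Finset V)
    (h : s.card < deg T x) : ∃ c, Nb T x c ∧ c ∉ s := by
  obtain ⟨c, hc, hcs⟩ := Finset.exists_mem_notMem_of_card_lt_card h
  exact ⟨c, (mem_neighbors hT.card_face).1 hc, hcs⟩

theorem other_third {T : Finset (Finset V)} {x y z : V} (h : Tri T x y z)
    (hb : ¬ Bd T x y) : ∃ w, Tri T x y w ∧ w ≠ z := by
  by_contra! hne
  exact hb ⟨z, h, hne⟩

theorem Surf.not_bd {T : Finset (Finset V)} {x y p q : V} (hp : Tri T x y p)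
    (hq : Tri T x y q) (hpq : p ≠ q) : ¬ Bd T x y := by
  rintro ⟨z, -, h⟩
  exact hpq ((h p hp).trans (h q hq).symm)

/-- A 3-cycle in the link of `x` is the whole link, so `x` would be an inner vertex of degree three.
-/
theorem Good.no_triangle_link {T : Finset (Finset V)} (hT : Good T) {x a b c : V}
    (hab : Tri T x a b) (hbc : Tri T x b c) (hca : Tri T x c a) : False := by
  have h1 := hT.surf.distinct hab
  have h2 := hT.surf.distinct hbc
  have h3 := hT.surf.distinct hca
  have hN := nb_of_triangle_link hT.surf hab.swap hca.rot.rot hbc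
  have hin : ∀ y, ¬ Bd T x y := by
    intro y hy
    rcases hN y hy.nb with rfl | rfl | rfl
    · exact Surf.not_bd hab hca.swapRight h2.2.2 hy
    · exact Surf.not_bd hbc hab.swapRight h3.2.2 hy
    · exact Surf.not_bd hca hbc.swapRight h1.2.2 hy
  have := hT.four_le x a ⟨b, hab⟩ hin
  have h4 := deg_le hT.surf {a, b, c} (x := x) (by intro y hy; simpa using hN y hy)
  have := Finset.card_le_three (a := a) (b := b) (c := c)
  omega

/-- If `x a` and `x b` had no second face, `x` would have degree two. -/
theorem Good.third_of_nb {T : Finset (Finset V)} (hT : Good T) {x a b : V} (h : Tri T x a b) :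
    (∃ w, Tri T x a w ∧ w ≠ b) ∨ ∃ w, Tri T x b w ∧ w ≠ a := by
  by_contra! hne
  have hN : ∀ c, Nb T x c → c = a ∨ c = b := by
    refine hT.surf.link x (fun c => c = a ∨ c = b) ⟨a, by simp, b, h⟩ ?_
    rintro c d (rfl | rfl) hcd
    · exact Or.inr (hne.1 d hcd)
    · exact Or.inl (hne.2 d hcd)
  have := hT.three_le x a ⟨b, h⟩
  have h4 := deg_le hT.surf {a, b} (x := x) (by intro y hy; simpa using hN y hy)
  have := Finset.card_le_two (a := a) (b := b)
  omega

/-- Inside the class `no_double` and `other` are automatic: an edge in both links would create a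
triangular link, and a third vertex of `a b` has a neighbor outside `a b`. -/
theorem Good.collapsible {T : Finset (Finset V)} (hT : Good T) {a b : V} (hab : Nb T a b)
    (hcom : ∀ c, Nb T a c → Nb T b c → Tri T a b c)
    (kind : (∀ c, ¬ Bd T b c) ∨ Bd T a b) : Collapsible T a b := by
  refine ⟨hab, hcom, ?_, kind, ?_⟩
  · intro c d hac hbc
    have h1 := hcom c ⟨d, hac⟩ ⟨d, hbc⟩
    exact hT.no_triangle_link h1.rot.rot hbc.swap hac.rot
  · obtain ⟨p, hp⟩ := hab
    obtain ⟨x, ⟨y, hxy⟩, hx⟩ := exists_nb_of_lt_deg hT.surf {a, b} (x := p)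
      (lt_of_le_of_lt Finset.card_le_two (hT.three_le p a ⟨b, hp.rot.rot⟩))
    have := hT.surf.distinct hp
    have := hT.surf.distinct hxy
    refine ⟨p, x, y, hxy, ?_⟩
    grind

/-- Boundary edges at `a` correspond to the vertices of odd degree in the link of `a`; by the
handshake lemma there is never just one. -/
theorem exists_other_bd {T : Finset (Finset V)} (hT : Surf T) {a b : V} (h : Bd T a b) :
    ∃ c, c ≠ b ∧ Bd T a c := by
  classical
  have hmem : ∀ {c}, c ∈ neighbors T a ↔ Nb T a c := mem_neighbors hT.card_face
  let G : SimpleGraph (neighbors T a) := (linkGraph T a).comap Subtype.val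
  have hG : ∀ c d : neighbors T a, G.Adj c d ↔ Tri T a c d := by
    intro c d
    refine ⟨fun h => h.2.2.2, fun h => ?_⟩
    have := hT.distinct h
    exact ⟨this.2.2, this.1, this.2.1, h⟩
  have hodd : Odd (G.degree ⟨b, hmem.2 h.nb⟩) := by
    obtain ⟨p, hp, hu⟩ := h
    have : G.neighborFinset ⟨b, hmem.2 ⟨p, hp⟩⟩ = {⟨p, hmem.2 ⟨b, hp.swapRight⟩⟩} := by
      ext c
      rw [SimpleGraph.mem_neighborFinset, hG, Finset.mem_singleton, Subtype.ext_iff]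
      refine ⟨fun h => hu _ h, fun h => ?_⟩
      rw [h]
      exact hp
    rw [SimpleGraph.degree, this, Finset.card_singleton]
    exact odd_one
  obtain ⟨⟨c, hc⟩, hne, hcodd⟩ := G.exists_ne_odd_degree_of_exists_odd_degree _ hodd
  refine ⟨c, fun h => hne (Subtype.ext h), by_contra fun hbd => ?_⟩
  obtain ⟨p, hp⟩ := hmem.1 hc
  obtain ⟨q, hq, hqp⟩ := other_third hp hbd
  have : G.neighborFinset ⟨c, hc⟩ = {⟨p, hmem.2 ⟨c, hp.swapRight⟩⟩, ⟨q, hmem.2 ⟨c, hq.swapRight⟩⟩} := by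
    ext d
    rw [SimpleGraph.mem_neighborFinset, hG, Finset.mem_insert, Finset.mem_singleton,
      Subtype.ext_iff, Subtype.ext_iff]
    refine ⟨fun h => hT.third hp hq hqp.symm h, ?_⟩
    rintro (h | h) <;> rw [h]
    · exact hp
    · exact hq
  rw [SimpleGraph.degree, this, Finset.card_pair (by simpa [Subtype.ext_iff] using hqp.symm)] at hcodd
  exact absurd hcodd (by decide)

/-! ### Contractions inside the class -/

theorem tri_contract_new {T : Finset (Finset V)} (hT : Surf T) {a b : V} (hab : a ≠ b)
    {y z : V} : Tri (contract T a b) a y z ↔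
    (y ≠ a ∧ y ≠ b ∧ z ≠ a ∧ z ≠ b) ∧ (Tri T a y z ∨ Tri T b y z) := by
  rw [tri_contract hT.card_face hab]
  have := @Surf.distinct _ _ _ hT a y z
  have := @Surf.distinct _ _ _ hT b y z
  grind

theorem tri_contract_old {T : Finset (Finset V)} (hT : Surf T) {a b : V} (hab : a ≠ b)
    {x y z : V} (hx : x ≠ a) (hy : y ≠ a) (hz : z ≠ a) :
    Tri (contract T a b) x y z ↔ (x ≠ b ∧ y ≠ b ∧ z ≠ b) ∧ Tri T x y z := by
  rw [tri_contract hT.card_face hab]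
  have := @Surf.distinct _ _ _ hT x y z
  grind

section Contraction

set_option linter.unusedSectionVars false

variable {T : Finset (Finset V)} (hT : Good T) {a b : V} (hab : a ≠ b)
  (hcom : ∀ c, Nb T a c → Nb T b c → Tri T a b c)

include hT hab

theorem nb_contract_new {y : V} (hya : y ≠ a) (hyb : y ≠ b) (h : Nb T a y ∨ Nb T b y) :
    Nb (contract T a b) a y := by
  have key : ∀ z, z ≠ a → z ≠ b → (Tri T a y z ∨ Tri T b y z) → Nb (contract T a b) a y :=
    fun z hz hz' h => ⟨z, (tri_contract_new hT.surf hab).2 ⟨⟨hya, hyb, hz, hz'⟩, h⟩⟩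
  -- The face at hand may be the collapsed one; `third_of_nb` then supplies another face on `y a` or
  -- `y b`.
  have key' : Tri T y a b → Nb (contract T a b) a y := by
    intro h
    rcases hT.third_of_nb h with ⟨w, hw, hwb⟩ | ⟨w, hw, hwa⟩
    · exact key w (hT.surf.distinct hw).2.2.symm hwb (Or.inl hw.swap)
    · exact key w hwa (hT.surf.distinct hw).2.2.symm (Or.inr hw.swap)
  rcases h with ⟨z, hz⟩ | ⟨z, hz⟩
  · by_cases hzb : z = b
    · subst hzb
      exact key' hz.swap.swapRight.swapRight
    · exact key z (hT.surf.distinct hz).2.1.symm hzb (Or.inl hz)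
  · by_cases hza : z = a
    · subst hza
      exact key' hz.rot
    · exact key z hza (hT.surf.distinct hz).2.1.symm (Or.inr hz)

theorem nb_contract_old {x y : V} (hxb : x ≠ b) (hyb : y ≠ b) (h : Nb T x y) :
    Nb (contract T a b) x y := by
  have hne : x ≠ y := by
    obtain ⟨z, hz⟩ := h
    exact (hT.surf.distinct hz).1
  by_cases hxa : x = a
  · subst hxa
    exact nb_contract_new hT hab hne.symm hyb (Or.inl h)
  by_cases hya : y = a
  · subst hya
    exact (nb_contract_new hT hab hne hxb (Or.inl h.symm)).symm
  obtain ⟨z, hz⟩ := h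
  have hz' := hT.surf.distinct hz
  by_cases hzb : z = b
  · subst hzb
    refine ⟨a, Tri.rot ((tri_contract_new hT.surf hab).2 ⟨⟨hxa, hxb, hya, hyb⟩, Or.inr hz.rot.rot⟩)⟩
  · by_cases hza : z = a
    · subst hza
      refine ⟨z, Tri.rot ((tri_contract_new hT.surf hab).2 ⟨⟨hxa, hxb, hya, hyb⟩, Or.inl hz.rot.rot⟩)⟩
    · exact ⟨z, (tri_contract_old hT.surf hab hxa hya hza).2 ⟨⟨hxb, hyb, hzb⟩, hz⟩⟩

/-- Renaming `b` to `a` is injective on the neighbors of a vertex that is not adjacent to both. -/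
theorem deg_contract_of_not_third (hT' : Surf (contract T a b)) {x : V} (hxa : x ≠ a)
    (hxb : x ≠ b) (h : ¬ (Nb T x a ∧ Nb T x b)) : deg T x ≤ deg (contract T a b) x := by
  have hmem : ∀ {c}, c ∈ neighbors T x ↔ Nb T x c := mem_neighbors hT.surf.card_face
  have hinj : Set.InjOn (fun c => if c = b then a else c) (neighbors T x : Set V) := by
    intro c hc d hd hcd
    simp only [Finset.mem_coe, hmem] at hc hd hcd
    grind
  rw [deg, ← Finset.card_image_of_injOn hinj]
  refine le_deg hT' _ fun c hc => ?_
  obtain ⟨d, hd, rfl⟩ := Finset.mem_image.1 hc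
  rw [hmem] at hd
  by_cases hdb : d = b
  · subst hdb
    simp only [if_true]
    exact (nb_contract_new hT hab hxa hxb (Or.inr hd.symm)).symm
  · simp only [hdb, if_false]
    exact nb_contract_old hT hab hxb hdb hd

theorem deg_contract_of_third (hT' : Surf (contract T a b)) {x : V} (hxb : x ≠ b) :
    deg T x ≤ deg (contract T a b) x + 1 := by
  have h := le_deg hT' ((neighbors T x).erase b) (x := x) (by
    intro c hc
    rw [Finset.mem_erase, mem_neighbors hT.surf.card_face] at hc
    exact nb_contract_old hT hab hxb hc.1 hc.2)
  have := Finset.pred_card_le_card_erase (s := neighbors T x) (a := b)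
  unfold deg at *
  omega

theorem deg_contract_new (hT' : Surf (contract T a b)) :
    (((neighbors T a).erase b) ∪ ((neighbors T b).erase a)).card ≤ deg (contract T a b) a := by
  refine le_deg hT' _ fun c hc => ?_
  simp only [Finset.mem_union, Finset.mem_erase, mem_neighbors hT.surf.card_face] at hc
  have h1 : ∀ x c, Nb T x c → c ≠ x := by
    rintro x c ⟨z, hz⟩
    exact (hT.surf.distinct hz).1.symm
  rcases hc with hc | hc
  · exact nb_contract_new hT hab (h1 _ _ hc.2) hc.1 (Or.inl hc.2)
  · exact nb_contract_new hT hab hc.1 (h1 _ _ hc.2) (Or.inr hc.2)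

include hcom

/-- The delicate case is a boundary edge of `x` whose only face is the collapsed `x a b`: the merged
edge `x a` then keeps only the second face of the other one of `x a`, `x b`, and is again a boundary
edge. -/
theorem bd_contract_old {x : V} (hxa : x ≠ a) (hxb : x ≠ b) (h : ∃ y, Bd T x y) :
    ∃ y, Bd (contract T a b) x y := by
  obtain ⟨y, z, hz, hu⟩ := h
  have hz' := hT.surf.distinct hz
  have hnew : ∀ {w}, Tri (contract T a b) x a w ↔
      (w ≠ a ∧ w ≠ b) ∧ (Tri T x a w ∨ Tri T x b w) := by
    intro w
    have h := tri_contract_new hT.surf hab (y := x) (z := w)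
    constructor
    · intro h'
      obtain ⟨h1, h2⟩ := h.1 h'.swap
      exact ⟨⟨h1.2.2.1, h1.2.2.2⟩, h2.imp Tri.swap Tri.swap⟩
    · rintro ⟨h1, h2⟩
      exact Tri.swap (h.2 ⟨⟨hxa, hxb, h1.1, h1.2⟩, h2.imp Tri.swap Tri.swap⟩)
  have key : ∀ c d, (c = a ∧ d = b) ∨ (c = b ∧ d = a) → y = c → Bd (contract T a b) x a := by
    rintro c d hcd rfl
    have hnew : ∀ {w}, Tri (contract T a b) x a w ↔
        (w ≠ y ∧ w ≠ d) ∧ (Tri T x y w ∨ Tri T x d w) := by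
      intro w
      rw [hnew]
      grind
    have hcom' : Nb T x y → Nb T x d → Tri T x y d := by
      intro h1 h2
      rcases hcd with ⟨rfl, rfl⟩ | ⟨rfl, rfl⟩
      · exact (hcom x h1.symm h2.symm).rot.rot
      · exact (hcom x h2.symm h1.symm).rot.rot.swapRight
    have hyd : y ≠ d := by grind
    by_cases hzd : z = d
    · subst hzd
      rcases hT.third_of_nb hz with ⟨w, hw, hne⟩ | ⟨w, hw, hne⟩
      · exact absurd (hu w hw) hne
      · have hw' := hT.surf.distinct hw
        refine ⟨w, hnew.2 ⟨⟨hne, hw'.2.2.symm⟩, Or.inr hw⟩, fun v hv => ?_⟩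
        obtain ⟨⟨h1, h2⟩, h3 | h3⟩ := hnew.1 hv
        · exact absurd (hu v h3) h2
        · have := hT.surf.third hz.swapRight hw hne.symm h3
          grind
    · refine ⟨z, hnew.2 ⟨⟨hz'.2.2.symm, hzd⟩, Or.inl hz⟩, fun v hv => ?_⟩
      obtain ⟨⟨h1, h2⟩, h3 | h3⟩ := hnew.1 hv
      · exact hu v h3
      · exact absurd (hu d (hcom' ⟨z, hz⟩ ⟨v, h3⟩)).symm hzd
  by_cases hya : y = a
  · exact ⟨a, key a b (Or.inl ⟨rfl, rfl⟩) hya⟩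
  by_cases hyb : y = b
  · exact ⟨a, key b a (Or.inr ⟨rfl, rfl⟩) hyb⟩
  have hnb : ∀ {w}, Tri (contract T a b) x y w →
      (Tri T x y w ∧ w ≠ b) ∨ (w = a ∧ Tri T x y b) := by
    intro w hw
    rw [tri_contract hT.surf.card_face hab] at hw
    grind
  refine ⟨y, if z = b then a else z, ?_, fun w hw => ?_⟩
  · rw [tri_contract hT.surf.card_face hab]
    grind
  · rcases hnb hw with h | h
    · have := hu w h.1
      grind
    · have := hu b h.2
      grind

/-- A vertex on one boundary edge lies on a second one, so the boundary is not confined to `a` and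
`b`. -/
theorem exists_bd_contract (h : ∃ x y, Bd T x y) : ∃ x y, Bd (contract T a b) x y := by
  suffices ∃ x, x ≠ a ∧ x ≠ b ∧ ∃ y, Bd T x y by
    obtain ⟨x, h1, h2, h3⟩ := this
    exact ⟨x, bd_contract_old hT hab hcom h1 h2 h3⟩
  obtain ⟨x, y, hxy⟩ := h
  by_contra! hne
  obtain ⟨z, hz, hxz⟩ := exists_other_bd hT.surf hxy
  have d : ∀ {x y}, Bd T x y → x ≠ y := by
    rintro x y ⟨z, hz, -⟩
    exact (hT.surf.distinct hz).1
  have e : ∀ {x y}, Bd T x y → x = a ∨ x = b := by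
    intro x y h
    by_contra! h'
    exact hne x h'.1 h'.2 y h
  have := e hxy
  have := e hxy.symm
  have := e hxz.symm
  have := d hxy
  have := d hxz
  grind

/-- A vertex of degree three at an end of the contracted edge yields a boundary edge. -/
theorem boundary_pair_of_deg_three (hnb : Nb T a b) (h3 : deg T a = 3) :
    ∃ x z, (x ≠ a ∧ x ≠ b ∧ z ≠ a ∧ z ≠ b) ∧ (Tri T a x z ∨ Tri T b x z) ∧
      ∀ w, w ≠ a → w ≠ b → (Tri T a x w ∨ Tri T b x w) → w = z := by
  have hS := hT.surf
  obtain ⟨p, hp⟩ := hnb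
  have dp := hS.distinct hp
  -- If `a b` has two faces `a b p` and `a b q`, then `a p` is a boundary edge because `a p q` is
  -- not a face, and merging it with `b p` leaves one face. If `a b` has one face, the boundary edge
  -- from `a` to its remaining neighbor `d` is unaffected.
  by_cases hq : ∃ q, Tri T a b q ∧ q ≠ p
  · obtain ⟨q, hq, hqp⟩ := hq
    have dq := hS.distinct hq
    have hN := nb_iff_of_deg_le hS (x := a) {b, p, q} (by
      intro c hc
      simp only [Finset.mem_insert, Finset.mem_singleton] at hc
      rcases hc with rfl | rfl | rfl
      · exact ⟨p, hp⟩
      · exact ⟨b, hp.swapRight⟩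
      · exact ⟨b, hq.swapRight⟩) (by
      rw [h3, Finset.card_eq_three.2 ⟨b, p, q, by grind, by grind, by grind, rfl⟩])
    have hapq : ¬ Tri T a p q := fun h => hT.no_triangle_link hp h hq.swapRight
    have hap : ∀ w, Tri T a p w → w = b := by
      intro w hw
      have h1 := (hN w).1 ⟨p, hw.swapRight⟩
      have := hS.distinct hw
      simp only [Finset.mem_insert, Finset.mem_singleton] at h1
      rcases h1 with h | h | h
      · exact h
      · grind
      · subst h
        exact absurd hw hapq
    rcases hT.third_of_nb hp.rot.rot with ⟨w, hw, hne⟩ | ⟨w, hw, hne⟩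
    · exact absurd (hap w hw.swap) hne
    · have dw := hS.distinct hw
      refine ⟨p, w, ⟨by grind, by grind, hne, by grind⟩, Or.inr hw.swap, ?_⟩
      intro v hva hvb hv
      rcases hv with hv | hv
      · exact absurd (hap v hv) hvb
      · have := hS.third hp.rot hw.swap hne.symm hv
        grind
  · push Not at hq
    obtain ⟨d, hd, hdn⟩ := exists_nb_of_lt_deg hS {b, p} (x := a)
      (lt_of_le_of_lt Finset.card_le_two (by omega))
    simp only [Finset.mem_insert, Finset.mem_singleton, not_or] at hdn
    have had : a ≠ d := by
      obtain ⟨w, hw⟩ := hd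
      exact (hS.distinct hw).1
    have hN := nb_iff_of_deg_le hS (x := a) {b, p, d} (by
      intro c hc
      simp only [Finset.mem_insert, Finset.mem_singleton] at hc
      rcases hc with rfl | rfl | rfl
      · exact ⟨p, hp⟩
      · exact ⟨b, hp.swapRight⟩
      · exact hd) (by
      rw [h3, Finset.card_eq_three.2 ⟨b, p, d, by grind, by grind, by grind, rfl⟩])
    have hadw : ∀ w, Tri T a d w → w = p := by
      intro w hw
      have h1 := (hN w).1 ⟨d, hw.swapRight⟩
      have := hS.distinct hw
      simp only [Finset.mem_insert, Finset.mem_singleton] at h1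
      rcases h1 with h | h | h
      · subst h
        exact absurd (hq d hw.swapRight) hdn.2
      · exact h
      · grind
    obtain ⟨w, hw⟩ := hd
    have := hadw w hw
    subst this
    refine ⟨d, w, ⟨by grind, by grind, by grind, by grind⟩, Or.inl hw, ?_⟩
    rintro v hva hvb (hv | hv)
    · exact hadw v hv
    · exact absurd (hq d (hcom d ⟨w, hw⟩ ⟨v, hv⟩)) hdn.2

theorem card_common_le_two : (((neighbors T a).erase b) ∩ ((neighbors T b).erase a)).card ≤ 2 := by
  by_contra! h
  obtain ⟨x, y, z, hx, hy, hz, h1, h2, h3⟩ := Finset.two_lt_card_iff.1 h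
  have key : ∀ {x}, x ∈ ((neighbors T a).erase b) ∩ ((neighbors T b).erase a) → Tri T a b x := by
    intro x hx
    simp only [Finset.mem_inter, Finset.mem_erase, mem_neighbors hT.surf.card_face] at hx
    exact hcom x hx.1.2 hx.2.2
  have := hT.surf.le_two (key hx) (key hy) (key hz)
  grind

end Contraction

/-- The merged vertex has at least `deg a + deg b - 4` neighbors. That is enough if both degrees are
at least 4; if one of them is 3, the merged vertex lies on the boundary and needs only 3. A third
vertex loses at most one neighbor, which only a light vertex cannot afford, and no other vertex
loses any. -/
theorem good_contract {T : Finset (Finset V)} (hT : Good T) {a b : V} (hab : Nb T a b)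
    (hcom : ∀ c, Nb T a c → Nb T b c → Tri T a b c) (hT' : Surf (contract T a b))
    (hl : ∀ x, Tri T a b x → ¬ Light T x) : Good (contract T a b) := by
  have hS := hT.surf
  have hc := hS.card_face
  have hne : a ≠ b := by
    obtain ⟨p, hp⟩ := hab
    exact (hS.distinct hp).1
  have main : ∀ x, (∃ y, Nb (contract T a b) x y) → 3 ≤ deg (contract T a b) x ∧
      ((∀ z, ¬ Bd (contract T a b) x z) → 4 ≤ deg (contract T a b) x) := by
    rintro x ⟨y, z, hxyz⟩
    have hxb : x ≠ b := ((tri_contract hc hne _ _ _).1 hxyz).2.1.1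
    by_cases hxa : x = a
    · subst hxa
      have hA : ((neighbors T x).erase b).card = deg T x - 1 :=
        Finset.card_erase_of_mem ((mem_neighbors hc).2 hab)
      have hB : ((neighbors T b).erase x).card = deg T b - 1 :=
        Finset.card_erase_of_mem ((mem_neighbors hc).2 hab.symm)
      have hn := deg_contract_new hT hne hT'
      have hu := Finset.card_union_add_card_inter ((neighbors T x).erase b) ((neighbors T b).erase x)
      have hi := card_common_le_two hT hne hcom
      have hx3 := hT.three_le x b hab
      have hb3 := hT.three_le b x hab.symm
      have hbd : deg T x = 3 ∨ deg T b = 3 → ∃ z, Bd (contract T x b) x z := by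
        intro h
        have : ∃ w z, (w ≠ x ∧ w ≠ b ∧ z ≠ x ∧ z ≠ b) ∧ (Tri T x w z ∨ Tri T b w z) ∧
            ∀ v, v ≠ x → v ≠ b → (Tri T x w v ∨ Tri T b w v) → v = z := by
          rcases h with h | h
          · exact boundary_pair_of_deg_three hT hne hcom hab h
          · obtain ⟨w, z, h1, h2, h3⟩ := boundary_pair_of_deg_three hT hne.symm
              (fun c h1 h2 => (hcom c h2 h1).swap) hab.symm h
            exact ⟨w, z, ⟨h1.2.1, h1.1, h1.2.2.2, h1.2.2.1⟩, h2.symm,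
              fun v hv hv' h => h3 v hv' hv h.symm⟩
        obtain ⟨w, z, h1, h2, h3⟩ := this
        refine ⟨w, z, (tri_contract_new hT.surf hne).2 ⟨h1, h2⟩, fun v hv => ?_⟩
        obtain ⟨h4, h5⟩ := (tri_contract_new hT.surf hne).1 hv
        exact h3 v h4.2.2.1 h4.2.2.2 h5
      -- For two degrees equal to 3 the general count gives only 2. Two common neighbors would then
      -- force a triangular link at one of the ends, so there is at most one and the count improves
      -- to 3.
      have h33 : deg T x = 3 → deg T b = 3 →
          (((neighbors T x).erase b) ∩ ((neighbors T b).erase x)).card ≤ 1 := by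
        intro h1 h2
        by_contra! hlt
        obtain ⟨p, hp, q, hq, hpq⟩ := Finset.one_lt_card.1 hlt
        simp only [Finset.mem_inter, Finset.mem_erase, mem_neighbors hc] at hp hq
        have hp' := hcom p hp.1.2 hp.2.2
        have hq' := hcom q hq.1.2 hq.2.2
        have dp := hS.distinct hp'
        have dq := hS.distinct hq'
        have hNx := nb_iff_of_deg_le hS (x := x) {b, p, q} (by
          intro c hc
          simp only [Finset.mem_insert, Finset.mem_singleton] at hc
          rcases hc with rfl | rfl | rfl
          · exact hab
          · exact hp.1.2
          · exact hq.1.2) (by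
          rw [h1, Finset.card_eq_three.2 ⟨b, p, q, by grind, by grind, by grind, rfl⟩])
        have hNb := nb_iff_of_deg_le hS (x := b) {x, p, q} (by
          intro c hc
          simp only [Finset.mem_insert, Finset.mem_singleton] at hc
          rcases hc with rfl | rfl | rfl
          · exact hab.symm
          · exact hp.2.2
          · exact hq.2.2) (by
          rw [h2, Finset.card_eq_three.2 ⟨x, p, q, by grind, by grind, by grind, rfl⟩])
        rcases hT.third_of_nb hp'.rot.rot with ⟨w, hw, hwb⟩ | ⟨w, hw, hwb⟩
        · have h3 := (hNx w).1 ⟨p, hw.swap.swapRight⟩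
          have := hS.distinct hw
          have hwq : w = q := by
            simp only [Finset.mem_insert, Finset.mem_singleton] at h3
            grind
          subst hwq
          exact hT.no_triangle_link hp' hw.swap hq'.swapRight
        · have h3 := (hNb w).1 ⟨p, hw.swap.swapRight⟩
          have := hS.distinct hw
          have hwq : w = q := by
            simp only [Finset.mem_insert, Finset.mem_singleton] at h3
            grind
          subst hwq
          exact hT.no_triangle_link hp'.swap hw.swap hq'.swap.swapRight
      constructor
      · by_cases h1 : deg T x = 3 ∧ deg T b = 3
        · have := h33 h1.1 h1.2
          omega
        · omega
      · intro hz
        have : ¬ (deg T x = 3 ∨ deg T b = 3) := fun h => by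
          obtain ⟨z, h⟩ := hbd h
          exact hz z h
        omega
    · have hx : ∃ y, Nb T x y := by
        rcases ((tri_contract hc hne _ _ _).1 hxyz).2.2 with h | h | h | h
        · exact ⟨_, _, h⟩
        · exact absurd h.1 hxa
        · exact ⟨_, _, h.2⟩
        · exact ⟨_, _, h.2⟩
      obtain ⟨y, hxy⟩ := hx
      have h3 := hT.three_le x y hxy
      have h4 := hT.four_le x y hxy
      have hbd := bd_contract_old hT hne hcom hxa hxb
      by_cases ht : Tri T a b x
      · have hlx := hl x ht
        have hd := deg_contract_of_third hT hne hT' (x := x) hxb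
        unfold Light at hlx
        push Not at hlx
        by_cases hB : ∃ y, Bd T x y
        · have := hlx.1 hB
          refine ⟨by omega, fun h => ?_⟩
          obtain ⟨z, hz⟩ := hbd hB
          exact absurd hz (h z)
        · push Not at hB
          have := hlx.2 hB
          have := h4 hB
          exact ⟨by omega, fun _ => by omega⟩
      · have hd := deg_contract_of_not_third hT hne hT' hxa hxb
          (fun h => ht (hcom x h.1.symm h.2.symm))
        refine ⟨by omega, fun h => ?_⟩
        by_cases hB : ∃ y, Bd T x y
        · obtain ⟨z, hz⟩ := hbd hB
          exact absurd hz (h z)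
        · push Not at hB
          have := h4 hB
          omega
  exact ⟨hT', fun x y hxy => (main x ⟨y, hxy⟩).1, fun x y hxy => (main x ⟨y, hxy⟩).2⟩

/-! ### Light vertices beside contractible edges -/

/-- `T` arises by one operation from a smaller triangulation in the class, with boundary. -/
def Reducible (F : Type v) [TopologicalSpace F] (T : Finset (Finset V)) : Prop :=
  ∃ T', Step F T' T ∧ T'.card < T.card ∧ ∃ x y, Bd T' x y

theorem contract_card_lt {T : Finset (Finset V)} {a b : V} (h : Nb T a b) :
    (contract T a b).card < T.card := by
  obtain ⟨p, hp⟩ := h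
  refine Finset.card_image_le.trans_lt (Finset.card_lt_card ?_)
  rw [Finset.ssubset_iff_of_subset (Finset.filter_subset _ _)]
  exact ⟨_, hp, by simp⟩

/-- Otherwise the contraction stays in the class, all its vertices of degree three are on the
boundary, the edge is triode detecting, and `T` is a 3-splitting of a smaller triangulation. -/
theorem exists_light_of_contractible {F : Type v} [TopologicalSpace F] {T : Finset (Finset V)}
    (hT : InClass F T) (hole : ∃ x y, Bd T x y) (hred : ¬ Reducible F T) {a b : V}
    (h : Contractible F T a b) : ∃ x, Tri T a b x ∧ Light T x := by
  by_contra! hl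
  have hG := (inClass_iff.1 hT).1
  have hc := hG.surf.card_face
  obtain ⟨hne, hab, hcom, hs, hF⟩ := h
  have hab' := (mem_edges hc hne).1 hab
  have hcom' : ∀ c, Nb T a c → Nb T b c → Tri T a b c := fun c h1 h2 =>
    hcom c ((mem_neighbors hc).2 h1) ((mem_neighbors hc).2 h2)
  have hG' := good_contract hG hab' hcom' hs.surf hl
  refine hred ⟨contract T a b, ⟨inClass_iff.2 ⟨hG', hF⟩, hT, Or.inl ⟨a, b, ⟨⟨hne, hab, hcom, hs, hF⟩,
    ?_⟩, hG.three_le a b hab', hG.three_le b a hab'.symm, rfl⟩⟩, contract_card_lt hab',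
    exists_bd_contract hG hne hcom' hole⟩
  intro x _ hd
  refine ⟨?_, hd⟩
  rw [mem_boundaryVertices hG'.surf.card_face]
  by_contra! hB
  have : 0 < (neighbors (contract T a b) x).card := by
    unfold deg at hd
    omega
  obtain ⟨y, hy⟩ := Finset.card_pos.1 this
  have := hG'.four_le x y ((mem_neighbors hG'.surf.card_face).1 hy) hB
  omega

/-- Replaces contractibility by conditions that can be read off from links, so that the argument can
be repeated at further edges. -/
theorem exists_light {F : Type v} [TopologicalSpace F] {T : Finset (Finset V)}
    (hT : InClass F T) (hole : ∃ x y, Bd T x y) (hred : ¬ Reducible F T) {a b : V}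
    (hab : Nb T a b) (hcom : ∀ c, Nb T a c → Nb T b c → Tri T a b c)
    (kind : (∀ c, ¬ Bd T b c) ∨ Bd T a b) : ∃ x, Tri T a b x ∧ Light T x := by
  obtain ⟨hG, ⟨e⟩⟩ := inClass_iff.1 hT
  have hc := hG.surf.card_face
  have hne : a ≠ b := by
    obtain ⟨p, hp⟩ := hab
    exact (hG.surf.distinct hp).1
  obtain ⟨hs, ⟨e'⟩⟩ := (hG.collapsible hab hcom kind).contract hG.surf
  exact exists_light_of_contractible hT hole hred ⟨hne, (mem_edges hc hne).2 hab,
    fun c h1 h2 => hcom c ((mem_neighbors hc).1 h1) ((mem_neighbors hc).1 h2),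
    hs.isTriangulatedSurface, ⟨e'.symm.trans e⟩⟩

/-! ### Links of vertices of small degree -/

/-- The link of `x` is the 4-cycle `a b c d`. -/
structure Link4 (T : Finset (Finset V)) (x a b c d : V) : Prop where
  ab : Tri T x a b
  bc : Tri T x b c
  cd : Tri T x c d
  da : Tri T x d a
  ac_ne : a ≠ c
  bd_ne : b ≠ d

theorem Link4.rotate {T : Finset (Finset V)} {x a b c d : V} (h : Link4 T x a b c d) :
    Link4 T x b c d a :=
  ⟨h.bc, h.cd, h.da, h.ab, h.bd_ne, h.ac_ne.symm⟩

theorem Link4.reverse {T : Finset (Finset V)} {x a b c d : V} (h : Link4 T x a b c d) :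
    Link4 T x d c b a :=
  ⟨h.cd.swapRight, h.bc.swapRight, h.ab.swapRight, h.da.swapRight, h.bd_ne.symm, h.ac_ne.symm⟩

theorem Link4.distinct {T : Finset (Finset V)} (hT : Surf T) {x a b c d : V}
    (h : Link4 T x a b c d) : (x ≠ a ∧ x ≠ b ∧ x ≠ c ∧ x ≠ d) ∧ a ≠ b ∧ a ≠ c ∧ a ≠ d ∧ b ≠ c ∧
      b ≠ d ∧ c ≠ d := by
  have h1 := hT.distinct h.ab
  have h2 := hT.distinct h.bc
  have h3 := hT.distinct h.cd
  have h4 := hT.distinct h.da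
  have h5 := h.ac_ne
  have h6 := h.bd_ne
  grind

theorem Link4.nb {T : Finset (Finset V)} (hT : Surf T) {x a b c d : V}
    (h : Link4 T x a b c d) (w : V) (hw : Nb T x w) : w = a ∨ w = b ∨ w = c ∨ w = d := by
  refine hT.link x (fun w => w = a ∨ w = b ∨ w = c ∨ w = d) ⟨a, by simp, b, h.ab⟩ ?_ w hw
  have k1 := fun w => hT.third h.ab h.da.swapRight h.bd_ne (r := w)
  have k2 := fun w => hT.third h.bc h.ab.swapRight h.ac_ne.symm (r := w)
  have k3 := fun w => hT.third h.cd h.bc.swapRight h.bd_ne.symm (r := w)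
  have k4 := fun w => hT.third h.da h.cd.swapRight h.ac_ne (r := w)
  rintro v w (rfl | rfl | rfl | rfl) hvw
  · have := k1 w hvw
    grind
  · have := k2 w hvw
    grind
  · have := k3 w hvw
    grind
  · have := k4 w hvw
    grind

theorem Link4.tri_iff {T : Finset (Finset V)} (hT : Surf T) {x a b c d : V}
    (h : Link4 T x a b c d) (v w : V) : Tri T x v w ↔
      (v = a ∧ w = b) ∨ (v = b ∧ w = a) ∨ (v = b ∧ w = c) ∨ (v = c ∧ w = b) ∨
      (v = c ∧ w = d) ∨ (v = d ∧ w = c) ∨ (v = d ∧ w = a) ∨ (v = a ∧ w = d) := by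
  have k1 := fun w => hT.third h.ab h.da.swapRight h.bd_ne (r := w)
  have k2 := fun w => hT.third h.bc h.ab.swapRight h.ac_ne.symm (r := w)
  have k3 := fun w => hT.third h.cd h.bc.swapRight h.bd_ne.symm (r := w)
  have k4 := fun w => hT.third h.da h.cd.swapRight h.ac_ne (r := w)
  constructor
  · intro hvw
    rcases h.nb hT v ⟨w, hvw⟩ with rfl | rfl | rfl | rfl
    · rcases k1 w hvw with rfl | rfl <;> simp
    · rcases k2 w hvw with rfl | rfl <;> simp
    · rcases k3 w hvw with rfl | rfl <;> simp
    · rcases k4 w hvw with rfl | rfl <;> simp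
  · rintro (⟨rfl, rfl⟩ | ⟨rfl, rfl⟩ | ⟨rfl, rfl⟩ | ⟨rfl, rfl⟩ | ⟨rfl, rfl⟩ | ⟨rfl, rfl⟩ |
      ⟨rfl, rfl⟩ | ⟨rfl, rfl⟩)
    exacts [h.ab, h.ab.swapRight, h.bc, h.bc.swapRight, h.cd, h.cd.swapRight, h.da, h.da.swapRight]

theorem Link4.inner {T : Finset (Finset V)} (hT : Surf T) {x a b c d : V}
    (h : Link4 T x a b c d) (y : V) : ¬ Bd T x y := by
  intro hy
  rcases h.nb hT y hy.nb with rfl | rfl | rfl | rfl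
  · exact Surf.not_bd h.ab h.da.swapRight h.bd_ne hy
  · exact Surf.not_bd h.bc h.ab.swapRight h.ac_ne.symm hy
  · exact Surf.not_bd h.cd h.bc.swapRight h.bd_ne.symm hy
  · exact Surf.not_bd h.da h.cd.swapRight h.ac_ne hy

theorem Link4.deg_eq {T : Finset (Finset V)} (hT : Surf T) {x a b c d : V}
    (h : Link4 T x a b c d) : deg T x = 4 := by
  obtain ⟨-, h1, h2, h3, h4, h5, h6⟩ := h.distinct hT
  have hcard : ({a, b, c, d} : Finset V).card = 4 := by
    rw [Finset.card_insert_of_notMem (by grind),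
      Finset.card_eq_three.2 ⟨b, c, d, h4, h5, h6, rfl⟩]
  apply le_antisymm
  · rw [← hcard]
    exact deg_le hT _ fun w hw => by simpa using h.nb hT w hw
  · rw [← hcard]
    refine le_deg hT _ fun w hw => ?_
    simp only [Finset.mem_insert, Finset.mem_singleton] at hw
    rcases hw with rfl | rfl | rfl | rfl
    exacts [⟨_, h.ab⟩, ⟨_, h.bc⟩, ⟨_, h.cd⟩, ⟨_, h.da⟩]

/-- The second faces on `x b` and `x a` give `c` and `d`, which differ because the link is not a
triangle. These are then all four neighbors, and the second face on `x c` has to use `d`. -/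
theorem Good.exists_link4 {T : Finset (Finset V)} (hT : Good T) {x a b : V}
    (hin : ∀ y, ¬ Bd T x y) (hd : deg T x = 4) (hab : Tri T x a b) :
    ∃ c d, Link4 T x a b c d := by
  have hS := hT.surf
  obtain ⟨c, hc, hca⟩ := other_third hab.swapRight (hin b)
  obtain ⟨d, hda, hdb⟩ := other_third hab (hin a)
  have h1 := hS.distinct hab
  have h2 := hS.distinct hc
  have h3 := hS.distinct hda
  have hdc : c ≠ d := by
    rintro rfl
    exact hT.no_triangle_link hab hc hda.swapRight
  have hN := nb_iff_of_deg_le hS (x := x) {a, b, c, d} (by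
    intro w hw
    simp only [Finset.mem_insert, Finset.mem_singleton] at hw
    rcases hw with rfl | rfl | rfl | rfl
    exacts [⟨_, hab⟩, ⟨_, hc⟩, ⟨_, hc.swapRight⟩, ⟨_, hda.swapRight⟩]) (by
    rw [hd, Finset.card_insert_of_notMem (by grind), Finset.card_eq_three.2
          ⟨b, c, d, by grind, by grind, by grind, rfl⟩])
  obtain ⟨e, he, heb⟩ := other_third hc.swapRight (hin c)
  have h4 := hS.distinct he
  have hed : e = d := by
    have := (hN e).1 ⟨c, he.swapRight⟩
    simp only [Finset.mem_insert, Finset.mem_singleton] at this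
    rcases this with rfl | rfl | rfl | rfl
    · rcases hS.third hab hda hdb.symm he.swapRight with h | h
      · exact absurd h.symm h2.2.2
      · exact absurd h hdc
    · exact absurd rfl heb
    · exact absurd rfl h4.2.2
    · rfl
  subst hed
  exact ⟨c, e, hab, hc, he, hda.swapRight, hca.symm, hdb.symm⟩

/-! ### Octahedra -/

/-- Faces through the vertex into which others are contracted and faces away from it are described
by different lemmas; this splits the comparison accordingly. -/
theorem faces_ext_at {T T' : Finset (Finset V)} (hc : ∀ t ∈ T, t.card = 3)
    (hc' : ∀ t ∈ T', t.card = 3) (r : V) (hr : ∀ y z, Tri T r y z ↔ Tri T' r y z)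
    (h : ∀ x y z, x ≠ r → y ≠ r → z ≠ r → (Tri T x y z ↔ Tri T' x y z)) : T = T' := by
  refine faces_ext hc hc' fun x y z => ?_
  by_cases hx : x = r
  · rw [hx]; exact hr y z
  by_cases hy : y = r
  · rw [hy]
    exact ⟨fun h => ((hr _ _).1 h.swap).swap, fun h => ((hr _ _).2 h.swap).swap⟩
  by_cases hz : z = r
  · rw [hz]
    exact ⟨fun h => ((hr _ _).1 h.rot.rot).rot, fun h => ((hr _ _).2 h.rot.rot).rot⟩
  · exact h x y z hx hy hz

/-- Three mutually adjacent vertices `x`, `p`, `q` of degree four; the further common neighbors of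
`p q`, `x q`, `x p` are `u`, `r`, `s`. -/
structure Octa (T : Finset (Finset V)) (x p q u r s : V) : Prop where
  link_x : Link4 T x p q r s
  link_p : Link4 T p q x s u
  link_q : Link4 T q x p u r

theorem Octa.rotate {T : Finset (Finset V)} {x p q u r s : V} (h : Octa T x p q u r s) :
    Octa T p q x r s u :=
  ⟨h.link_p, h.link_q, h.link_x⟩

theorem Octa.reflect {T : Finset (Finset V)} {x p q u r s : V} (h : Octa T x p q u r s) :
    Octa T q p x s r u :=
  ⟨h.link_q.reverse.rotate.rotate, h.link_p.reverse.rotate.rotate, h.link_x.reverse.rotate.rotate⟩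

theorem Octa.distinct {T : Finset (Finset V)} (hT : Surf T) {x p q u r s : V}
    (h : Octa T x p q u r s) : (x ≠ p ∧ x ≠ q ∧ p ≠ q) ∧ (u ≠ r ∧ u ≠ s ∧ r ≠ s) ∧
      (x ≠ u ∧ x ≠ r ∧ x ≠ s) ∧ (p ≠ u ∧ p ≠ r ∧ p ≠ s) ∧ (q ≠ u ∧ q ≠ r ∧ q ≠ s) := by
  have h1 := h.link_x.distinct hT
  have h2 := h.link_p.distinct hT
  have h3 := h.link_q.distinct hT
  grind

/-- The result of replacing the octahedron by a face. -/
def fillOcta (T : Finset (Finset V)) (x p q u r s : V) : Finset (Finset V) :=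
  insert {u, r, s} (deleteVertices T {x, p, q})

theorem tri_deleteVertices {T : Finset (Finset V)} {S : Finset V} {y z w : V} :
    Tri (deleteVertices T S) y z w ↔ Tri T y z w ∧ y ∉ S ∧ z ∉ S ∧ w ∉ S := by
  simp [Tri, deleteVertices]

theorem Octa.tri_fill {T : Finset (Finset V)} (hT : Surf T) {x p q u r s : V}
    (h : Octa T x p q u r s) {y z w : V} : Tri (fillOcta T x p q u r s) y z w ↔
      SameTriple y z w u r s ∨ (Tri T y z w ∧ (y ≠ x ∧ y ≠ p ∧ y ≠ q) ∧ (z ≠ x ∧ z ≠ p ∧ z ≠ q) ∧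
        (w ≠ x ∧ w ≠ p ∧ w ≠ q)) := by
  have hd := (h.distinct hT).2.1
  have := tri_deleteVertices (T := T) (S := {x, p, q}) (y := y) (z := z) (w := w)
  simp only [Finset.mem_insert, Finset.mem_singleton, not_or] at this
  rw [← this, ← triple_eq_iff hd.1 hd.2.1 hd.2.2]
  simp [Tri, fillOcta]

theorem Octa.card_of_mem_fill {T : Finset (Finset V)} (hT : Surf T) {x p q u r s : V}
    (h : Octa T x p q u r s) (t : Finset V) (ht : t ∈ fillOcta T x p q u r s) : t.card = 3 := by
  have hd := (h.distinct hT).2.1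
  simp only [fillOcta, deleteVertices, Finset.mem_insert, Finset.mem_filter] at ht
  rcases ht with rfl | ht
  · exact Finset.card_eq_three.2 ⟨u, r, s, hd.1, hd.2.1, hd.2.2, rfl⟩
  · exact hT.card_face t ht.1

/-- The central vertices are contracted into the corner `r` one after another. Each is inner, so the
surface is kept, although the intermediate triangulations leave the class. `hrsu` prevents the last
contraction from doubling a face. -/
theorem Octa.fill {T : Finset (Finset V)} (hT : Surf T) {x p q u r s : V}
    (h : Octa T x p q u r s) (hrsu : ¬ Tri T r s u) : Surf (fillOcta T x p q u r s) ∧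
      Nonempty (realization T ≃ₜ realization (fillOcta T x p q u r s)) := by
  obtain ⟨⟨d1, d2, d3⟩, ⟨d4, d5, d6⟩, ⟨d7, d8, d9⟩, ⟨d10, d11, d12⟩, d13, d14, d15⟩ := h.distinct hT
  have lx := h.link_x.tri_iff hT
  have lp := h.link_p.tri_iff hT
  have lq := h.link_q.tri_iff hT
  have nx := h.link_x.nb hT
  have np := h.link_p.nb hT
  have hpr : ∀ z, ¬ Tri T r p z := fun z hz => by
    have := np r ⟨z, hz.swap⟩
    grind
  have c1 : Collapsible T r x := by
    refine ⟨⟨s, h.link_x.cd.swap⟩, ?_, ?_, Or.inl (h.link_x.inner hT), ?_⟩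
    · rintro c ⟨d, hc⟩ hxc
      have := hT.distinct hc
      rcases nx c hxc with rfl | rfl | rfl | rfl
      · exact absurd hc (hpr d)
      · exact h.link_x.bc.swapRight.swap
      · grind
      · exact h.link_x.cd.swap
    · intro c d hr hx
      have := hT.distinct hr
      have := hpr c
      have := hpr d
      have := hr.swapRight
      rw [lx] at hx
      grind
    · exact ⟨p, q, u, h.link_p.da.swapRight, by grind⟩
  obtain ⟨hS1, ⟨e1⟩⟩ := c1.contract hT
  have r1 : ∀ c d, Tri (contract T r x) r c d ↔ _ := fun c d =>
    tri_contract_new hT d8.symm (y := c) (z := d)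
  have q1 : ∀ c d, Tri (contract T r x) q c d ↔ (c = p ∧ d = u) ∨ (c = u ∧ d = p) ∨
      (c = u ∧ d = r) ∨ (c = r ∧ d = u) ∨ (c = r ∧ d = p) ∨ (c = p ∧ d = r) := by
    intro c d
    rw [tri_contract hT.card_face d8.symm, lq c d, lq x d]
    have : Tri T q c x ↔ Tri T q x c := ⟨Tri.swapRight, Tri.swapRight⟩
    rw [this, lq x c]
    grind
  set T1 := contract T r x with hT1
  -- By now `q` has the triangular link `p u r`.
  have c2 : Collapsible T1 r q := by
    have hrqp : Tri T1 r q p := Tri.swap ((q1 _ _).2 (by simp))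
    have hrqu : Tri T1 r q u := Tri.swap ((q1 _ _).2 (by simp))
    refine ⟨⟨p, hrqp⟩, ?_, ?_, Or.inl ?_, ?_⟩
    · rintro c ⟨d, hc⟩ ⟨e, he⟩
      have := hS1.distinct hc
      rw [q1] at he
      have : c = p ∨ c = u := by grind
      rcases this with rfl | rfl
      · exact hrqp
      · exact hrqu
    · intro c d hr hq
      have := hS1.distinct hr
      rw [q1] at hq
      rw [r1, lx] at hr
      have := hpr c
      have := hpr d
      have : Tri T r c d → Tri T r d c := Tri.swapRight
      grind
    · rintro c ⟨d, hd, hu⟩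
      simp only [q1] at hd hu
      have := hu p
      have := hu u
      have := hu r
      grind
    · refine ⟨p, u, s, ?_, Or.inl ⟨d11, d4, d6.symm⟩⟩
      rw [tri_contract hT.card_face d8.symm, lp]
      grind
  obtain ⟨hS2, ⟨e2⟩⟩ := c2.contract hS1
  have r2 : ∀ c d, Tri (contract T1 r q) r c d ↔ _ := fun c d =>
    tri_contract_new hS1 d14.symm (y := c) (z := d)
  have p2 : ∀ c d, Tri (contract T1 r q) p c d ↔ (c = r ∧ d = s) ∨ (c = s ∧ d = r) ∨
      (c = s ∧ d = u) ∨ (c = u ∧ d = s) ∨ (c = u ∧ d = r) ∨ (c = r ∧ d = u) := by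
    have p1 : ∀ c d, Tri T1 p c d ↔ (c = q ∧ d = r) ∨ (c = r ∧ d = q) ∨ (c = r ∧ d = s) ∨
      (c = s ∧ d = r) ∨ (c = s ∧ d = u) ∨ (c = u ∧ d = s) ∨ (c = u ∧ d = q) ∨ (c = q ∧ d = u) := by
      intro c d
      rw [tri_contract hT.card_face d8.symm, lp c d, lp x d]
      have : Tri T p c x ↔ Tri T p x c := ⟨Tri.swapRight, Tri.swapRight⟩
      rw [this, lp x c]
      grind
    intro c d
    rw [tri_contract hS1.card_face d14.symm, p1 c d, p1 q d]
    have : Tri T1 p c q ↔ Tri T1 p q c := ⟨Tri.swapRight, Tri.swapRight⟩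
    rw [this, p1 q c]
    grind
  set T2 := contract T1 r q with hT2
  -- By now `p` has the triangular link `r s u`.
  have c3 : Collapsible T2 r p := by
    have hrps : Tri T2 r p s := Tri.swap ((p2 _ _).2 (by simp))
    have hrpu : Tri T2 r p u := Tri.swap ((p2 _ _).2 (by simp))
    refine ⟨⟨s, hrps⟩, ?_, ?_, Or.inl ?_, ?_⟩
    · rintro c ⟨d, hc⟩ ⟨e, he⟩
      have := hS2.distinct hc
      rw [p2] at he
      have : c = s ∨ c = u := by grind
      rcases this with rfl | rfl
      · exact hrps
      · exact hrpu
    · intro c d hr hp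
      have := hS2.distinct hr
      rw [p2] at hp
      rw [r2, r1, q1, lx] at hr
      have : Tri T r u s → Tri T r s u := Tri.swapRight
      grind
    · rintro c ⟨d, hd, hu⟩
      simp only [p2] at hd hu
      have := hu s
      have := hu u
      have := hu r
      grind
    · exact ⟨p, s, u, (p2 _ _).2 (by simp), Or.inl ⟨d11, d6.symm, d4⟩⟩
  obtain ⟨hS3, ⟨e3⟩⟩ := c3.contract hS2
  have heq : contract T2 r p = fillOcta T x p q u r s := by
    refine faces_ext_at hS3.card_face (h.card_of_mem_fill hT) r ?_ ?_
    · intro y z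
      rw [tri_contract_new hS2 d11.symm, r2, r1, q1, p2, lx, h.tri_fill hT]
      have := @Surf.distinct _ _ _ hT r y z
      simp only [SameTriple]
      grind
    · intro y z w hy hz hw
      rw [tri_contract_old hS2 d11.symm hy hz hw, tri_contract_old hS1 d14.symm hy hz hw,
        tri_contract_old hT d8.symm hy hz hw, h.tri_fill hT]
      simp only [SameTriple]
      grind
  rw [heq] at hS3 e3
  exact ⟨hS3, ⟨(e1.trans e2).trans e3⟩⟩

/-! ### Degree bounds from lists of neighbors, and deletion of vertices -/

theorem card_le_deg {T : Finset (Finset V)} (hT : Surf T) {x : V} (l : List V) (hl : l.Nodup)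
    (h : ∀ c ∈ l, Nb T x c) : l.length ≤ deg T x := by
  rw [← List.toFinset_card_of_nodup hl]
  exact le_deg hT _ fun c hc => h c (List.mem_toFinset.1 hc)

theorem mem_of_nb_of_deg {T : Finset (Finset V)} (hT : Surf T) {x : V} (l : List V)
    (hl : l.Nodup) (h : ∀ c ∈ l, Nb T x c) (hd : deg T x = l.length) (c : V) (hc : Nb T x c) :
    c ∈ l := by
  rw [← List.toFinset_card_of_nodup hl] at hd
  exact List.mem_toFinset.1 ((nb_iff_of_deg_le hT l.toFinset
    (fun c hc => h c (List.mem_toFinset.1 hc)) hd.le c).1 hc)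

theorem exists_nb_not_mem {T : Finset (Finset V)} (hT : Surf T) {x : V} (l : List V)
    (hd : l.length < deg T x) : ∃ c, Nb T x c ∧ c ∉ l := by
  obtain ⟨c, hc, hcl⟩ := exists_nb_of_lt_deg hT l.toFinset
    ((List.toFinset_card_le l).trans_lt hd)
  exact ⟨c, hc, fun h => hcl (List.mem_toFinset.2 h)⟩

theorem Light.deg_le {T : Finset (Finset V)} {x : V} (h : Light T x) : deg T x ≤ 4 := by
  rcases h with h | h <;> omega

theorem Light.deg_eq_of_bd {T : Finset (Finset V)} {x y : V} (h : Light T x) (hb : Bd T x y) :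
    deg T x = 3 := by
  rcases h with h | h
  · exact h.2
  · exact absurd hb (h.1 y)

/-- Deletion of the vertices of `S` at the end of which the edge `s t` becomes a boundary edge. -/
theorem good_delete {T : Finset (Finset V)} (hT : Good T) {S : Finset V} {s t : V}
    (hS' : Surf (deleteVertices T S)) (hs : s ∉ S) (ht : t ∉ S)
    (hfar : ∀ y z, y ∉ S → z ∈ S → Nb T y z → y = s ∨ y = t)
    (hm : ∃ m ∈ S, Tri T s t m) (hk : ∃ k ∉ S, Tri T s t k)
    (hds : 3 + (neighbors T s ∩ S).card ≤ deg T s)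
    (hdt : 3 + (neighbors T t ∩ S).card ≤ deg T t) :
    Good (deleteVertices T S) ∧ (deleteVertices T S).card < T.card ∧
      Bd (deleteVertices T S) s t := by
  have hst : Bd (deleteVertices T S) s t := by
    obtain ⟨m, hm, hstm⟩ := hm
    obtain ⟨k, hk, hstk⟩ := hk
    refine ⟨k, tri_deleteVertices.2 ⟨hstk, hs, ht, hk⟩, fun w hw => ?_⟩
    obtain ⟨h1, -, -, h2⟩ := tri_deleteVertices.1 hw
    have hmk : m ≠ k := fun h => hk (h ▸ hm)
    rcases hT.surf.third hstm hstk hmk h1 with rfl | rfl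
    · exact absurd hm h2
    · rfl
  -- A face lost through a vertex of `S` has its other two vertices in `{s, t}`, so `s t` is the
  -- only edge at risk, and it still has the face at `k`.
  have hnb : ∀ y z, y ∉ S → z ∉ S → Nb T y z → Nb (deleteVertices T S) y z := by
    rintro y z hy hz ⟨w, hw⟩
    have hd := hT.surf.distinct hw
    by_cases hwS : w ∈ S
    · have h1 := hfar y w hy hwS ⟨z, hw.swapRight⟩
      have h2 := hfar z w hz hwS ⟨y, hw.rot⟩
      rcases h1 with rfl | rfl <;> rcases h2 with rfl | rfl
      · exact absurd rfl hd.1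
      · exact hst.nb
      · exact hst.symm.nb
      · exact absurd rfl hd.1
    · exact ⟨w, tri_deleteVertices.2 ⟨hw, hy, hz, hwS⟩⟩
  have hdeg : ∀ y, y ∉ S → deg T y ≤ deg (deleteVertices T S) y + (neighbors T y ∩ S).card := by
    intro y hy
    have h1 := le_deg hS' (neighbors T y \ S) (x := y) (by
      intro c hc
      rw [Finset.mem_sdiff, mem_neighbors hT.surf.card_face] at hc
      exact hnb y c hy hc.2 hc.1)
    have h2 := Finset.card_sdiff_add_card_inter (neighbors T y) S
    unfold deg at *
    omega
  refine ⟨?_, ?_, hst⟩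
  · have main : ∀ y, (∃ z, Nb (deleteVertices T S) y z) → 3 ≤ deg (deleteVertices T S) y ∧
        ((∀ z, ¬ Bd (deleteVertices T S) y z) → 4 ≤ deg (deleteVertices T S) y) := by
      rintro y ⟨z, w, hw⟩
      obtain ⟨hw, hyS, hzS, hwS⟩ := tri_deleteVertices.1 hw
      have hd := hdeg y hyS
      by_cases hys : y = s
      · subst hys
        exact ⟨by omega, fun h => absurd hst (h t)⟩
      by_cases hyt : y = t
      · subst hyt
        exact ⟨by omega, fun h => absurd hst.symm (h s)⟩
      have hno : ∀ z ∈ S, ¬ Nb T y z := fun z hz h => (hfar y z hyS hz h).elim hys hyt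
      have h0 : neighbors T y ∩ S = ∅ := by
        ext c
        simp only [Finset.mem_inter, mem_neighbors hT.surf.card_face, Finset.notMem_empty, iff_false]
        exact fun h => hno c h.2 h.1
      rw [h0, Finset.card_empty] at hd
      have h3 := hT.three_le y z ⟨w, hw⟩
      have h4 := hT.four_le y z ⟨w, hw⟩
      refine ⟨by omega, fun h => ?_⟩
      have := h4 (fun c hc => h c ?_)
      · omega
      · obtain ⟨v, hv, hu⟩ := hc
        have hcS : c ∉ S := fun h => hno c h ⟨v, hv⟩
        have hvS : v ∉ S := fun h => hno v h ⟨c, hv.swapRight⟩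
        exact ⟨v, tri_deleteVertices.2 ⟨hv, hyS, hcS, hvS⟩,
          fun x hx => hu x (tri_deleteVertices.1 hx).1⟩
    exact ⟨hS', fun y z h => (main y ⟨z, h⟩).1, fun y z h => (main y ⟨z, h⟩).2⟩
  · obtain ⟨m, hm, hstm⟩ := hm
    apply Finset.card_lt_card
    rw [deleteVertices, Finset.ssubset_iff_of_subset (Finset.filter_subset _ _)]
    refine ⟨_, hstm, fun h => ?_⟩
    rw [Finset.mem_filter, Finset.disjoint_left] at h
    exact h.2 (by simp) hm

/-! ### Degrees at the corners of an octahedron -/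

section Octahedron

variable {T : Finset (Finset V)} {x p q u r s : V}

/-- With `r s u` as a face, all six vertices have 4-cycles among the six as links; by connectedness
there is nothing else, and this sphere has no boundary. -/
theorem Octa.not_closed (hT : Surf T) (h : Octa T x p q u r s) (hole : ∃ y z, Bd T y z) :
    ¬ Tri T r s u := by
  intro hrsu
  obtain ⟨⟨d1, d2, d3⟩, ⟨d4, d5, d6⟩, ⟨d7, d8, d9⟩, ⟨d10, d11, d12⟩, d13, d14, d15⟩ := h.distinct hT
  have lr : Link4 T r x q u s := ⟨h.link_x.bc.swapRight.swap, h.link_q.cd.rot.rot,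
    hrsu.swapRight, h.link_x.cd.swap.swapRight, d7, d15⟩
  have ls : Link4 T s r x p u := ⟨h.link_x.cd.rot.rot.swapRight, h.link_x.da.swap,
    h.link_p.cd.swap, hrsu.swap.swapRight, d11.symm, d7⟩
  have lu : Link4 T u p q r s := ⟨h.link_q.bc.rot.rot.swapRight, h.link_q.cd.swap,
    hrsu.rot.rot, h.link_p.cd.rot.swap, d11, d15⟩
  have hl : ∀ y, (y = x ∨ y = p ∨ y = q ∨ y = u ∨ y = r ∨ y = s) → ∃ a b c d, Link4 T y a b c d ∧
      ∀ w, (w = a ∨ w = b ∨ w = c ∨ w = d) → (w = x ∨ w = p ∨ w = q ∨ w = u ∨ w = r ∨ w = s) := by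
    rintro y (rfl | rfl | rfl | rfl | rfl | rfl)
    · exact ⟨_, _, _, _, h.link_x, by grind⟩
    · exact ⟨_, _, _, _, h.link_p, by grind⟩
    · exact ⟨_, _, _, _, h.link_q, by grind⟩
    · exact ⟨_, _, _, _, lu, by grind⟩
    · exact ⟨_, _, _, _, lr, by grind⟩
    · exact ⟨_, _, _, _, ls, by grind⟩
  obtain ⟨y, z, hyz⟩ := hole
  have := hT.conn (fun y => y = x ∨ y = p ∨ y = q ∨ y = u ∨ y = r ∨ y = s)
    ⟨x, p, Or.inl rfl, q, h.link_x.ab⟩ (by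
      intro y z hy hyz
      obtain ⟨a, b, c, d, hl, hw⟩ := hl y hy
      exact hw z (hl.nb hT z hyz)) y z hyz.nb
  obtain ⟨a, b, c, d, hl, -⟩ := hl y this
  exact hl.inner hT z hyz

variable {F : Type v} [TopologicalSpace F]

/-- The trichotomy decides how the octahedron is removed. Degree four leaves no vertex for second
faces on `r s` and `r u`. An inner corner of degree five is impossible: with its fifth neighbor `w`,
the edge `w r` would be contractible with third vertices `s` and `u`, which have degree at least
five and are not light. -/
theorem Octa.corner (hT : InClass F T) (hole : ∃ y z, Bd T y z) (hred : ¬ Reducible F T)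
    (h : Octa T x p q u r s) : 6 ≤ deg T r ∨ ((∃ y, Bd T r y) ∧ 5 ≤ deg T r) ∨
      (deg T r = 4 ∧ Bd T r s ∧ Bd T r u) := by
  have hG := (inClass_iff.1 hT).1
  have hS := hG.surf
  obtain ⟨⟨d1, d2, d3⟩, ⟨d4, d5, d6⟩, ⟨d7, d8, d9⟩, ⟨d10, d11, d12⟩, d13, d14, d15⟩ := h.distinct hS
  have hrsu := h.not_closed hS hole
  have nx := h.link_x.nb hS
  have np := h.link_p.nb hS
  have nq := h.link_q.nb hS
  have f1 : Tri T r s x := h.link_x.cd.rot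
  have f2 : Tri T r u q := h.link_q.cd.rot.swap
  have hNr : ∀ c ∈ [s, x, q, u], Nb T r c := by
    intro c hc
    simp only [List.mem_cons, List.not_mem_nil, or_false] at hc
    rcases hc with rfl | rfl | rfl | rfl
    exacts [f1.nb, f1.swapRight.nb, f2.swapRight.nb, f2.nb]
  have hnd : [s, x, q, u].Nodup := by
    simp only [List.nodup_cons, List.mem_cons, List.not_mem_nil, or_false, List.nodup_nil]
    grind
  have h4 : 4 ≤ deg T r := card_le_deg hS _ hnd hNr
  have hxr : ∀ {w}, Tri T r s w → w ≠ q := by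
    rintro w hw rfl
    have := nq s ⟨r, hw.rot.rot.swapRight⟩
    grind
  have hqr : ∀ {w}, Tri T r u w → w ≠ x := by
    rintro w hw rfl
    have := nx u ⟨r, hw.rot.rot.swapRight⟩
    grind
  rcases Nat.lt_or_ge (deg T r) 5 with h5 | h5
  · right; right
    have hN := mem_of_nb_of_deg hS _ hnd hNr (by simp; omega)
    refine ⟨by omega, by_contra fun hbd => ?_, by_contra fun hbd => ?_⟩
    · obtain ⟨w, hw, hwx⟩ := other_third f1 hbd
      have := hN w hw.swapRight.nb
      simp only [List.mem_cons, List.not_mem_nil, or_false] at this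
      have := hxr hw
      have := hS.distinct hw
      grind
    · obtain ⟨w, hw, hwx⟩ := other_third f2 hbd
      have := hN w hw.swapRight.nb
      simp only [List.mem_cons, List.not_mem_nil, or_false] at this
      have := hqr hw
      have := hS.distinct hw
      have := hw.swapRight
      grind
  · rcases Nat.lt_or_ge (deg T r) 6 with h6 | h6
    · right; left
      refine ⟨by_contra fun hin => ?_, h5⟩
      push Not at hin
      obtain ⟨w, hw, hwn⟩ := exists_nb_not_mem hS [s, x, q, u] (x := r) (by simp; omega)
      have hNr' : ∀ c ∈ [w, s, x, q, u], Nb T r c := by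
        intro c hc
        rcases List.mem_cons.1 hc with rfl | hc
        · exact hw
        · exact hNr c hc
      have hN := mem_of_nb_of_deg hS _ (List.nodup_cons.2 ⟨hwn, hnd⟩) hNr' (by simp; omega)
      simp only [List.mem_cons, List.not_mem_nil, or_false] at hN hwn
      obtain ⟨v, hv, hvx⟩ := other_third f1 (hin s)
      obtain ⟨v', hv', hvx'⟩ := other_third f2 (hin u)
      have hvw : v = w := by
        have := hN v hv.swapRight.nb
        have := hxr hv
        have := hS.distinct hv
        grind
      have hvw' : v' = w := by
        have := hN v' hv'.swapRight.nb
        have := hqr hv'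
        have := hS.distinct hv'
        have := hv'.swapRight
        grind
      subst hvw
      subst hvw'
      have hne := (hS.distinct hv).2.1
      obtain ⟨y, hy, hl⟩ := exists_light hT hole hred hw.symm (by
        intro c hvc hrc
        have hc := hN c hrc
        rcases hc with rfl | rfl | rfl | rfl | rfl
        · obtain ⟨z, hz⟩ := hvc
          exact absurd rfl (hS.distinct hz).1
        · exact hv.rot.rot
        · have := nx _ hvc.symm
          have := np r
          have : v' = p → Nb T p r := fun h => h ▸ hw.symm
          grind
        · have := nq _ hvc.symm
          have := np r
          have : v' = p → Nb T p r := fun h => h ▸ hw.symm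
          grind
        · exact hv'.rot.rot) (Or.inl hin)
      have hl4 := hl.deg_le
      have hwp : v' ≠ p := by
        rintro rfl
        have := np r hw.symm
        grind
      rcases hS.third hv.swapRight hv'.swapRight d5.symm hy.swap with rfl | rfl
      · have : 5 ≤ deg T y := card_le_deg hS [v', r, x, p, u] (by
          simp only [List.nodup_cons, List.mem_cons, List.not_mem_nil, or_false, List.nodup_nil]
          grind) (by
          intro c hc
          simp only [List.mem_cons, List.not_mem_nil, or_false] at hc
          rcases hc with rfl | rfl | rfl | rfl | rfl
          exacts [hv.rot.nb, f1.swap.nb, f1.rot.nb, h.link_p.cd.swap.nb,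
            h.link_p.cd.rot.nb])
        omega
      · have : 5 ≤ deg T y := card_le_deg hS [v', r, q, p, s] (by
          simp only [List.nodup_cons, List.mem_cons, List.not_mem_nil, or_false, List.nodup_nil]
          grind) (by
          intro c hc
          simp only [List.mem_cons, List.not_mem_nil, or_false] at hc
          rcases hc with rfl | rfl | rfl | rfl | rfl
          exacts [hv'.rot.nb, f2.swap.nb, f2.rot.nb, h.link_q.bc.rot.rot.swapRight.nb,
            h.link_p.cd.rot.swap.nb])
        omega
    · exact Or.inl h6

theorem Octa.isOctahedron (hS : Surf T) (h : Octa T x p q u r s) (hra : Nb T r s)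
    (hru : Nb T r u) : IsOctahedron T ![x, p, q] ![u, r, s] := by
  obtain ⟨⟨d1, d2, d3⟩, ⟨d4, d5, d6⟩, ⟨d7, d8, d9⟩, ⟨d10, d11, d12⟩, d13, d14, d15⟩ := h.distinct hS
  have hm : ∀ {x y}, y ∈ neighbors T x ↔ Nb T x y := mem_neighbors hS.card_face
  have hsu : Nb T s u := h.link_p.cd.rot.nb
  have nx : ∀ w, Nb T x w ↔ w = p ∨ w = q ∨ w = r ∨ w = s := fun w =>
    ⟨h.link_x.nb hS w, by
      rintro (rfl | rfl | rfl | rfl)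
      exacts [h.link_x.ab.nb, h.link_x.bc.nb, h.link_x.cd.nb, h.link_x.da.nb]⟩
  have np : ∀ w, Nb T p w ↔ w = q ∨ w = x ∨ w = s ∨ w = u := fun w =>
    ⟨h.link_p.nb hS w, by
      rintro (rfl | rfl | rfl | rfl)
      exacts [h.link_p.ab.nb, h.link_p.bc.nb, h.link_p.cd.nb, h.link_p.da.nb]⟩
  have nq : ∀ w, Nb T q w ↔ w = x ∨ w = p ∨ w = u ∨ w = r := fun w =>
    ⟨h.link_q.nb hS w, by
      rintro (rfl | rfl | rfl | rfl)
      exacts [h.link_q.ab.nb, h.link_q.bc.nb, h.link_q.cd.nb, h.link_q.da.nb]⟩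
  refine ⟨?_, ?_, ?_, ?_, ?_, ?_, ?_, Or.inl ?_⟩
  · intro i j
    fin_cases i <;> fin_cases j <;> simp <;> grind
  · intro i j
    fin_cases i <;> fin_cases j <;> simp <;> grind
  · intro i j
    fin_cases i <;> fin_cases j <;> simp <;> grind
  · intro i
    fin_cases i
    exacts [h.link_x.deg_eq hS, h.link_p.deg_eq hS, h.link_q.deg_eq hS]
  · intro i j hij
    rw [hm]
    fin_cases i <;> fin_cases j <;> simp [nx, np, nq] at hij ⊢
  · intro i j k hij hik hjk w hw
    rw [hm, hm]
    fin_cases i <;> fin_cases j <;> fin_cases k <;> simp [nx, np, nq] at hij hik hjk hw ⊢ <;> grind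
  · intro i j hij
    rw [hm]
    fin_cases i <;> fin_cases j <;> simp [hra, hru, hsu, hra.symm, hru.symm, hsu.symm] at hij ⊢
  · intro i
    rw [mem_boundaryVertices hS.card_face]
    rintro ⟨y, hy⟩
    fin_cases i
    exacts [h.link_x.inner hS y hy, h.link_p.inner hS y hy, h.link_q.inner hS y hy]

end Octahedron

/-! ### Replacing an octahedron by a face -/

section Octahedron

variable {T : Finset (Finset V)} {x p q u r s : V}

/-- Boundary edges avoid the central vertices. If the only face on such an edge is a deleted one,
the edge is a side of `u r s`, and the new face takes over. -/
theorem Octa.bd_fill (hT : Surf T) (h : Octa T x p q u r s) {y c : V} (hb : Bd T y c) :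
    Bd (fillOcta T x p q u r s) y c := by
  have hin : ∀ z w, Bd T z w → z ≠ x ∧ z ≠ p ∧ z ≠ q := by
    intro z w hz
    refine ⟨?_, ?_, ?_⟩ <;> rintro rfl
    exacts [h.link_x.inner hT w hz, h.link_p.inner hT w hz, h.link_q.inner hT w hz]
  have hy := hin y c hb
  have hc := hin c y hb.symm
  obtain ⟨v, hv, hu⟩ := hb
  have hd := hT.distinct hv
  have hdis := h.distinct hT
  have f1 : Tri T r s x := h.link_x.cd.rot
  have f2 : Tri T u r q := h.link_q.cd.rot
  have f3 : Tri T s u p := h.link_p.cd.rot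
  have hpair : ∀ w, SameTriple y c w u r s → v = x ∨ v = p ∨ v = q := by
    have := hu x
    have := hu p
    have := hu q
    have := f1.swap
    have := f2.swap
    have := f3.swap
    simp only [SameTriple]
    rintro w (⟨rfl, rfl, rfl⟩ | ⟨rfl, rfl, rfl⟩ | ⟨rfl, rfl, rfl⟩ | ⟨rfl, rfl, rfl⟩ |
      ⟨rfl, rfl, rfl⟩ | ⟨rfl, rfl, rfl⟩) <;> grind
  by_cases hvS : v = x ∨ v = p ∨ v = q
  · have hex : ∃ w, SameTriple y c w u r s := by
      have hx := h.link_x.tri_iff hT y c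
      have hp := h.link_p.tri_iff hT y c
      have hq := h.link_q.tri_iff hT y c
      have := hv.rot.rot
      simp only [SameTriple]
      rcases hvS with rfl | rfl | rfl
      · exact ⟨u, by grind⟩
      · exact ⟨r, by grind⟩
      · exact ⟨s, by grind⟩
    obtain ⟨w, hw⟩ := hex
    refine ⟨w, (h.tri_fill hT).2 (Or.inl hw), fun w' hw' => ?_⟩
    rcases (h.tri_fill hT).1 hw' with hw' | ⟨hw', -, -, hw''⟩
    · simp only [SameTriple] at hw hw'
      grind
    · have := hu w' hw'
      grind
  · refine ⟨v, (h.tri_fill hT).2 (Or.inr ⟨hv, hy, hc, by grind⟩), fun w hw => ?_⟩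
    rcases (h.tri_fill hT).1 hw with hw | ⟨hw, -⟩
    · exact absurd (hpair w hw) hvS
    · exact hu w hw

/-- At least `x p q` and `x q r` disappear and only one face is added. -/
theorem Octa.card_fill_lt (hT : Surf T) (h : Octa T x p q u r s) :
    (fillOcta T x p q u r s).card < T.card := by
  have hd := h.distinct hT
  have hne : ({x, p, q} : Finset V) ≠ {x, q, r} := by
    intro he
    have : p ∈ ({x, q, r} : Finset V) := he ▸ by simp
    simp only [Finset.mem_insert, Finset.mem_singleton] at this
    grind
  have h1 : {x, p, q} ∈ T := h.link_x.ab
  have h2 : {x, q, r} ∈ T := h.link_x.bc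
  have hsub : deleteVertices T {x, p, q} ⊆ (T.erase {x, p, q}).erase {x, q, r} := by
    intro t ht
    rw [deleteVertices, Finset.mem_filter, Finset.disjoint_right] at ht
    have : x ∉ t := ht.2 (by simp)
    refine Finset.mem_erase.2 ⟨?_, Finset.mem_erase.2 ⟨?_, ht.1⟩⟩ <;> rintro rfl <;> simp at this
  have hc := Finset.card_le_card hsub
  rw [Finset.card_erase_of_mem (Finset.mem_erase.2 ⟨hne.symm, h2⟩),
    Finset.card_erase_of_mem h1] at hc
  have h3 : 1 < T.card := Finset.one_lt_card.2 ⟨_, h1, _, h2, hne⟩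
  have := Finset.card_insert_le {u, r, s} (deleteVertices T {x, p, q})
  unfold fillOcta
  omega

/-- Each corner is adjacent to at most two of the central vertices: from degree 6 it keeps 4, from
degree 5 on the boundary it keeps 3. -/
theorem Octa.good_fill (hT : Good T) (h : Octa T x p q u r s) (hrsu : ¬ Tri T r s u)
    (hu : 6 ≤ deg T u ∨ ((∃ y, Bd T u y) ∧ 5 ≤ deg T u))
    (hr : 6 ≤ deg T r ∨ ((∃ y, Bd T r y) ∧ 5 ≤ deg T r))
    (hs : 6 ≤ deg T s ∨ ((∃ y, Bd T s y) ∧ 5 ≤ deg T s)) :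
    Good (fillOcta T x p q u r s) := by
  have hS := hT.surf
  have hS' := (h.fill hS hrsu).1
  obtain ⟨⟨d1, d2, d3⟩, ⟨d4, d5, d6⟩, ⟨d7, d8, d9⟩, ⟨d10, d11, d12⟩, d13, d14, d15⟩ := h.distinct hS
  have hlx := h.link_x.tri_iff hS
  have hlp := h.link_p.tri_iff hS
  have hlq := h.link_q.tri_iff hS
  have hnb : ∀ y z, (y ≠ x ∧ y ≠ p ∧ y ≠ q) → (z ≠ x ∧ z ≠ p ∧ z ≠ q) → Nb T y z →
      Nb (fillOcta T x p q u r s) y z := by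
    rintro y z hy hz ⟨w, hw⟩
    have hwx := hlx y z
    have hwp := hlp y z
    have hwq := hlq y z
    have := hw.rot.rot
    by_cases hwS : w = x ∨ w = p ∨ w = q
    · rcases hwS with rfl | rfl | rfl
      · exact ⟨u, (h.tri_fill hS).2 (Or.inl (by simp only [SameTriple]; grind))⟩
      · exact ⟨r, (h.tri_fill hS).2 (Or.inl (by simp only [SameTriple]; grind))⟩
      · exact ⟨s, (h.tri_fill hS).2 (Or.inl (by simp only [SameTriple]; grind))⟩
    · exact ⟨w, (h.tri_fill hS).2 (Or.inr ⟨hw, hy, hz, by grind⟩)⟩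
  have hmem : ∀ {y z}, z ∈ neighbors T y ↔ Nb T y z := mem_neighbors hS.card_face
  have hdeg : ∀ y, (y ≠ x ∧ y ≠ p ∧ y ≠ q) → deg T y ≤ deg (fillOcta T x p q u r s) y +
      (neighbors T y ∩ {x, p, q}).card := by
    intro y hy
    have h1 := le_deg hS' (neighbors T y \ {x, p, q}) (x := y) (by
      intro c hc
      rw [Finset.mem_sdiff, hmem] at hc
      exact hnb y c hy (by simpa using hc.2) hc.1)
    have h2 := Finset.card_sdiff_add_card_inter (neighbors T y) {x, p, q}
    unfold deg at *
    omega
  have hcorner : ∀ y a b c, neighbors T y ∩ {x, p, q} ⊆ {a, b, c} → ¬ Nb T y c →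
      (neighbors T y ∩ {x, p, q}).card ≤ 2 := by
    intro y a b c hsub hnc
    refine (Finset.card_le_card (t := {a, b}) fun w hw => ?_).trans Finset.card_le_two
    have h1 := hsub hw
    have h2 := hmem.1 (Finset.mem_inter.1 hw).1
    simp only [Finset.mem_insert, Finset.mem_singleton] at h1 ⊢
    rcases h1 with h1 | h1 | rfl
    exacts [Or.inl h1, Or.inr h1, absurd h2 hnc]
  have main : ∀ y, (∃ z, Nb (fillOcta T x p q u r s) y z) →
      3 ≤ deg (fillOcta T x p q u r s) y ∧
        ((∀ z, ¬ Bd (fillOcta T x p q u r s) y z) → 4 ≤ deg (fillOcta T x p q u r s) y) := by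
    have hcase : ∀ y, (y ≠ x ∧ y ≠ p ∧ y ≠ q) → (neighbors T y ∩ {x, p, q}).card ≤ 2 →
        (6 ≤ deg T y ∨ ((∃ z, Bd T y z) ∧ 5 ≤ deg T y)) → 3 ≤ deg (fillOcta T x p q u r s) y ∧
        ((∀ z, ¬ Bd (fillOcta T x p q u r s) y z) → 4 ≤ deg (fillOcta T x p q u r s) y) := by
      intro y hy hc hd
      have := hdeg y hy
      rcases hd with hd | ⟨⟨z, hz⟩, hd⟩
      · exact ⟨by omega, fun _ => by omega⟩
      · exact ⟨by omega, fun hn => absurd (h.bd_fill hS hz) (hn z)⟩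
    rintro y ⟨z, w, hw⟩
    by_cases hyu : y = u
    · subst hyu
      refine hcase y ⟨d7.symm, d10.symm, d13.symm⟩ (hcorner y p q x (by grind) fun hn => ?_) hu
      have := h.link_x.nb hS y hn.symm
      grind
    by_cases hyr : y = r
    · subst hyr
      refine hcase y ⟨d8.symm, d11.symm, d14.symm⟩ (hcorner y x q p (by grind) fun hn => ?_) hr
      have := h.link_p.nb hS y hn.symm
      grind
    by_cases hys : y = s
    · subst hys
      refine hcase y ⟨d9.symm, d12.symm, d15.symm⟩ (hcorner y x p q (by grind) fun hn => ?_) hs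
      have := h.link_q.nb hS y hn.symm
      grind
    rcases (h.tri_fill hS).1 hw with hw | ⟨hw, hy, hz, hw'⟩
    · simp only [SameTriple] at hw
      grind
    have h0 : neighbors T y ∩ {x, p, q} = ∅ := by
      ext c
      simp only [Finset.mem_inter, hmem, Finset.notMem_empty, iff_false, Finset.mem_insert,
        Finset.mem_singleton]
      rintro ⟨hn, rfl | rfl | rfl⟩
      · have := h.link_x.nb hS y hn.symm
        grind
      · have := h.link_p.nb hS y hn.symm
        grind
      · have := h.link_q.nb hS y hn.symm
        grind
    have hd := hdeg y hy
    rw [h0, Finset.card_empty] at hd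
    have h3 := hT.three_le y z ⟨w, hw⟩
    have h4 := hT.four_le y z ⟨w, hw⟩
    refine ⟨by omega, fun hn => ?_⟩
    have := h4 fun c hc => hn c (h.bd_fill hS hc)
    omega
  exact ⟨hS', fun y z h => (main y ⟨z, h⟩).1, fun y z h => (main y ⟨z, h⟩).2⟩

variable {F : Type v} [TopologicalSpace F]

theorem Octa.reducible_inner (hT : InClass F T) (hole : ∃ y z, Bd T y z)
    (h : Octa T x p q u r s)
    (hu : 6 ≤ deg T u ∨ ((∃ y, Bd T u y) ∧ 5 ≤ deg T u))
    (hr : 6 ≤ deg T r ∨ ((∃ y, Bd T r y) ∧ 5 ≤ deg T r))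
    (hs : 6 ≤ deg T s ∨ ((∃ y, Bd T s y) ∧ 5 ≤ deg T s)) : Reducible F T := by
  obtain ⟨hG, ⟨e⟩⟩ := inClass_iff.1 hT
  have hS := hG.surf
  have hrsu := h.not_closed hS hole
  obtain ⟨-, ⟨e'⟩⟩ := h.fill hS hrsu
  have hoct := h.isOctahedron hS h.link_x.cd.rot.nb h.link_q.cd.rot.swap.nb
  obtain ⟨y, z, hyz⟩ := hole
  refine ⟨fillOcta T x p q u r s, ⟨inClass_iff.2 ⟨h.good_fill hG hrsu hu hr hs,
    ⟨e'.symm.trans e⟩⟩, hT, Or.inr (Or.inr (Or.inr (Or.inl ⟨_, _, hoct, Or.inl ⟨?_, rfl⟩⟩)))⟩,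
    h.card_fill_lt hS, y, z, h.bd_fill hS hyz⟩
  intro i
  rw [mem_boundaryVertices hS.card_face]
  rintro ⟨y, hy⟩
  fin_cases i
  exacts [h.link_x.inner hS y hy, h.link_p.inner hS y hy, h.link_q.inner hS y hy]

end Octahedron

/-! ### Removing an octahedron together with a boundary corner -/

section Octahedron

variable {T : Finset (Finset V)} {x p q u r s w : V} {F : Type v} [TopologicalSpace F]

/-- Were `s u` a boundary edge too, filling the octahedron would leave the single face `r s u`, and
`F` would be a disk. -/
theorem Octa.exists_third (hdisk : IsEmpty (F ≃ₜ Metric.closedBall (0 : EuclideanSpace ℝ (Fin 2)) 1))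
    (hT : InClass F T) (h : Octa T x p q u r s) (hrs : Bd T r s) (hru : Bd T r u) :
    ∃ w, Tri T s u w ∧ w ≠ p := by
  obtain ⟨hG, ⟨e⟩⟩ := inClass_iff.1 hT
  have hS := hG.surf
  obtain ⟨hS', ⟨e'⟩⟩ := h.fill hS (h.not_closed hS ⟨r, s, hrs⟩)
  refine other_third h.link_p.cd.rot fun hsu => ?_
  have huniq : ∀ {a b c}, Bd T a b → Tri (fillOcta T x p q u r s) a b c →
      ∀ w, Tri (fillOcta T x p q u r s) a b w → w = c := by
    intro a b c hb hc w hw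
    obtain ⟨z, -, hz⟩ := h.bd_fill hS hb
    exact (hz w hw).trans (hz c hc).symm
  have hf : Tri (fillOcta T x p q u r s) r s u :=
    (h.tri_fill hS).2 (Or.inl (by simp [SameTriple]))
  obtain ⟨e''⟩ := single_face_homeomorph_ball hS' hf (huniq hrs hf) (huniq hru hf.swapRight)
    (huniq hsu hf.rot)
  exact hdisk.false ((e.symm.trans e').trans e'')

/-- The deletion will cost `s` the neighbors `r`, `x`, `p`, so it needs six. With only `r`, `x`,
`p`, `u`, `w` as neighbors, `s w` would be a contractible boundary edge whose sole third vertex `u`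
has degree at least five and is not light. -/
theorem Octa.six_le_deg (hT : InClass F T) (hred : ¬ Reducible F T) (h : Octa T x p q u r s)
    (hr : deg T r = 4) (hrs : Bd T r s) (hw : Tri T s u w) (hwp : w ≠ p) : 6 ≤ deg T s := by
  have hG := (inClass_iff.1 hT).1
  have hS := hG.surf
  have hole : ∃ y z, Bd T y z := ⟨r, s, hrs⟩
  have hrsu := h.not_closed hS hole
  obtain ⟨⟨d1, d2, d3⟩, ⟨d4, d5, d6⟩, ⟨d7, d8, d9⟩, ⟨d10, d11, d12⟩, d13, d14, d15⟩ := h.distinct hS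
  have dw := hS.distinct hw
  have nx := h.link_x.nb hS
  have np := h.link_p.nb hS
  have nq := h.link_q.nb hS
  have f1 : Tri T r s x := h.link_x.cd.rot
  have f2 : Tri T r u q := h.link_q.cd.rot.swap
  have f3 : Tri T s u p := h.link_p.cd.rot
  have hwr : w ≠ r := by
    rintro rfl
    exact hrsu hw.rot.rot
  have hwx : w ≠ x := by
    rintro rfl
    have := nx u hw.rot.rot.swapRight.nb
    grind
  have hwq : w ≠ q := by
    rintro rfl
    have := nq s hw.rot.rot.nb
    grind
  have hNr := mem_of_nb_of_deg hS [s, x, q, u] (x := r) (by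
      simp only [List.nodup_cons, List.mem_cons, List.not_mem_nil, or_false, List.nodup_nil]
      grind) (by
      intro c hc
      simp only [List.mem_cons, List.not_mem_nil, or_false] at hc
      rcases hc with rfl | rfl | rfl | rfl
      exacts [f1.nb, f1.swapRight.nb, f2.swapRight.nb, f2.nb]) (by simpa using hr)
  have hnd : [r, x, p, u, w].Nodup := by
    simp only [List.nodup_cons, List.mem_cons, List.not_mem_nil, or_false, List.nodup_nil]
    grind
  have hNs : ∀ c ∈ [r, x, p, u, w], Nb T s c := by
    intro c hc
    simp only [List.mem_cons, List.not_mem_nil, or_false] at hc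
    rcases hc with rfl | rfl | rfl | rfl | rfl
    exacts [f1.swap.nb, f1.rot.nb, f3.swapRight.nb, f3.nb, hw.swapRight.nb]
  have h5 : 5 ≤ deg T s := card_le_deg hS _ hnd hNs
  by_contra! h6
  have hN := mem_of_nb_of_deg hS _ hnd hNs (by simp; omega)
  simp only [List.mem_cons, List.not_mem_nil, or_false] at hN hNr
  have hsw : Bd T s w := by
    refine ⟨u, hw.swapRight, fun v hv => by_contra fun hvu => ?_⟩
    have dv := hS.distinct hv
    rcases hN v hv.swapRight.nb with rfl | rfl | rfl | rfl | rfl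
    · obtain ⟨z, -, hz⟩ := hrs
      exact hwx ((hz w hv.rot.rot).trans (hz x f1).symm)
    · have := (h.link_x.tri_iff hS s w).1 hv.rot.rot
      grind
    · have := (h.link_p.tri_iff hS s w).1 hv.rot.rot
      grind
    · exact hvu rfl
    · exact dv.2.2 rfl
  obtain ⟨v, hv, hl⟩ := exists_light hT hole hred hw.swapRight.nb (by
    intro c hc hwc
    rcases hN c hc with rfl | rfl | rfl | rfl | rfl
    · have := hNr w hwc.symm
      grind
    · have := nx w hwc.symm
      grind
    · have := np w hwc.symm
      grind
    · exact hw.swapRight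
    · obtain ⟨z, hz⟩ := hwc
      exact absurd rfl (hS.distinct hz).1) (Or.inr hsw)
  have hvu : v = u := by
    obtain ⟨z, -, hz⟩ := hsw
    exact (hz v hv).trans (hz u hw.swapRight).symm
  subst hvu
  have := hl.deg_le
  have : 5 ≤ deg T v := card_le_deg hS [r, q, p, s, w] (by
    simp only [List.nodup_cons, List.mem_cons, List.not_mem_nil, or_false, List.nodup_nil]
    grind) (by
    intro c hc
    simp only [List.mem_cons, List.not_mem_nil, or_false] at hc
    rcases hc with rfl | rfl | rfl | rfl | rfl
    exacts [f2.swap.nb, f2.rot.nb, f3.rot.nb, f3.swap.nb, hv.rot.rot.swapRight.nb])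
  omega

/-- Since `r` has degree four, filling leaves it in the face `r s u` alone, and contracting `r` into
`s` removes this ear. -/
theorem Octa.surf_delete (hT : Surf T) (h : Octa T x p q u r s)
    (hr : deg T r = 4) (hrs : Bd T r s) (hw : Tri T s u w) (hwp : w ≠ p) :
    Surf (deleteVertices T {r, x, p, q}) ∧
      Nonempty (realization T ≃ₜ realization (deleteVertices T {r, x, p, q})) := by
  have hrsu := h.not_closed hT ⟨r, s, hrs⟩
  obtain ⟨hS', ⟨e⟩⟩ := h.fill hT hrsu
  obtain ⟨⟨d1, d2, d3⟩, ⟨d4, d5, d6⟩, ⟨d7, d8, d9⟩, ⟨d10, d11, d12⟩, d13, d14, d15⟩ := h.distinct hT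
  have dw := hT.distinct hw
  have hwr : w ≠ r := by
    rintro rfl
    exact hrsu hw.rot.rot
  have hwx : w ≠ x := by
    rintro rfl
    have := h.link_x.nb hT u hw.rot.rot.swapRight.nb
    grind
  have hwq : w ≠ q := by
    rintro rfl
    have := h.link_q.nb hT s hw.rot.rot.nb
    grind
  have hNr := mem_of_nb_of_deg hT [s, x, q, u] (x := r) (by
      simp only [List.nodup_cons, List.mem_cons, List.not_mem_nil, or_false, List.nodup_nil]
      grind) (by
      intro c hc
      simp only [List.mem_cons, List.not_mem_nil, or_false] at hc
      rcases hc with rfl | rfl | rfl | rfl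
      exacts [h.link_x.cd.rot.nb, h.link_x.cd.swap.nb, h.link_q.da.swapRight.rot.swap.swapRight.nb,
        h.link_q.cd.rot.swap.nb]) (by simpa using hr)
  simp only [List.mem_cons, List.not_mem_nil, or_false] at hNr
  have hfr : ∀ c d, Tri (fillOcta T x p q u r s) r c d ↔ (c = s ∧ d = u) ∨ (c = u ∧ d = s) := by
    intro c d
    rw [h.tri_fill hT]
    simp only [SameTriple]
    constructor
    · rintro (hc | ⟨hc, -, h1, h2⟩)
      · grind
      · have := hNr c hc.nb
        have := hNr d hc.swapRight.nb
        have := hT.distinct hc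
        have := hc.swapRight
        grind
    · grind
  have hcol : Collapsible (fillOcta T x p q u r s) s r := by
    refine ⟨⟨u, ((hfr _ _).2 (by simp)).swap⟩, ?_, ?_, Or.inr (h.bd_fill hT hrs.symm), ?_⟩
    · rintro c ⟨d, hc⟩ ⟨d', hc'⟩
      have := hS'.distinct hc
      have := (hfr _ _).1 hc'
      exact ((hfr _ _).2 (by grind)).swap
    · intro c d hc hc'
      have := hS'.distinct hc
      have := (hfr _ _).1 hc'
      grind
    · exact ⟨s, u, w, (h.tri_fill hT).2 (Or.inr (by grind)), by grind⟩
  obtain ⟨hS2, ⟨e2⟩⟩ := hcol.contract hS'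
  have heq : contract (fillOcta T x p q u r s) s r = deleteVertices T {r, x, p, q} := by
    refine faces_ext_at hS2.card_face
      (fun t ht => hT.card_face t (Finset.mem_filter.1 ht).1) s ?_ ?_
    · intro y z
      rw [tri_contract_new hS' d6.symm, hfr, h.tri_fill hT, tri_deleteVertices]
      have := @Surf.distinct _ _ _ hT s y z
      simp only [SameTriple, Finset.mem_insert, Finset.mem_singleton]
      grind
    · intro y z w hy hz hw
      rw [tri_contract_old hS' d6.symm hy hz hw, h.tri_fill hT, tri_deleteVertices]
      simp only [SameTriple, Finset.mem_insert, Finset.mem_singleton]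
      grind
  rw [heq] at hS2 e2
  exact ⟨hS2, ⟨e.trans e2⟩⟩

theorem Octa.reducible_external
    (hdisk : IsEmpty (F ≃ₜ Metric.closedBall (0 : EuclideanSpace ℝ (Fin 2)) 1))
    (hT : InClass F T) (h : Octa T x p q u r s)
    (hr : deg T r = 4) (hrs : Bd T r s) (hru : Bd T r u) : Reducible F T := by
  by_contra hred
  obtain ⟨w, hw, hwp⟩ := h.exists_third hdisk hT hrs hru
  have hs6 := h.six_le_deg hT hred hr hrs hw hwp
  have hu6 := h.reflect.six_le_deg hT hred hr hru hw.swap hwp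
  obtain ⟨hG, ⟨e⟩⟩ := inClass_iff.1 hT
  have hS := hG.surf
  obtain ⟨hS', ⟨e'⟩⟩ := h.surf_delete hS hr hrs hw hwp
  have hrsu := h.not_closed hS ⟨r, s, hrs⟩
  obtain ⟨⟨d1, d2, d3⟩, ⟨d4, d5, d6⟩, ⟨d7, d8, d9⟩, ⟨d10, d11, d12⟩, d13, d14, d15⟩ := h.distinct hS
  have nx := h.link_x.nb hS
  have np := h.link_p.nb hS
  have nq := h.link_q.nb hS
  have f1 : Tri T r s x := h.link_x.cd.rot
  have f2 : Tri T r u q := h.link_q.cd.rot.swap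
  have hNr := mem_of_nb_of_deg hS [s, x, q, u] (x := r) (by
      simp only [List.nodup_cons, List.mem_cons, List.not_mem_nil, or_false, List.nodup_nil]
      grind) (by
      intro c hc
      simp only [List.mem_cons, List.not_mem_nil, or_false] at hc
      rcases hc with rfl | rfl | rfl | rfl
      exacts [f1.nb, f1.swapRight.nb, f2.swapRight.nb, f2.nb]) (by simpa using hr)
  simp only [List.mem_cons, List.not_mem_nil, or_false] at hNr
  have hcard : ∀ y a b c, (neighbors T y ∩ {r, x, p, q}) ⊆ {a, b, c} →
      (neighbors T y ∩ {r, x, p, q}).card ≤ 3 := fun y a b c hsub =>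
    (Finset.card_le_card hsub).trans Finset.card_le_three
  have hmem : ∀ {y z}, z ∈ neighbors T y ↔ Nb T y z := mem_neighbors hS.card_face
  have hcs := hcard s r x p (by
    intro c hc
    rw [Finset.mem_inter, hmem] at hc
    have := nq s
    have : c = q → Nb T q s := fun h => h ▸ hc.1.symm
    grind)
  have hcu := hcard u r p q (by
    intro c hc
    rw [Finset.mem_inter, hmem] at hc
    have := nx u
    have : c = x → Nb T x u := fun h => h ▸ hc.1.symm
    grind)
  obtain ⟨hG', hlt, hbd⟩ := good_delete hG (S := {r, x, p, q}) (s := s) (t := u) hS'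
    (by grind) (by grind) (by
      intro y z hy hz hyz
      simp only [Finset.mem_insert, Finset.mem_singleton] at hy hz
      rcases hz with rfl | rfl | rfl | rfl
      · have := hNr y hyz.symm
        grind
      · have := nx y hyz.symm
        grind
      · have := np y hyz.symm
        grind
      · have := nq y hyz.symm
        grind) ⟨p, by simp, h.link_p.cd.rot⟩ ⟨w, by
      have : w ≠ r := by
        rintro rfl
        exact hrsu hw.rot.rot
      have : w ≠ x := by
        rintro rfl
        have := nx u hw.rot.rot.swapRight.nb
        grind
      have : w ≠ q := by
        rintro rfl
        have := nq s hw.rot.rot.nb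
        grind
      grind, hw⟩ (by omega) (by omega)
  -- The indices `2, 1, 0` stand for the corners `s`, `r`, `u`; the middle one is deleted.
  exact hred ⟨_, ⟨inClass_iff.2 ⟨hG', ⟨e'.symm.trans e⟩⟩, hT, Or.inr (Or.inr (Or.inr (Or.inr
    ⟨![x, p, q], ![u, r, s], h.isOctahedron hS f1.nb f2.nb, 2, 1, 0, by decide, by decide,
      by decide, (mem_boundaryEdges hS.card_face).2 hrs.symm,
      (mem_boundaryEdges hS.card_face).2 hru, rfl⟩)))⟩, hlt, s, u, hbd⟩

/-- A corner of degree four is removed together with the centre; if there is none, every corner can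
spare two neighbors and a face is filled in. Rotations carry the statements about `r` to the other
corners. -/
theorem Octa.reducible (hdisk : IsEmpty (F ≃ₜ Metric.closedBall (0 : EuclideanSpace ℝ (Fin 2)) 1))
    (hT : InClass F T) (hole : ∃ y z, Bd T y z) (h : Octa T x p q u r s) : Reducible F T := by
  by_contra hred
  rcases h.corner hT hole hred with h1 | h1 | ⟨h1, h2, h3⟩
  on_goal 3 => exact hred (h.reducible_external hdisk hT h1 h2 h3)
  all_goals
    rcases h.rotate.corner hT hole hred with h4 | h4 | ⟨h4, h5, h6⟩
    on_goal 3 => exact hred (h.rotate.reducible_external hdisk hT h4 h5 h6)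
    all_goals
      rcases h.rotate.rotate.corner hT hole hred with h7 | h7 | ⟨h7, h8, h9⟩
      on_goal 3 => exact hred (h.rotate.rotate.reducible_external hdisk hT h7 h8 h9)
      all_goals exact hred (h.reducible_inner hT hole (by tauto) (by tauto) (by tauto))

end Octahedron

/-! ### Flags -/

/-- The link of `x` is an induced 4-cycle `p q r s` in which `p` and `q` have degree three. -/
structure FlagConfig (T : Finset (Finset V)) (x p q r s : V) : Prop where
  link : Link4 T x p q r s
  pr : ¬ Nb T p r
  qs : ¬ Nb T q s
  deg_p : deg T p = 3
  deg_q : deg T q = 3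

section Flag

variable {T : Finset (Finset V)} {x p q r s w : V} {F : Type v} [TopologicalSpace F]

theorem FlagConfig.reflect (h : FlagConfig T x p q r s) : FlagConfig T x q p s r :=
  ⟨h.link.reverse.rotate.rotate, h.qs, h.pr, h.deg_q, h.deg_p⟩

/-- The neighbors of `p` are exactly `s`, `x`, `q`, and `s`, `q` are not adjacent, so the link of
`p` is the path `s x q`. -/
theorem Link4.tri_of_deg_three (hT : Surf T) (h : Link4 T x p q r s) (hqs : ¬ Nb T q s)
    (hd3 : deg T p = 3) (c d : V) :
    Tri T p c d ↔ (c = s ∧ d = x) ∨ (c = x ∧ d = s) ∨ (c = x ∧ d = q) ∨ (c = q ∧ d = x) := by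
  have hd := h.distinct hT
  have f1 : Tri T p x q := h.ab.swap
  have f2 : Tri T p x s := h.da.rot.rot
  have hN := mem_of_nb_of_deg hT [s, x, q] (x := p) (by
      simp only [List.nodup_cons, List.mem_cons, List.not_mem_nil, or_false, List.nodup_nil]
      grind) (by
      intro c hc
      simp only [List.mem_cons, List.not_mem_nil, or_false] at hc
      rcases hc with rfl | rfl | rfl
      exacts [f2.swapRight.nb, f1.nb, f1.swapRight.nb]) (by simpa using hd3)
  simp only [List.mem_cons, List.not_mem_nil, or_false] at hN
  constructor
  · intro hc
    have := hN c hc.nb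
    have := hN d hc.swapRight.nb
    have := hT.distinct hc
    have h1 : c = q → d = s → Nb T q s := fun h h' => h ▸ h' ▸ hc.rot.nb
    have h2 : c = s → d = q → Nb T q s := fun h h' => h ▸ h' ▸ hc.rot.swap.nb
    grind
  · rintro (⟨rfl, rfl⟩ | ⟨rfl, rfl⟩ | ⟨rfl, rfl⟩ | ⟨rfl, rfl⟩)
    exacts [f2.swapRight, f2, f1, f1.swapRight]

theorem Link4.bd_of_deg_three (hT : Surf T) (h : Link4 T x p q r s) (hqs : ¬ Nb T q s)
    (hd3 : deg T p = 3) : Bd T p s ∧ Bd T p q := by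
  have hd := h.distinct hT
  have := h.tri_of_deg_three hT hqs hd3
  exact ⟨⟨x, by grind, fun w hw => by grind⟩, ⟨x, by grind, fun w hw => by grind⟩⟩

theorem FlagConfig.tri_p (hT : Surf T) (h : FlagConfig T x p q r s) (c d : V) :
    Tri T p c d ↔ (c = s ∧ d = x) ∨ (c = x ∧ d = s) ∨ (c = x ∧ d = q) ∨ (c = q ∧ d = x) :=
  h.link.tri_of_deg_three hT h.qs h.deg_p c d

theorem FlagConfig.bd_ps (hT : Surf T) (h : FlagConfig T x p q r s) : Bd T p s :=
  (h.link.bd_of_deg_three hT h.qs h.deg_p).1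

theorem FlagConfig.bd_pq (hT : Surf T) (h : FlagConfig T x p q r s) : Bd T p q :=
  (h.link.bd_of_deg_three hT h.qs h.deg_p).2

/-- The faces of the triangulation in which `x` and `p` are identified with `s`. -/
theorem FlagConfig.contract_twice (hT : Good T) (h : FlagConfig T x p q r s) :
    Surf (contract (contract T s x) s p) ∧
      Nonempty (realization T ≃ₜ realization (contract (contract T s x) s p)) ∧
      (∀ c d, Tri (contract (contract T s x) s p) q c d ↔ (c = s ∧ d = r) ∨ (c = r ∧ d = s)) ∧
      (∀ c d, Tri (contract (contract T s x) s p) s c d ↔ (c ≠ x ∧ c ≠ p ∧ d ≠ x ∧ d ≠ p) ∧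
        (Tri T s c d ∨ (c = q ∧ d = r) ∨ (c = r ∧ d = q))) ∧
      (∀ c d e, c ≠ s → d ≠ s → e ≠ s → (Tri (contract (contract T s x) s p) c d e ↔
        Tri T c d e ∧ (c ≠ x ∧ c ≠ p) ∧ (d ≠ x ∧ d ≠ p) ∧ (e ≠ x ∧ e ≠ p))) := by
  have hS := hT.surf
  obtain ⟨⟨d1, d2, d3, d4⟩, d5, d6, d7, d8, d9, d10⟩ := h.link.distinct hS
  have hp := h.tri_p hS
  have hq := h.reflect.tri_p hS
  have hx := h.link.tri_iff hS
  have hqs := h.qs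
  -- The vertex `x` is inner and shares only `p` and `r` with `s`, because `q s` is not an edge.
  have c1 : Collapsible T s x := hT.collapsible h.link.da.swap.nb (by
    intro c hsc hxc
    rcases h.link.nb hS c hxc with rfl | rfl | rfl | rfl
    · exact h.link.da.swap
    · exact absurd hsc.symm hqs
    · exact h.link.cd.rot.rot
    · obtain ⟨z, hz⟩ := hsc
      exact absurd rfl (hS.distinct hz).1) (Or.inl (h.link.inner hS))
  obtain ⟨hS1, ⟨e1⟩⟩ := c1.contract hS
  have s1 : ∀ c d, Tri (contract T s x) s c d ↔ _ := fun c d =>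
    tri_contract_new hS d4.symm (y := c) (z := d)
  have o1 : ∀ c d e, c ≠ s → d ≠ s → e ≠ s → (Tri (contract T s x) c d e ↔ _) := fun c d e =>
    tri_contract_old hS d4.symm
  have p1 : ∀ c d, Tri (contract T s x) p c d ↔ (c = s ∧ d = q) ∨ (c = q ∧ d = s) := by
    intro c d
    rw [tri_contract hS.card_face d4.symm, hp c d, hp x d]
    have : Tri T p c x ↔ Tri T p x c := ⟨Tri.swapRight, Tri.swapRight⟩
    rw [this, hp x c]
    grind
  have q1 : ∀ c d, Tri (contract T s x) q c d ↔ (c = s ∧ d = r) ∨ (c = r ∧ d = s) ∨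
      (c = s ∧ d = p) ∨ (c = p ∧ d = s) := by
    intro c d
    rw [tri_contract hS.card_face d4.symm, hq c d, hq x d]
    have : Tri T q c x ↔ Tri T q x c := ⟨Tri.swapRight, Tri.swapRight⟩
    rw [this, hq x c]
    grind
  -- By now `p` is an ear: its only face is `s p q`.
  have c2 : Collapsible (contract T s x) s p := by
    have hspq : Tri (contract T s x) s p q := ((p1 s q).2 (by simp)).swap
    refine ⟨hspq.nb, ?_, ?_, Or.inr ⟨q, hspq, fun w hw => ?_⟩, ?_⟩
    · rintro c ⟨d, hc⟩ ⟨d', hc'⟩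
      have := hS1.distinct hc
      have := (p1 _ _).1 hc'
      have : c = q := by grind
      subst this
      exact hspq
    · intro c d hc hc'
      have := hS1.distinct hc
      have := (p1 _ _).1 hc'
      grind
    · have := (p1 _ _).1 hw.swap
      grind
    · exact ⟨q, s, r, (q1 _ _).2 (by simp), by grind⟩
  obtain ⟨hS2, ⟨e2⟩⟩ := c2.contract hS1
  refine ⟨hS2, ⟨e1.trans e2⟩, ?_, ?_, ?_⟩
  · intro c d
    rw [tri_contract hS1.card_face d7.symm, q1 c d, q1 p d]
    have : Tri (contract T s x) q c p ↔ Tri (contract T s x) q p c :=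
      ⟨Tri.swapRight, Tri.swapRight⟩
    rw [this, q1 p c]
    grind
  · intro c d
    rw [tri_contract_new hS1 d7.symm, s1, p1, hx]
    have := @Surf.distinct _ _ _ hS s c d
    grind
  · intro c d e hc hd he
    rw [tri_contract_old hS1 d7.symm hc hd he, o1 c d e hc hd he]
    grind

/-- After the two contractions the flag has shrunk to the face `q s r`, with `q s` and `q r` on the
boundary. With `s r` on the boundary as well, `F` would be a disk. -/
theorem FlagConfig.exists_third
    (hdisk : IsEmpty (F ≃ₜ Metric.closedBall (0 : EuclideanSpace ℝ (Fin 2)) 1))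
    (hT : InClass F T) (h : FlagConfig T x p q r s) : ∃ w, Tri T s r w ∧ w ≠ x := by
  obtain ⟨hG, ⟨e⟩⟩ := inClass_iff.1 hT
  have hS := hG.surf
  obtain ⟨⟨d1, d2, d3, d4⟩, d5, d6, d7, d8, d9, d10⟩ := h.link.distinct hS
  obtain ⟨hS', ⟨e'⟩, hq, hs, -⟩ := h.contract_twice hG
  refine other_third h.link.cd.rot.swap fun ⟨z, hz, hu⟩ => ?_
  have hzx := hu x h.link.cd.rot.swap
  subst hzx
  obtain ⟨e''⟩ := single_face_homeomorph_ball hS' ((hq s r).2 (by simp))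
    (fun w hw => by have := (hq _ _).1 hw; grind) (fun w hw => by have := (hq _ _).1 hw; grind)
    (fun w hw => by
      have := (hs _ _).1 hw
      have := hu w
      grind)
  exact hdisk.false ((e.symm.trans e').trans e'')

theorem FlagConfig.third_ne (h : FlagConfig T x p q r s) (hw : Tri T s r w) :
    w ≠ p ∧ w ≠ q := by
  constructor <;> rintro rfl
  · exact h.pr hw.rot.swap.nb
  · exact h.qs hw.rot.rot.nb

/-- With the flag `s` loses `p` and `x`, so it needs five neighbors. If it had only `p`, `x`, `r`,
`w`, the boundary edge `s w` would be contractible and its sole third vertex `r` light; as a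
boundary vertex `r` would have degree three, but it is adjacent to `q`, `x`, `s`, `w`. -/
theorem FlagConfig.five_le_deg (hT : InClass F T) (hred : ¬ Reducible F T)
    (h : FlagConfig T x p q r s) (hw : Tri T s r w) (hwx : w ≠ x) : 5 ≤ deg T s := by
  have hG := (inClass_iff.1 hT).1
  have hS := hG.surf
  obtain ⟨⟨d1, d2, d3, d4⟩, d5, d6, d7, d8, d9, d10⟩ := h.link.distinct hS
  obtain ⟨hwp, hwq⟩ := h.third_ne hw
  have dw := hS.distinct hw
  have hp := h.tri_p hS
  have f1 : Tri T s p x := h.link.da.rot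
  have f2 : Tri T s r x := h.link.cd.rot.swap
  have hnd : [p, x, r, w].Nodup := by
    simp only [List.nodup_cons, List.mem_cons, List.not_mem_nil, or_false, List.nodup_nil]
    grind
  have hNs : ∀ c ∈ [p, x, r, w], Nb T s c := by
    intro c hc
    simp only [List.mem_cons, List.not_mem_nil, or_false] at hc
    rcases hc with rfl | rfl | rfl | rfl
    exacts [f1.nb, f1.swapRight.nb, f2.nb, hw.swapRight.nb]
  have h4 : 4 ≤ deg T s := card_le_deg hS _ hnd hNs
  by_contra! h5
  have hN := mem_of_nb_of_deg hS _ hnd hNs (by simp; omega)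
  simp only [List.mem_cons, List.not_mem_nil, or_false] at hN
  have hsw : Bd T s w := by
    refine ⟨r, hw.swapRight, fun v hv => by_contra fun hvr => ?_⟩
    have dv := hS.distinct hv
    rcases hN v hv.swapRight.nb with rfl | rfl | rfl | rfl
    · have := (hp _ _).1 hv.rot.rot
      grind
    · have := (h.link.tri_iff hS s w).1 hv.rot.rot
      grind
    · exact hvr rfl
    · exact dv.2.2 rfl
  obtain ⟨v, hv, hl⟩ := exists_light hT ⟨s, w, hsw⟩ hred hw.swapRight.nb (by
    rintro c hc ⟨d, hwc⟩
    rcases hN c hc with rfl | rfl | rfl | rfl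
    · have := (hp _ _).1 hwc.swap
      grind
    · have := h.link.nb hS w hwc.swap.nb
      grind
    · exact hw.swapRight
    · exact absurd rfl (hS.distinct hwc).1) (Or.inr hsw)
  have hvr : v = r := by
    obtain ⟨z, -, hz⟩ := hsw
    exact (hz v hv).trans (hz r hw.swapRight).symm
  subst hvr
  have := hl.deg_eq_of_bd (h.reflect.bd_ps hS).symm
  have : 4 ≤ deg T v := card_le_deg hS [q, x, s, w] (by
    simp only [List.nodup_cons, List.mem_cons, List.not_mem_nil, or_false, List.nodup_nil]
    grind) (by
    intro c hc
    simp only [List.mem_cons, List.not_mem_nil, or_false] at hc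
    rcases hc with rfl | rfl | rfl | rfl
    exacts [(h.reflect.bd_ps hS).symm.nb, f2.rot.nb, f2.swap.nb, hv.rot.swap.nb])
  omega

/-- What `contract_twice` leaves of the flag is an ear at `q`, and a third contraction into `s`
removes it. -/
theorem FlagConfig.surf_delete (hT : Good T) (h : FlagConfig T x p q r s)
    (hw : Tri T s r w) (hwx : w ≠ x) : Surf (deleteVertices T {p, q, x}) ∧
      Nonempty (realization T ≃ₜ realization (deleteVertices T {p, q, x})) := by
  have hS := hT.surf
  obtain ⟨⟨d1, d2, d3, d4⟩, d5, d6, d7, d8, d9, d10⟩ := h.link.distinct hS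
  obtain ⟨hwp, hwq⟩ := h.third_ne hw
  obtain ⟨hS2, ⟨e2⟩, hq, hs, ho⟩ := h.contract_twice hT
  have hqs := h.qs
  have c3 : Collapsible (contract (contract T s x) s p) s q := by
    have hsqr : Tri (contract (contract T s x) s p) s q r := ((hq s r).2 (by simp)).swap
    refine ⟨hsqr.nb, ?_, ?_, Or.inr ⟨r, hsqr, fun w hw => ?_⟩, ?_⟩
    · rintro c ⟨d, hc⟩ ⟨d', hc'⟩
      have := hS2.distinct hc
      have := (hq _ _).1 hc'
      have : c = r := by grind
      subst this
      exact hsqr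
    · intro c d hc hc'
      have := hS2.distinct hc
      have := (hq _ _).1 hc'
      grind
    · have := (hq _ _).1 hw.swap
      grind
    · exact ⟨s, r, w, (hs _ _).2 (by grind), by grind⟩
  obtain ⟨hS3, ⟨e3⟩⟩ := c3.contract hS2
  have heq : contract (contract (contract T s x) s p) s q = deleteVertices T {p, q, x} := by
    refine faces_ext_at hS3.card_face
      (fun t ht => hS.card_face t (Finset.mem_filter.1 ht).1) s ?_ ?_
    · intro y z
      rw [tri_contract_new hS2 d9.symm, hq, hs, tri_deleteVertices]
      have := @Surf.distinct _ _ _ hS s y z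
      simp only [Finset.mem_insert, Finset.mem_singleton]
      grind
    · intro y z w hy hz hw
      rw [tri_contract_old hS2 d9.symm hy hz hw, ho y z w hy hz hw, tri_deleteVertices]
      simp only [Finset.mem_insert, Finset.mem_singleton]
      grind
  rw [heq] at hS3 e3
  exact ⟨hS3, ⟨e2.trans e3⟩⟩

theorem FlagConfig.reducible
    (hdisk : IsEmpty (F ≃ₜ Metric.closedBall (0 : EuclideanSpace ℝ (Fin 2)) 1))
    (hT : InClass F T) (h : FlagConfig T x p q r s) : Reducible F T := by
  by_contra hred
  obtain ⟨w, hw, hwx⟩ := h.exists_third hdisk hT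
  have hs5 := h.five_le_deg hT hred hw hwx
  have hr5 := h.reflect.five_le_deg hT hred hw.swap hwx
  obtain ⟨hG, ⟨e⟩⟩ := inClass_iff.1 hT
  have hS := hG.surf
  obtain ⟨hS', ⟨e'⟩⟩ := h.surf_delete hG hw hwx
  obtain ⟨⟨d1, d2, d3, d4⟩, d5, d6, d7, d8, d9, d10⟩ := h.link.distinct hS
  obtain ⟨hwp, hwq⟩ := h.third_ne hw
  have hp := h.tri_p hS
  have hq := h.reflect.tri_p hS
  have hx := h.link.nb hS
  have hmem : ∀ {y z}, z ∈ neighbors T y ↔ Nb T y z := mem_neighbors hS.card_face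
  have hcard : ∀ y a b, (neighbors T y ∩ {p, q, x}) ⊆ {a, b} →
      (neighbors T y ∩ {p, q, x}).card ≤ 2 := fun y a b hsub =>
    (Finset.card_le_card hsub).trans Finset.card_le_two
  have hcs := hcard s p x (by
    intro c hc
    rw [Finset.mem_inter, hmem] at hc
    have := h.qs
    have : c = q → Nb T q s := fun h => h ▸ hc.1.symm
    grind)
  have hcr := hcard r q x (by
    intro c hc
    rw [Finset.mem_inter, hmem] at hc
    have := h.pr
    have : c = p → Nb T p r := fun h => h ▸ hc.1.symm
    grind)
  obtain ⟨hG', hlt, hbd⟩ := good_delete hG (S := {p, q, x}) (s := s) (t := r) hS'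
    (by grind) (by grind) (by
      intro y z hy hz hyz
      simp only [Finset.mem_insert, Finset.mem_singleton] at hy hz
      rcases hz with rfl | rfl | rfl
      · obtain ⟨d, hd⟩ := hyz.symm
        have := (hp _ _).1 hd
        grind
      · obtain ⟨d, hd⟩ := hyz.symm
        have := (hq _ _).1 hd
        grind
      · have := hx y hyz.symm
        grind) ⟨x, by simp, h.link.cd.rot.swap⟩ ⟨w, by grind, hw⟩ (by omega) (by omega)
  have hbe : ∀ {y z}, {y, z} ∈ boundaryEdges T ↔ Bd T y z := mem_boundaryEdges hS.card_face
  have hbv : ∀ {y}, y ∈ boundaryVertices T ↔ ∃ z, Bd T y z := mem_boundaryVertices hS.card_face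
  have hflag : IsFlag T x s p q r := by
    refine ⟨?_, h.link.deg_eq hS, ?_, ?_, ⟨h.link.da, h.link.ab, h.link.bc, h.link.cd⟩,
      ⟨hbe.2 (h.bd_ps hS).symm, hbe.2 (h.bd_pq hS), hbe.2 (h.reflect.bd_ps hS)⟩,
      ⟨?_, hbv.2 ⟨p, (h.bd_ps hS).symm⟩, hbv.2 ⟨q, (h.reflect.bd_ps hS).symm⟩⟩,
      h.deg_p, h.deg_q⟩
    · rw [hbv]
      rintro ⟨y, hy⟩
      exact h.link.inner hS y hy
    · ext c
      rw [hmem]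
      simp only [Finset.mem_insert, Finset.mem_singleton]
      refine ⟨fun hc => ?_, ?_⟩
      · have := hx c hc
        grind
      · rintro (rfl | rfl | rfl | rfl)
        exacts [h.link.da.nb, h.link.ab.nb, h.link.bc.nb, h.link.cd.nb]
    -- Independence: `p` and `q` have degree three, `s` and `r` at least five.
    · intro y hy
      have := h.deg_p
      have := h.deg_q
      rcases hx y (hmem.1 hy) with rfl | rfl | rfl | rfl <;> omega
    · rw [hbe]
      exact Surf.not_bd hw h.link.cd.rot.swap hwx
  exact hred ⟨_, ⟨inClass_iff.2 ⟨hG', ⟨e'.symm.trans e⟩⟩, hT, Or.inr (Or.inl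
    ⟨x, s, p, q, r, hflag, rfl⟩)⟩, hlt, s, r, hbd⟩

end Flag

/-! ### The case analysis -/

section Main

variable {T : Finset (Finset V)} {x p q r s a b y : V} {F : Type v} [TopologicalSpace F]

/-- Light inner vertices have degree four, so the links of `p` and `q` are 4-cycles as well; the
faces that they share with each other and with the link of `x` identify the remaining vertices. -/
theorem exists_octa (hT : Good T) (h : Link4 T x p q r s) (hp : Light T p) (hq : Light T q)
    (hp' : ∀ y, ¬ Bd T p y) (hq' : ∀ y, ¬ Bd T q y) : ∃ u, Octa T x p q u r s := by
  have hS := hT.surf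
  have hd : ∀ {v}, Light T v → (∀ y, ¬ Bd T v y) → deg T v = 4 := fun h h' =>
    h.elim (fun h => absurd h.1 (not_exists.2 h')) And.right
  obtain ⟨c, u, hpl⟩ := hT.exists_link4 hp' (hd hp hp') h.ab.rot
  have hcs : c = s :=
    (hS.third h.ab h.da.swapRight h.bd_ne hpl.bc.swap).resolve_left hpl.ac_ne.symm
  subst hcs
  obtain ⟨d, e, hql⟩ := hT.exists_link4 hq' (hd hq hq') h.ab.rot.rot
  have hdu : d = u :=
    (hS.third h.ab.rot hpl.da.swapRight hpl.bd_ne hql.bc.swap).resolve_left hql.ac_ne.symm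
  subst hdu
  have her : e = r :=
    (hS.third h.ab.swapRight h.bc h.ac_ne hql.da.rot.rot).resolve_left hql.bd_ne.symm
  subst her
  exact ⟨d, h, hpl, hql⟩

/-- A light boundary vertex has degree three, which makes `p q` a boundary edge. So `p` and `q` are
both on the boundary, giving a flag, or both inner, giving an octahedron. -/
theorem reducible_of_adjacent_light
    (hdisk : IsEmpty (F ≃ₜ Metric.closedBall (0 : EuclideanSpace ℝ (Fin 2)) 1))
    (hT : InClass F T) (hole : ∃ y z, Bd T y z) (h : Link4 T x p q r s) (hpr : ¬ Nb T p r)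
    (hqs : ¬ Nb T q s) (hp : Light T p) (hq : Light T q) : Reducible F T := by
  have hG := (inClass_iff.1 hT).1
  have hS := hG.surf
  by_cases hp' : ∃ y, Bd T p y
  · obtain ⟨y, hy⟩ := hp'
    have hp3 := hp.deg_eq_of_bd hy
    have hq3 := hq.deg_eq_of_bd (h.bd_of_deg_three hS hqs hp3).2.symm
    exact FlagConfig.reducible hdisk hT ⟨h, hpr, hqs, hp3, hq3⟩
  · by_cases hq' : ∃ y, Bd T q y
    · obtain ⟨y, hy⟩ := hq'
      exact absurd ⟨q, (h.reverse.rotate.rotate.bd_of_deg_three hS hpr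
        (hq.deg_eq_of_bd hy)).2.symm⟩ hp'
    · push Not at hp' hq'
      obtain ⟨u, hu⟩ := exists_octa hG h hp hq hp' hq'
      exact hu.reducible hdisk hT hole

/-- Because the diagonals are missing, each edge from `x` to a link vertex is contractible, with the
two neighbors of that vertex in the link as third vertices. So each opposite pair contains a light
vertex, and light vertices from different pairs are adjacent. -/
theorem reducible_of_link4
    (hdisk : IsEmpty (F ≃ₜ Metric.closedBall (0 : EuclideanSpace ℝ (Fin 2)) 1))
    (hT : InClass F T) (hole : ∃ y z, Bd T y z) (h : Link4 T x p q r s) (hpr : ¬ Nb T p r)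
    (hqs : ¬ Nb T q s) : Reducible F T := by
  by_contra hred
  have hS := (inClass_iff.1 hT).1.surf
  have key : ∀ {p q r s}, Link4 T x p q r s → ¬ Nb T p r → Light T q ∨ Light T s := by
    intro p q r s h hpr
    obtain ⟨v, hv, hl⟩ := exists_light hT hole hred h.ab.swap.nb (by
      intro c hpc hxc
      rcases h.nb hS c hxc with rfl | rfl | rfl | rfl
      · obtain ⟨z, hz⟩ := hpc
        exact absurd rfl (hS.distinct hz).1
      · exact h.ab.swap
      · exact absurd hpc hpr
      · exact h.da.rot.rot) (Or.inl (h.inner hS))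
    rcases hS.third h.ab h.da.swapRight h.bd_ne hv.swap with rfl | rfl
    exacts [Or.inl hl, Or.inr hl]
  have hrp : ¬ Nb T r p := fun h => hpr h.symm
  have hsq : ¬ Nb T s q := fun h => hqs h.symm
  rcases key h hpr with h1 | h1 <;> rcases key h.rotate hqs with h2 | h2
  · exact hred (reducible_of_adjacent_light hdisk hT hole h.rotate hqs hrp h1 h2)
  · exact hred (reducible_of_adjacent_light hdisk hT hole h hpr hqs h2 h1)
  · exact hred (reducible_of_adjacent_light hdisk hT hole h.rotate.rotate hrp hsq h2 h1)
  · exact hred (reducible_of_adjacent_light hdisk hT hole h.rotate.rotate.rotate hsq hpr h1 h2)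

/-- An edge `a y` would make `y` a common neighbor of `a` and `b`, hence `a b y` a face, and `b`
would have the triangular link `x a y`. -/
theorem not_nb_of_common (hT : Good T) (hcom : ∀ c, Nb T a c → Nb T b c → Tri T a b c)
    (h : Tri T x a b) (hy : Tri T x b y) : ¬ Nb T a y := fun ha =>
  hT.no_triangle_link h.rot.swap hy.swap (hcom y ha hy.rot.nb).rot

/-- The link of `x` is the path `a b y`, so `x a` is a contractible boundary edge with sole third
vertex `b`, and `b` is light. It turns out to be inner of degree four, so `x b` is contractible too,
and `a` or `y` is light. Lying on the boundary, that vertex has degree three like `x`, and the two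
form a flag around `b`. -/
theorem reducible_of_boundary_light
    (hdisk : IsEmpty (F ≃ₜ Metric.closedBall (0 : EuclideanSpace ℝ (Fin 2)) 1))
    (hT : InClass F T) (hole : ∃ y z, Bd T y z)
    (hcom : ∀ c, Nb T a c → Nb T b c → Tri T a b c) (h : Tri T x a b) (hd : deg T x = 3)
    (hy : Tri T x b y) (hya : y ≠ a) : Reducible F T := by
  by_contra hred
  have hG := (inClass_iff.1 hT).1
  have hS := hG.surf
  have hnay := not_nb_of_common hG hcom h hy
  have d1 := hS.distinct h
  have d2 := hS.distinct hy
  have hN := mem_of_nb_of_deg hS [a, b, y] (x := x) (by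
      simp only [List.nodup_cons, List.mem_cons, List.not_mem_nil, or_false, List.nodup_nil]
      grind) (by
      intro c hc
      simp only [List.mem_cons, List.not_mem_nil, or_false] at hc
      rcases hc with rfl | rfl | rfl
      exacts [h.nb, hy.nb, hy.swapRight.nb]) (by simpa using hd)
  simp only [List.mem_cons, List.not_mem_nil, or_false] at hN
  have hxa : ∀ v, Tri T x a v → v = b := by
    intro v hv
    rcases hN v hv.swapRight.nb with rfl | rfl | rfl
    · exact absurd rfl (hS.distinct hv).2.2
    · rfl
    · exact absurd hv.rot.nb hnay
  have hxy : ∀ v, Tri T x y v → v = b := by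
    intro v hv
    rcases hN v hv.swapRight.nb with rfl | rfl | rfl
    · exact absurd hv.rot.swap.nb hnay
    · rfl
    · exact absurd rfl (hS.distinct hv).2.2
  have bxa : Bd T x a := ⟨b, h, hxa⟩
  obtain ⟨v, hv, hl⟩ := exists_light hT hole hred h.nb (by
    rintro c hc ⟨d, hac⟩
    rcases hN c hc with rfl | rfl | rfl
    · exact absurd rfl (hS.distinct hac).1
    · exact h
    · exact absurd hac.nb hnay) (Or.inr bxa)
  have hvb := hxa v hv
  subst hvb
  -- If `b` had degree three, its neighbors `x`, `a`, `y` would leave no second face on `a b`, and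
  -- `a` would have degree two.
  rcases hl with ⟨-, hl⟩ | ⟨hin, hl⟩
  · have hNb := mem_of_nb_of_deg hS [x, a, y] (x := v) (by
      simp only [List.nodup_cons, List.mem_cons, List.not_mem_nil, or_false, List.nodup_nil]
      grind) (by
      intro c hc
      simp only [List.mem_cons, List.not_mem_nil, or_false] at hc
      rcases hc with rfl | rfl | rfl
      exacts [h.rot.rot.nb, h.rot.swap.nb, hy.rot.nb]) (by simpa using hl)
    simp only [List.mem_cons, List.not_mem_nil, or_false] at hNb
    rcases hG.third_of_nb h.swap with ⟨w, hw, hwv⟩ | ⟨w, hw, hwx⟩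
    · exact hwv (hxa w hw.swap)
    · rcases hNb w hw.rot.nb with rfl | rfl | rfl
      · exact hwx rfl
      · exact (hS.distinct hw).2.1 rfl
      · exact hnay hw.swapRight.nb
  · obtain ⟨c, w, hl4⟩ := hG.exists_link4 hin hl h.rot.swap
    have hcy : c = y :=
      (hS.third h.swapRight hy hya.symm hl4.bc.swap).resolve_left hl4.ac_ne.symm
    subst hcy
    have dl := hl4.distinct hS
    have hxw : ¬ Nb T x w := by
      intro hn
      have := hN w hn
      grind
    obtain ⟨z, hz, hzl⟩ := exists_light hT hole hred hy.nb (by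
      rintro e he ⟨d, hve⟩
      rcases hN e he with rfl | rfl | rfl
      · exact h.swapRight
      · exact absurd rfl (hS.distinct hve).1
      · exact hy) (Or.inl hin)
    rcases hS.third h.swapRight hy hya.symm hz with rfl | rfl
    · exact hred (FlagConfig.reducible hdisk hT ⟨hl4, hnay, hxw, hzl.deg_eq_of_bd bxa.symm, hd⟩)
    · have byx : Bd T z x := Bd.symm ⟨v, hy.swapRight, hxy⟩
      exact hred (FlagConfig.reducible hdisk hT ⟨hl4.rotate, hxw, fun h => hnay h.symm, hd,
        hzl.deg_eq_of_bd byx⟩)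

/-- The light vertex beside the edge decides the case. For a boundary one, `third_of_nb` tells on
which side its second face lies; for an inner one, the absence of critical 3-cycles through `a b`
makes the link an induced 4-cycle. -/
theorem reducible_of_contractible
    (hdisk : IsEmpty (F ≃ₜ Metric.closedBall (0 : EuclideanSpace ℝ (Fin 2)) 1))
    (hT : InClass F T) (hole : ∃ y z, Bd T y z) (h : Contractible F T a b) : Reducible F T := by
  by_contra hred
  obtain ⟨x, hx, hl⟩ := exists_light_of_contractible hT hole hred h
  have hG := (inClass_iff.1 hT).1
  have hc := hG.surf.card_face
  have hcom : ∀ c, Nb T a c → Nb T b c → Tri T a b c := fun c h1 h2 =>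
    h.2.2.1 c ((mem_neighbors hc).2 h1) ((mem_neighbors hc).2 h2)
  have hcom' : ∀ c, Nb T b c → Nb T a c → Tri T b a c := fun c h1 h2 => (hcom c h2 h1).swap
  rcases hl with ⟨-, hd⟩ | ⟨hin, hd⟩
  · rcases hG.third_of_nb hx.rot.rot with ⟨y, hy, hyb⟩ | ⟨y, hy, hya⟩
    · exact hred (reducible_of_boundary_light hdisk hT hole hcom' hx.rot.rot.swapRight hd hy hyb)
    · exact hred (reducible_of_boundary_light hdisk hT hole hcom hx.rot.rot hd hy hya)
  · obtain ⟨y, z, hl4⟩ := hG.exists_link4 hin hd hx.rot.rot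
    exact hred (reducible_of_link4 hdisk hT hole hl4 (not_nb_of_common hG hcom hl4.ab hl4.bc)
      (not_nb_of_common hG hcom' hl4.ab.swapRight hl4.da.swapRight))

/-- Induction on a bound for the number of faces; the existence of a boundary is carried along
because each reduction needs it. -/
theorem exists_irreducible
    (hdisk : IsEmpty (F ≃ₜ Metric.closedBall (0 : EuclideanSpace ℝ (Fin 2)) 1)) (n : ℕ)
    (T : Finset (Finset V)) (hn : T.card ≤ n) (hT : InClass F T) (hole : ∃ y z, Bd T y z) :
    ∃ T₀ : Finset (Finset V), InClass F T₀ ∧ Irreducible F T₀ ∧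
      Relation.ReflTransGen (Step F) T₀ T := by
  induction n generalizing T with
  | zero =>
    obtain ⟨y, z, w, hw, -⟩ := hole
    exact absurd (Finset.card_pos.2 ⟨_, hw⟩) (by omega)
  | succ n ih =>
    by_cases hirr : Irreducible F T
    · exact ⟨T, hT, hirr, Relation.ReflTransGen.refl⟩
    · unfold Irreducible at hirr
      push Not at hirr
      obtain ⟨a, b, hab⟩ := hirr
      obtain ⟨T', hstep, hlt, hole'⟩ := reducible_of_contractible hdisk hT hole hab
      obtain ⟨T₀, h1, h2, h3⟩ := ih T' (by omega) hstep.1 hole'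
      exact ⟨T₀, h1, h2, h3.tail hstep⟩

end Main

end SurfaceTriangulation

open SurfaceTriangulation in
/-- Every triangulation in the class of a punctured surface `F` other than the disk is obtained
from an irreducible triangulation of `F` (in the class) by a finite sequence of the four kinds of
operations, all triangulations on the way being triangulations of `F` in the class. -/
theorem theorem1 {V : Type*} [DecidableEq V] (F : Type*) [TopologicalSpace F]
    (hdisk : IsEmpty (F ≃ₜ Metric.closedBall (0 : EuclideanSpace ℝ (Fin 2)) 1))
    (T : Finset (Finset V)) (hT : InClass F T) (hole : HasOneHole T) :
    ∃ T₀ : Finset (Finset V), InClass F T₀ ∧ Irreducible F T₀ ∧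
      Relation.ReflTransGen (Step F) T₀ T :=
  exists_irreducible hdisk T.card T le_rfl hT
    ((boundaryEdges_nonempty hT.1.1.card_face).1 hole.1)
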